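/- **Setting.** Let $\mathbb G$ be a Carnot group of step $s\ge 1$, i.e. a connected, simply connected Lie group whose Lie algebra has a stratification $\mathfrak g=V_1\oplus\cdots\oplus V_s$ with $[V_j,V_1]=V_{j+1}$ for $1\le j\le s$, $V_s\neq\{0\}$, $V_{s+1}=\{0\}$. As usual, $\mathbb G$ is identified with $\mathfrak g$ through the exponential map (a diffeomorphism), so that the product is given by the Baker–Campbell–Hausdorff formula, the identity is $e=0$ and $x^{-1}=-x$. For $\lambda>0$ let $\delta_\lambda\bigl(\sum_j v_j\bigr)=\sum_j\lambda^j v_j$ ($v_j\in V_j$) be the intrinsic dilations. Fix an inner product on $V_1$ and an orthonormal basis $X_1,\dots,X_k$ of $V_1$, regarded as left invariant vector fields, and let $d$ be the Carnot–Carathéodory distance $$d^2(x,y)=\inf\Bigl\{\int_0^1\sum_{i=1}^k|a_i(t)|^2\,dt\Bigr\},$$ the infimum being over all Lipschitz curves $\gamma:[0,1]\to\mathbb G$ with $\gamma(0)=x$, $\gamma(1)=y$ and $\gamma'(t)=\sum_i a_i(t)(X_i)_{\gamma(t)}$ for a.e. $t$. Let $B_r(x)$ be the open $d$-balls. An $\mathbb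 R^m$-valued Radon measure $\mu$ on $\mathbb G$ is a $\sigma$-additive function, with values in $\mathbb R^m$, on the bounded Borel sets; its total variation $|\mu|$ is the smallest nonnegative Borel measure with $|\mu|(B)\ge|\mu(B)|$ (Euclidean norm) for all bounded Borel sets $B$. Weak$^*$ convergence $\mu_h\to\mu$ means $\int u\,d\mu_h\to\int u\,d\mu$ for all $u\in C_c(\mathbb G)$. For a nonnegative Borel measure $\sigma$, $\operatorname{supp}\sigma=\{x:\ \sigma(B_r(x))>0\ \ \forall r>0\}$. Let $q\in\mathbb R$. The measure $\mu$ is *asymptotically $q$-regular* if $$0<\liminf_{r\downarrow0}\frac{|\mu|(B_r(x))}{r^q}\le\limsup_{r\downarrow0}\frac{|\mu|(B_r(x))}{r^q}<+\infty\qquad\text{for }|\mu|\text{-a.e. }x\in\mathbb G .$$ Put $I_{x,r}(y)=\delta_{1/r}(x^{-1}y)$. For an $\mathbb R^m$-valued Radon measure $\mu$ and $x\in\mathbb G$, let $\operatorname{Tan}(\mu,x)$ be the set of all $\mathbb R^m$-valued Radon measures $\nu$ for which there are $r_i>0$ with $r_i\to0$ and $r_i^{-q}(I_{x,r_i})_\sharp\mu\to\nu$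 weakly$^*$ (the same exponent $q$ is used for all measures). **Theorem.** Let $m\in\mathbb N$ and let $\mu$ be an $\mathbb R^m$-valued Radon measure on $\mathbb G$ that is asymptotically $q$-regular. Then, for $|\mu|$-a.e. $x\in\mathbb G$, $$\operatorname{Tan}(\nu,y)\subseteq\operatorname{Tan}(\mu,x)\qquad\text{for all }\nu\in\operatorname{Tan}(\mu,x)\text{ and all }y\in\operatorname{supp}|\nu| .$$ -/

import Mathlib

open MeasureTheory Filter Set
open scoped Topology ENNReal NNReal

/-! ### Real Lie algebras carrying a norm

On a finite-dimensional space all norms are equivalent. The norm below is used only for the vector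
space topology, for derivatives of curves and for the class of Lipschitz curves, and no
compatibility between norm and bracket is required. -/

/-- A Lie ring with a norm on its additive group. -/
class NormedLieRing (𝔤 : Type*) extends NormedAddCommGroup 𝔤, LieRing 𝔤

/-- A real Lie algebra with a norm on its vector space. -/
class NormedLieAlgebra (𝔤 : Type*) [NormedLieRing 𝔤] extends NormedSpace ℝ 𝔤, LieAlgebra ℝ 𝔤

/-- A stratification `𝔤 = V₁ ⊕ ⋯ ⊕ V_s` of step `s ≥ 1`: `[V_j, V₁] = V_{j+1}` for `j ≥ 1`,
`V_s ≠ 0`, `V_{s+1} = 0`. The layers are indexed by `ℕ`, with `V₀ = 0` and `V_j = 0` for `j > s`. -/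
structure Stratification (𝔤 : Type*) [LieRing 𝔤] [LieAlgebra ℝ 𝔤] where
  /-- the step `s` -/
  step : ℕ
  /-- the layers `V_j` -/
  V : ℕ → Submodule ℝ 𝔤
  one_le_step : 1 ≤ step
  layer_zero : V 0 = ⊥
  layer_eq_bot : ∀ j, step < j → V j = ⊥
  layer_step_ne_bot : V step ≠ ⊥
  isInternal : DirectSum.IsInternal V
  span_lie : ∀ j, 1 ≤ j → Submodule.span ℝ {z | ∃ x ∈ V j, ∃ y ∈ V 1, ⁅x, y⁆ = z} = V (j + 1)

/-! ### The Carnot group of a stratified Lie algebra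

The connected and simply connected Lie group with Lie algebra `𝔤` is realised in exponential
coordinates: its underlying manifold is `𝔤`, `exp` is the identity map, the identity element is `0`,
the inverse of `x` is `-x`, and the product is given by the Baker-Campbell-Hausdorff formula. -/

namespace Stratification

noncomputable section

section Algebra

variable {𝔤 : Type*} [LieRing 𝔤] [LieAlgebra ℝ 𝔤] (S : Stratification 𝔤)

/-- The projection of `𝔤 = ⊕ V_j` onto the layer `V_j`. -/
def proj (j : ℕ) : 𝔤 →ₗ[ℝ] 𝔤 :=
  (S.V j).subtype ∘ₗ DirectSum.component ℝ ℕ (fun i => S.V i) j ∘ₗ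
    (LinearEquiv.ofBijective (DirectSum.coeLinearMap S.V) S.isInternal).symm.toLinearMap

/-- The dilation `δ_c (∑ v_j) = ∑ c ^ j v_j`. As `exp` is the identity in the present coordinates,
this is the dilation both of the Lie algebra and of the group. -/
def dil (c : ℝ) (x : 𝔤) : 𝔤 := ∑ j ∈ Finset.range (S.step + 1), c ^ j • S.proj j x

/-- The exponential series of `ad x`, cut at the step: `(ad x) ^ s = 0`, as `𝔤` is nilpotent of
step `s`. -/
def expAd (x : 𝔤) : Module.End ℝ 𝔤 :=
  ∑ k ∈ Finset.range S.step, ((k.factorial : ℝ)⁻¹) • (LieAlgebra.ad ℝ 𝔤 x) ^ k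

/-- The function `ψ z = z log z / (z - 1) = z ∑ₖ (-1) ^ k (z - 1) ^ k / (k + 1)` of an
endomorphism, with the series cut at the step. It is used only for `z` the product of two
exponentials `e ^ (ad x)`, in which case `(z - 1) ^ s = 0`. -/
def bchPsi (z : Module.End ℝ 𝔤) : Module.End ℝ 𝔤 :=
  z * ∑ k ∈ Finset.range S.step, ((-1 : ℝ) ^ k / ((k : ℝ) + 1)) • (z - 1) ^ k

end Algebra

variable {𝔤 : Type*} [NormedLieRing 𝔤] [NormedLieAlgebra 𝔤] (S : Stratification 𝔤)

/-- The group product `log (exp x exp y)`, by the Baker-Campbell-Hausdorff formula in integral form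
`log (exp x exp y) = x + ∫₀¹ ψ (e ^ (ad x) e ^ (t ad y)) y dt`
`= x + y + [x, y] / 2 + [x, [x, y]] / 12 - [y, [x, y]] / 12 + ⋯`. -/
def mul (x y : 𝔤) : 𝔤 :=
  x + ∫ t in (0 : ℝ)..1, S.bchPsi (S.expAd x * S.expAd (t • y)) y

/-- The value at the point `g` of the left invariant vector field `v`, that is, the derivative at
`t = 0` of `g exp (t v)`. -/
def leftInvariantField (v g : 𝔤) : 𝔤 := deriv (fun t : ℝ => S.mul g (t • v)) 0

/-- `γ` is, on `[0, 1]`, a Lipschitz curve from `x` to `y` with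
`γ' = ∑ a_i (X_i)_γ` almost everywhere. -/
def IsHorizontal {k : ℕ} (X : Module.Basis (Fin k) ℝ (S.V 1)) (x y : 𝔤)
    (γ : ℝ → 𝔤) (a : ℝ → Fin k → ℝ) : Prop :=
  γ 0 = x ∧ γ 1 = y ∧ (∃ K : ℝ≥0, LipschitzOnWith K γ (Icc 0 1)) ∧
    ∀ᵐ t ∂(volume.restrict (Icc (0 : ℝ) 1)),
      HasDerivAt γ (∑ i, a t i • S.leftInvariantField (X i : 𝔤) (γ t)) t

/-- The Carnot-Carathéodory distance: `d ^ 2 (x, y)` is the infimum of `∫₀¹ ∑ |a_i| ^ 2 dt` over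
all horizontal curves from `x` to `y`. The basis `X` of `V₁` is the one that is orthonormal for
the chosen inner product of `V₁`. -/
def ccDist {k : ℕ} (X : Module.Basis (Fin k) ℝ (S.V 1)) (x y : 𝔤) : ℝ≥0∞ :=
  (⨅ (γ : ℝ → 𝔤) (a : ℝ → Fin k → ℝ) (_ : S.IsHorizontal X x y γ a),
    ∫⁻ t in Icc (0 : ℝ) 1, ENNReal.ofReal (∑ i, |a t i| ^ 2)) ^ (1 / 2 : ℝ)

/-- The open Carnot-Carathéodory ball `B_r(x)`. -/
def ccBall {k : ℕ} (X : Module.Basis (Fin k) ℝ (S.V 1)) (x : 𝔤) (r : ℝ) : Set 𝔤 :=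
  {y | S.ccDist X x y < ENNReal.ofReal r}

/-- The blow-up map `I_{x,r} y = δ_{1/r} (x⁻¹ y)`. -/
def blowUp (x : 𝔤) (r : ℝ) (y : 𝔤) : 𝔤 := S.dil (1 / r) (S.mul (-x) y)

end

end Stratification

/-! ### Vector-valued Radon measures -/

/-- Bounded Borel sets of a locally compact space: Borel sets with compact closure. In a Carnot group
these are the Borel sets that are bounded for the Carnot-Carathéodory distance. -/
def IsBddBorel {G : Type*} [TopologicalSpace G] [MeasurableSpace G] (B : Set G) : Prop :=
  MeasurableSet B ∧ IsCompact (closure B)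

/-- An `F`-valued Radon measure: a σ-additive set function on bounded Borel sets, with the value `0`
by convention on all other sets. Its total variation may be infinite on the whole space. -/
structure VectorRadonMeasure (G : Type*) [TopologicalSpace G] [MeasurableSpace G]
    (F : Type*) [NormedAddCommGroup F] where
  /-- the measure of bounded Borel sets -/
  toFun : Set G → F
  toFun_eq_zero : ∀ B, ¬ IsBddBorel B → toFun B = 0
  hasSum_iUnion : ∀ B : ℕ → Set G, (∀ i, MeasurableSet (B i)) → Pairwise (Function.onFun Disjoint B) →
    IsCompact (closure (⋃ i, B i)) → HasSum (fun i => toFun (B i)) (toFun (⋃ i, B i))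

namespace VectorRadonMeasure

noncomputable section

variable {G : Type*} [TopologicalSpace G] [MeasurableSpace G]
  {F : Type*} [NormedAddCommGroup F]

@[ext]
theorem ext {μ ν : VectorRadonMeasure G F} (h : ∀ B, μ.toFun B = ν.toFun B) : μ = ν := by
  cases μ; cases ν; congr; exact funext h

instance : Zero (VectorRadonMeasure G F) :=
  ⟨{ toFun := fun _ => 0
     toFun_eq_zero := fun _ _ => rfl
     hasSum_iUnion := fun _ _ _ _ => hasSum_zero }⟩

instance [NormedSpace ℝ F] : SMul ℝ (VectorRadonMeasure G F) :=
  ⟨fun c μ =>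
    { toFun := fun B => c • μ.toFun B
      toFun_eq_zero := fun B hB => by rw [μ.toFun_eq_zero B hB, smul_zero]
      hasSum_iUnion := fun B h1 h2 h3 => (μ.hasSum_iUnion B h1 h2 h3).const_smul c }⟩

/-- The restriction `B ↦ μ (B ∩ K)` to a bounded Borel set `K`, a finite vector measure. -/
def restrict (μ : VectorRadonMeasure G F) (K : Set G) (hK : IsBddBorel K) : VectorMeasure G F := by
  classical
  have hsub : ∀ A : Set G, IsCompact (closure (A ∩ K)) := fun A =>
    hK.2.of_isClosed_subset isClosed_closure (closure_mono inter_subset_right)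
  exact
  { measureOf' := fun A => if MeasurableSet A then μ.toFun (A ∩ K) else 0
    empty' := by
      have h := μ.hasSum_iUnion (fun _ => ∅) (fun _ => MeasurableSet.empty)
        (fun _ _ _ => disjoint_bot_left) (by simp)
      have h0 : μ.toFun ∅ = 0 := by
        simpa using tendsto_nhds_unique h.summable.tendsto_atTop_zero tendsto_const_nhds |>.symm
      simp [h0]
    not_measurable' := fun A hA => if_neg hA
    m_iUnion' := fun A hA hd => by
      have h := μ.hasSum_iUnion (fun i => A i ∩ K) (fun i => (hA i).inter hK.1)
        (fun i j hij => (hd hij).mono inter_subset_left inter_subset_left)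
        (by rw [← iUnion_inter]; exact hsub _)
      rw [← iUnion_inter] at h
      simpa [hA, MeasurableSet.iUnion hA] using h }

/-- The total variation `|μ|`: the smallest nonnegative Borel measure `σ` such that `|μ(B)| ≤ σ(B)`
for all bounded Borel sets `B`. -/
def variation (μ : VectorRadonMeasure G F) : Measure G :=
  sInf {σ : Measure G | ∀ B, IsBddBorel B → ‖μ.toFun B‖ₑ ≤ σ B}

/-- The push-forward `(f_# μ)(B) = μ (f⁻¹ B)` under a proper Borel map, that is, one for which the
preimages of bounded Borel sets are bounded Borel sets (and `0` by convention for other maps). -/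
def map (f : G → G) (μ : VectorRadonMeasure G F) : VectorRadonMeasure G F := by
  classical
  exact
  if h : Measurable f ∧ ∀ B, IsBddBorel B → IsBddBorel (f ⁻¹' B) then
    { toFun := fun B => if IsBddBorel B then μ.toFun (f ⁻¹' B) else 0
      toFun_eq_zero := fun B hB => if_neg hB
      hasSum_iUnion := fun B h1 h2 h3 => by
        have hU : IsBddBorel (⋃ i, B i) := ⟨MeasurableSet.iUnion h1, h3⟩
        have hB : ∀ i, IsBddBorel (B i) := fun i =>
          ⟨h1 i, h3.of_isClosed_subset isClosed_closure (closure_mono (subset_iUnion B i))⟩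
        have h4 := μ.hasSum_iUnion (fun i => f ⁻¹' (B i)) (fun i => h.1 (h1 i))
          (fun i j hij => (h2 hij).preimage f)
          (by rw [← preimage_iUnion]; exact (h.2 _ hU).2)
        rw [← preimage_iUnion] at h4
        simpa [hB, hU] using h4 }
  else 0

variable [OpensMeasurableSpace G] [NormedSpace ℝ F]

/-- The integral `∫ u dμ` of a continuous function with compact support. -/
def integral (μ : VectorRadonMeasure G F) (u : CompactlySupportedContinuousMap G ℝ) : F :=
  (μ.restrict (tsupport u) ⟨(isClosed_tsupport u).measurableSet, by
    rw [(isClosed_tsupport u).closure_eq]; exact u.hasCompactSupport⟩).integral u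
    (ContinuousLinearMap.lsmul ℝ ℝ)

/-- Weak-* convergence `μ_h → μ` in duality with `C_c(G)`. -/
def WeakStarTendsto (μs : ℕ → VectorRadonMeasure G F) (μ : VectorRadonMeasure G F) : Prop :=
  ∀ u : CompactlySupportedContinuousMap G ℝ,
    Tendsto (fun h => (μs h).integral u) atTop (𝓝 (μ.integral u))

end

end VectorRadonMeasure

/-! ### Regularity, support and tangent measures in a Carnot group -/

namespace Stratification

variable {𝔤 : Type*} [NormedLieRing 𝔤] [NormedLieAlgebra 𝔤] [MeasurableSpace 𝔤]
  (S : Stratification 𝔤) {F : Type*} [NormedAddCommGroup F]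

/-- `supp σ`: the points all of whose Carnot-Carathéodory balls have positive measure. -/
def supp {k : ℕ} (X : Module.Basis (Fin k) ℝ (S.V 1)) (σ : Measure 𝔤) : Set 𝔤 :=
  {x | ∀ r : ℝ, 0 < r → 0 < σ (S.ccBall X x r)}

/-- Asymptotic `q`-regularity: for `|μ|`-a.e. `x`, the lower and upper limits of
`|μ|(B_r(x)) / r ^ q` as `r ↓ 0` are positive and finite. -/
def AsymptoticallyRegular {k : ℕ} (X : Module.Basis (Fin k) ℝ (S.V 1)) (q : ℝ)
    (μ : VectorRadonMeasure 𝔤 F) : Prop :=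
  ∀ᵐ x ∂μ.variation,
    0 < liminf (fun r : ℝ => μ.variation (S.ccBall X x r) / ENNReal.ofReal (r ^ q)) (𝓝[>] 0) ∧
    limsup (fun r : ℝ => μ.variation (S.ccBall X x r) / ENNReal.ofReal (r ^ q)) (𝓝[>] 0) < ∞

/-- `Tan(μ, x)`: the weak-* limits of `r_i ^ (-q) (I_{x,r_i})_# μ` along sequences `r_i ↓ 0`. -/
def Tan [OpensMeasurableSpace 𝔤] [NormedSpace ℝ F] (q : ℝ) (μ : VectorRadonMeasure 𝔤 F) (x : 𝔤) :
    Set (VectorRadonMeasure 𝔤 F) :=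
  {ν | ∃ r : ℕ → ℝ, (∀ i, 0 < r i) ∧ Tendsto r atTop (𝓝 0) ∧
    VectorRadonMeasure.WeakStarTendsto
      (fun i => (r i) ^ (-q) • VectorRadonMeasure.map (S.blowUp x (r i)) μ) ν}

end Stratification

/-! Write μ_{x,r} for the rescaling r^(-q) (I_{x,r})_# μ. Rescalings compose: μ_{x',rs} with x' = x
· δ_r y is the rescaling of μ_{x,r} at y with scale s (`rescale_mul_dil_integral`). Hence, if
μ_{x,r_i} → ν, then ν_{y,s} is a limit of rescalings of μ, but about the moving centres x · δ_{r_i}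
y. The point is to replace these by rescalings about x itself, for almost every x.

Fix finitely many test functions and a vector c of approximate values. Let A be the set of points x
that have a tangent measure ν, a point y of its support and a scale s with ν_{y,s} close to c, while
no μ_{x,r} with r small is close to c. Almost every point of A is a density point of a measurable
hull T of A, in the sense that |μ|(B_r(x) \ T) = o(r^q) (`ae_density`). At such a point ν charges
every neighbourhood of y, so A must meet x · δ_{r_i} O for each neighbourhood O of y: otherwise all
the mass there would lie outside T and vanish in the limit (`eventually_exists_mul_dil_mem`). This
gives x' = x · δ_{r_i} y' in A with y' near y, and by equicontinuity μ_{x',r_i s} is close to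
ν_{y,s}, hence to c (`exists_mem_rescale_close`), which contradicts x' ∈ A. So A is null. Countably
many test functions and vectors c suffice, and a diagonal choice of radii ends the proof
(`ae_Tan_subset_Tan`). Finite upper density takes the place of a doubling condition, both in the
Vitali covering argument and in the equicontinuity.

Two foundations are needed. First, the Baker-Campbell-Hausdorff integral must be shown to be a
smooth group law. The adjoint action on 𝔤 extended by the degree derivation is faithful and
nilpotent; differentiating the logarithm of exp x exp(ty) identifies the product with that of
unipotent operators (`rep_mul`, `toUnipotent_mul`). Second, Carnot-Carathéodory balls must be
comparable with balls of a continuous homogeneous gauge, which are visibly open and relatively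
compact (`exists_ccBall_comparison`). Here one inclusion rests on the fact that the first layer
generates the group (`isWord`), the other on an energy estimate (`exists_ccBall_subset_ball`). -/

/-! ### The logarithm of unipotent elements of a Banach algebra -/

section TruncatedLog

/-- The coefficients `(-1) ^ k / (k + 1)` of the logarithmic series. -/
noncomputable def logCoeff (k : ℕ) : ℝ := (-1) ^ k / ((k : ℝ) + 1)

theorem logCoeff_mul_succ (k : ℕ) : logCoeff k * ((k : ℝ) + 1) = (-1) ^ k := by
  unfold logCoeff
  have : (k : ℝ) + 1 ≠ 0 := by positivity
  field_simp

/-- The exponential series, cut after `n` terms. -/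
noncomputable def truncExp {E : Type*} [Ring E] [Module ℝ E] (n : ℕ) (T : E) : E :=
  ∑ k ∈ Finset.range n, ((k.factorial : ℝ)⁻¹) • T ^ k

/-- The sum `∑ L ^ i * R ^ (n - 1 - i)` over `i < n`, which for commuting `L` and `R` is the divided
difference of the `n`-th power. -/
def powDiff {E : Type*} [Semiring E] (L R : E) : ℕ → E
  | 0 => 0
  | n + 1 => L * powDiff L R n + R ^ n

variable {E : Type*} [NormedRing E] [NormedAlgebra ℝ E]

theorem smul_pow_eq_zero (a : ℝ) {T : E} {n : ℕ} (h : T ^ n = 0) : (a • T) ^ n = 0 := by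
  rw [smul_pow, h, smul_zero]

theorem smul_mul_powDiff {R H : E} (h : Commute R H) (θ : ℝ) (n : ℕ) :
    θ • (H * powDiff (R + θ • H) R n) = (R + θ • H) ^ n - R ^ n := by
  induction n with
  | zero => simp [powDiff]
  | succ n ih =>
    have hc : Commute H (R + θ • H) := h.symm.add_right ((Commute.refl H).smul_right θ)
    have e : θ • (H * powDiff (R + θ • H) R (n + 1)) =
        (R + θ • H) * (θ • (H * powDiff (R + θ • H) R n)) + (θ • H) * R ^ n := by
      simp only [powDiff, mul_add, smul_add, mul_smul_comm, smul_mul_assoc, ← mul_assoc, hc.eq]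
    rw [e, ih]
    simp only [mul_sub, pow_succ', add_mul]
    abel

/-- Formally the function is ((R + θH)^(k+1) - R^(k+1)) / H. In the application H is nilpotent and
cannot be cancelled, so the derivative is computed by induction through the recursion of `powDiff`.
-/
theorem hasDerivAt_smul_powDiff {R H : E} (h : Commute R H) (k : ℕ) (θ : ℝ) :
    HasDerivAt (fun θ : ℝ => θ • powDiff (R + θ • H) R (k + 1))
      (((k : ℝ) + 1) • (R + θ • H) ^ k) θ := by
  induction k with
  | zero => simpa [powDiff] using (hasDerivAt_id θ).smul_const (1 : E)
  | succ k ih =>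
    have hx : HasDerivAt (fun θ : ℝ => R + θ • H) H θ := by
      simpa using ((hasDerivAt_id θ).smul_const H).const_add R
    have h1 := (hx.mul ih).add ((hasDerivAt_id θ).smul_const (R ^ (k + 1)))
    refine (h1.congr_deriv ?_).congr_of_eventuallyEq (Eventually.of_forall fun t => ?_)
    · have := smul_mul_powDiff h θ (k + 1)
      rw [mul_smul_comm, this]
      simp only [one_smul, mul_smul_comm, ← pow_succ']
      push_cast
      rw [add_smul _ (1 : ℝ), one_smul]
      module
    · change t • powDiff (R + t • H) R (k + 1 + 1) =
        (R + t • H) * (t • powDiff (R + t • H) R (k + 1)) + t • R ^ (k + 1)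
      rw [mul_smul_comm, ← smul_add, powDiff]

theorem one_add_mul_alternating_geom_sum {x : E} {m : ℕ} (hx : x ^ m = 0) :
    (1 + x) * ∑ k ∈ Finset.range m, (-1 : ℝ) ^ k • x ^ k = 1 := by
  have h : ∀ k : ℕ, (-1 : ℝ) ^ k • x ^ k = (-x) ^ k := fun k => by
    rw [neg_pow x]
    rcases Nat.even_or_odd k with hk | hk <;> simp [hk.neg_one_pow]
  have h2 := mul_neg_geom_sum (-x) m
  rw [sub_neg_eq_add, neg_pow, hx, mul_zero, sub_zero] at h2
  simp_rw [h]
  exact h2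

/-- This is log(1 + R + H) - log(1 + R) = log(1 + HS) with a factor H removed from both sides. Since
H cannot be cancelled, H is replaced by θH: both sides vanish at θ = 0, and both have derivative (1
+ R + θH)⁻¹. -/
theorem sum_logCoeff_powDiff {R H S : E} (h : Commute R H) {m : ℕ}
    (hm : ∀ θ : ℝ, (R + θ • H) ^ m = 0) (hH : H ^ m = 0) (hS : (1 + R) * S = 1)
    (hS' : S * (1 + R) = 1) :
    ∑ k ∈ Finset.range m, logCoeff k • powDiff (R + H) R (k + 1) =
      ∑ k ∈ Finset.range m, logCoeff k • (H ^ k * S ^ (k + 1)) := by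
  set P : ℝ → E := fun θ => ∑ k ∈ Finset.range m, logCoeff k • θ • powDiff (R + θ • H) R (k + 1)
  set Q : ℝ → E := fun θ => ∑ k ∈ Finset.range m, logCoeff k • θ ^ (k + 1) • (H ^ k * S ^ (k + 1))
  have hcS : Commute H S := by
    have h1 : Commute H (1 + R) := (Commute.one_right H).add_right h.symm
    calc H * S = S * (1 + R) * (H * S) := by rw [hS', one_mul]
      _ = S * ((1 + R) * H) * S := by simp only [mul_assoc]
      _ = S * (H * (1 + R)) * S := by rw [h1.eq]
      _ = S * H * ((1 + R) * S) := by simp only [mul_assoc]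
      _ = S * H := by rw [hS, mul_one]
  have hP : ∀ θ, HasDerivAt P (∑ k ∈ Finset.range m, (-1 : ℝ) ^ k • (R + θ • H) ^ k) θ := fun θ => by
    refine HasDerivAt.fun_sum fun k _ => ?_
    refine ((hasDerivAt_smul_powDiff h k θ).const_smul (logCoeff k)).congr_deriv ?_
    rw [smul_smul, logCoeff_mul_succ]
  have hQ : ∀ θ, HasDerivAt Q
      (S * ∑ k ∈ Finset.range m, (-1 : ℝ) ^ k • (θ • (H * S)) ^ k) θ := fun θ => by
    rw [Finset.mul_sum]
    refine HasDerivAt.fun_sum fun k _ => ?_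
    refine (((hasDerivAt_pow (k + 1) θ).smul_const (H ^ k * S ^ (k + 1))).const_smul
      (logCoeff k)).congr_deriv ?_
    have hk : S * (H * S) ^ k = H ^ k * S ^ (k + 1) := by
      rw [hcS.mul_pow, ← mul_assoc, (hcS.symm.pow_right k).eq, mul_assoc, ← pow_succ']
    rw [smul_pow, mul_smul_comm, mul_smul_comm, hk, smul_smul, smul_smul, ← logCoeff_mul_succ]
    push_cast
    congr 1
    ring
  have hPQ : ∀ θ, HasDerivAt (fun θ => P θ - Q θ) 0 θ := fun θ => by
    refine ((hP θ).sub (hQ θ)).congr_deriv ?_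
    rw [sub_eq_zero]
    have h1 := one_add_mul_alternating_geom_sum (hm θ)
    have hz : (θ • (H * S)) ^ m = 0 := by rw [smul_pow, hcS.mul_pow, hH, zero_mul, smul_zero]
    have h2 := one_add_mul_alternating_geom_sum hz
    set A := ∑ k ∈ Finset.range m, (-1 : ℝ) ^ k • (R + θ • H) ^ k
    set B := ∑ k ∈ Finset.range m, (-1 : ℝ) ^ k • (θ • (H * S)) ^ k
    have h3 : (1 + (R + θ • H)) * (S * B) = 1 := by
      have : (1 + (R + θ • H)) * S = 1 + θ • (H * S) := by
        rw [← add_assoc, add_mul, hS, smul_mul_assoc]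
      rw [← mul_assoc, this, h2]
    have h1' : A * (1 + (R + θ • H)) = 1 := by
      have : Commute (1 + (R + θ • H)) A := by
        refine Commute.sum_right _ _ _ fun k _ => Commute.smul_right (Commute.pow_right ?_ k) _
        exact (Commute.one_left _).add_left (Commute.refl _)
      rw [← this.eq, h1]
    calc A = A * ((1 + (R + θ • H)) * (S * B)) := by rw [h3, mul_one]
      _ = S * B := by rw [← mul_assoc, h1', one_mul]
  have hc := is_const_of_deriv_eq_zero (fun θ => (hPQ θ).differentiableAt)
    (fun θ => (hPQ θ).deriv) 1 0
  have h0 : P 0 - Q 0 = 0 := by simp [P, Q]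
  have h1 : P 1 = Q 1 := by
    rw [← sub_eq_zero]; exact hc.trans h0
  simpa [P, Q] using h1

/-- The logarithmic series at `U`, cut after `m` terms. -/
noncomputable def truncLog (m : ℕ) (U : E) : E :=
  ∑ k ∈ Finset.range m, logCoeff k • (U - 1) ^ (k + 1)

/-- The derivative of U^n is ∑ U^i U' U^(n-1-i). Expressed by the operators of left and right
multiplication, which commute, it becomes a divided difference, so that the commutative calculus
above applies. -/
theorem HasDerivAt.pow_powDiff {U : ℝ → E} {U' : E} {t : ℝ} (hU : HasDerivAt U U' t) (n : ℕ) :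
    HasDerivAt (fun t => U t ^ n) (powDiff (ContinuousLinearMap.mul ℝ E (U t))
      ((ContinuousLinearMap.mul ℝ E).flip (U t)) n U') t := by
  have hp : ∀ n, (((ContinuousLinearMap.mul ℝ E).flip (U t)) ^ n) U' = U' * U t ^ n := fun n => by
    induction n with
    | zero => simp
    | succ n ih => 
      rw [pow_succ']
      change ((ContinuousLinearMap.mul ℝ E).flip (U t)) ((((ContinuousLinearMap.mul ℝ E).flip (U t)) ^ n) U') = _
      rw [ih]
      simp [pow_succ, mul_assoc]
  induction n with
  | zero => simpa [powDiff] using hasDerivAt_const t (1 : E)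
  | succ n ih =>
    refine ((hU.mul ih).congr_deriv ?_).congr_of_eventuallyEq
      (Eventually.of_forall fun s => by simp [pow_succ'])
    simp [powDiff, hp, add_comm]

/-- With L and R the left and right multiplications by U - 1, the derivative is the divided
difference of the logarithm at 1 + L and 1 + R. Since (1 + L)(1 + R)⁻¹ is conjugation by U, it
equals log Z / (Z - 1) applied to Z Y, with Z that conjugation: the function ψ of the
Baker-Campbell-Hausdorff formula. -/
theorem HasDerivAt.truncLog {U : ℝ → E} {U' Y V : E} {t : ℝ} (hU : HasDerivAt U U' t)
    (hY : U' = U t * Y) (hV : U t * V = 1) (hV' : V * U t = 1) {n m : ℕ} (hn : (U t - 1) ^ n = 0)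
    (hm : 2 * n ≤ m) :
    HasDerivAt (fun t => truncLog m (U t)) (∑ k ∈ Finset.range m, logCoeff k •
      ((ContinuousLinearMap.mul ℝ E (U t) * (ContinuousLinearMap.mul ℝ E).flip V - 1) ^ k)
        (U t * Y * V)) t := by
  set N := U t - 1 with hN
  set L : E →L[ℝ] E := ContinuousLinearMap.mul ℝ E N with hL
  set R : E →L[ℝ] E := (ContinuousLinearMap.mul ℝ E).flip N with hR
  set S : E →L[ℝ] E := (ContinuousLinearMap.mul ℝ E).flip V with hS
  have hcomm : Commute R L := by
    ext a; simp [hL, hR, mul_assoc]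
  have hLn : L ^ n = 0 := by
    have : ∀ k a, (L ^ k) a = N ^ k * a := fun k => by
      induction k with
      | zero => simp
      | succ k ih => intro a; rw [pow_succ', mul_apply_eq_comp, ih]; simp [hL, pow_succ', mul_assoc]
    ext a; simp [this, hn]
  have hRn : R ^ n = 0 := by
    have : ∀ k a, (R ^ k) a = a * N ^ k := fun k => by
      induction k with
      | zero => simp
      | succ k ih => intro a; rw [pow_succ', mul_apply_eq_comp, ih]; simp [hR, pow_succ, mul_assoc]
    ext a; simp [this, hn]
  have hRS : (1 + R) * S = 1 := by
    ext a; simp [hR, hS, hN, mul_assoc, hV']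
  have hSR : S * (1 + R) = 1 := by
    ext a; simp [hR, hS, hN, mul_assoc, hV]
  have hRH : Commute R (L - R) := hcomm.sub_right (Commute.refl R)
  have hcomm' : ∀ a b : ℝ, Commute (a • R) (b • L) := fun a b => by
    ext v; simp [hL, hR, mul_assoc, smul_smul, mul_comm]
  -- Two commuting operators, each with vanishing n-th power: this is where `2 * n ≤ m` is needed.
  have hnil : ∀ a b : ℝ, (a • R + b • L) ^ m = 0 := fun a b =>
    (hcomm' a b).add_pow_eq_zero_of_add_le_succ_of_pow_eq_zero
      (smul_pow_eq_zero a hRn) (smul_pow_eq_zero b hLn) (by omega)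
  have key := sum_logCoeff_powDiff hRH (m := m)
    (fun θ => by rw [← hnil (1 - θ) θ]; congr 1; module)
    (by rw [← hnil (-1) 1]; congr 1; module) hRS hSR
  have hz : ContinuousLinearMap.mul ℝ E (U t) * S - 1 = (L - R) * S := by
    ext a
    simp [hL, hR, hS, hN, sub_mul, mul_assoc, hV']
  have hcHS : Commute (L - R) S := by
    have h1 : Commute (L - R) (1 + R) := (Commute.one_right _).add_right hRH.symm
    calc (L - R) * S = S * (1 + R) * ((L - R) * S) := by rw [hSR, one_mul]
      _ = S * ((1 + R) * (L - R)) * S := by simp only [mul_assoc]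
      _ = S * ((L - R) * (1 + R)) * S := by rw [h1.eq]
      _ = S * (L - R) * ((1 + R) * S) := by simp only [mul_assoc]
      _ = S * (L - R) := by rw [hRS, mul_one]
  have hd : HasDerivAt (fun t => _root_.truncLog m (U t))
      ((∑ k ∈ Finset.range m, logCoeff k • powDiff L R (k + 1)) U') t := by
    rw [sum_apply]
    refine HasDerivAt.fun_sum fun k _ => ?_
    exact ((hU.sub_const 1).pow_powDiff (k + 1)).const_smul (logCoeff k)
  refine hd.congr_deriv ?_
  have h2 : R + (L - R) = L := by abel
  rw [h2] at key
  rw [key, sum_apply]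
  refine Finset.sum_congr rfl fun k _ => ?_
  have hSU : S U' = U t * Y * V := by simp [hS, hY]
  rw [hz, hcHS.mul_pow, pow_succ S, ← mul_assoc, smul_apply,
    mul_apply_eq_comp, hSU]

/-- If moreover `Y` commutes with `U t`, the derivative of the logarithm is `Y`. -/
theorem HasDerivAt.truncLog_of_commute {U : ℝ → E} {U' Y V : E} {t : ℝ} (hU : HasDerivAt U U' t)
    (hY : U' = U t * Y) (hV : U t * V = 1) (hV' : V * U t = 1) {n m : ℕ} (hn : (U t - 1) ^ n = 0)
    (hm : 2 * n ≤ m) (hm0 : 0 < m) (hc : Commute (U t) Y) :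
    HasDerivAt (fun t => _root_.truncLog m (U t)) Y t := by
  refine (hU.truncLog hY hV hV' hn hm).congr_deriv ?_
  have h1 : U t * Y * V = Y := by rw [hc.eq, mul_assoc, hV, mul_one]
  obtain ⟨m, rfl⟩ : ∃ j, m = j + 1 := ⟨m - 1, by omega⟩
  -- Conjugation by U fixes Y, so only the term k = 0 survives.
  rw [Finset.sum_range_succ', Finset.sum_eq_zero]
  · simp [logCoeff, h1]
  · intro k _
    rw [pow_succ, mul_apply_eq_comp]
    have : (ContinuousLinearMap.mul ℝ E (U t) * (ContinuousLinearMap.mul ℝ E).flip V - 1)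
        (U t * Y * V) = 0 := by
      simp [h1, ← mul_assoc]
    rw [this, map_zero, smul_zero]

/-! ### Exponential and logarithm as inverse maps -/

variable [CompleteSpace E]

omit [CompleteSpace E] in
theorem exp_eq_truncExp {X : E} {n : ℕ} (hX : X ^ n = 0) : NormedSpace.exp X = truncExp n X := by
  rw [NormedSpace.exp_eq_tsum ℝ]
  refine tsum_eq_sum fun k hk => ?_
  rw [pow_eq_zero_of_le (by simpa using hk) hX, smul_zero]

omit [CompleteSpace E] in
theorem exp_sub_one_pow_eq_zero {X : E} {n : ℕ} (hX : X ^ n = 0) :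
    (NormedSpace.exp X - 1) ^ n = 0 := by
  have h := exp_eq_truncExp hX
  rcases n with _ | n
  · simpa using hX
  · have h2 : NormedSpace.exp X - 1 = X * ∑ k ∈ Finset.range n, (((k + 1).factorial : ℝ)⁻¹) • X ^ k := by
      rw [h, truncExp, Finset.sum_range_succ', Finset.mul_sum]
      simp [pow_succ']
    have hc : Commute X (∑ k ∈ Finset.range n, (((k + 1).factorial : ℝ)⁻¹) • X ^ k) :=
      Commute.sum_right _ _ _ fun k _ => ((Commute.refl X).pow_right k).smul_right _
    rw [h2, hc.mul_pow, hX, zero_mul]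

theorem exp_mul_exp_neg (X : E) : NormedSpace.exp X * NormedSpace.exp (-X) = 1 := by
  let _ : NormedAlgebra ℚ E := NormedAlgebra.restrictScalars ℚ ℝ E
  rw [← NormedSpace.exp_add_of_commute (Commute.neg_right (Commute.refl X)), add_neg_cancel,
    NormedSpace.exp_zero]

theorem exp_neg_mul_exp (X : E) : NormedSpace.exp (-X) * NormedSpace.exp X = 1 := by
  simpa using exp_mul_exp_neg (-X)

/-- The solution of `f' = [X, f]` is the conjugation by the exponential of `X`. -/
theorem exp_conj_of_hasDerivAt {X : E} {f : ℝ → E}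
    (hf : ∀ t, HasDerivAt f (X * f t - f t * X) t) :
    NormedSpace.exp X * f 0 * NormedSpace.exp (-X) = f 1 := by
  have hd : ∀ t : ℝ, HasDerivAt (fun t : ℝ => NormedSpace.exp (t • (-X)) * f t *
      NormedSpace.exp (t • X)) 0 t := fun t => by
    have h1 := ((hasDerivAt_exp_smul_const (-X) t).mul (hf t)).mul (hasDerivAt_exp_smul_const' X t)
    refine h1.congr_deriv ?_
    simp only [Pi.mul_apply]
    noncomm_ring
  have hc := is_const_of_deriv_eq_zero (fun θ => (hd θ).differentiableAt)
    (fun θ => (hd θ).deriv) 1 0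
  simp only [one_smul, zero_smul, NormedSpace.exp_zero, one_mul, mul_one] at hc
  rw [← hc]
  calc NormedSpace.exp X * (NormedSpace.exp (-X) * f 1 * NormedSpace.exp X) * NormedSpace.exp (-X)
      = (NormedSpace.exp X * NormedSpace.exp (-X)) * f 1 *
        (NormedSpace.exp X * NormedSpace.exp (-X)) := by simp only [mul_assoc]
    _ = f 1 := by rw [exp_mul_exp_neg, one_mul, mul_one]

/-- Along t ↦ exp(tX) velocity and position commute, so the logarithm has constant derivative X. -/
theorem truncLog_exp {X : E} {n m : ℕ} (hX : X ^ n = 0) (hm : 2 * n ≤ m) (hm0 : 0 < m) :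
    truncLog m (NormedSpace.exp X) = X := by
  have hd : ∀ t : ℝ, HasDerivAt (fun t : ℝ => truncLog m (NormedSpace.exp (t • X)) - t • X) 0 t := by
    intro t
    have h1 := (hasDerivAt_exp_smul_const X t).truncLog_of_commute rfl
      (exp_mul_exp_neg (t • X)) (exp_neg_mul_exp (t • X))
      (exp_sub_one_pow_eq_zero (X := t • X) (n := n) (by rw [smul_pow, hX, smul_zero])) hm hm0
      (((Commute.refl X).smul_right t).exp_right).symm
    exact (h1.sub ((hasDerivAt_id t).smul_const X)).congr_deriv (by simp)
  have hc := is_const_of_deriv_eq_zero (fun θ => (hd θ).differentiableAt)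
    (fun θ => (hd θ).deriv) 1 0
  have h0 : truncLog m (1 : E) = 0 := by simp [truncLog]
  simpa [h0, sub_eq_zero] using hc

theorem HasDerivAt.exp_of_commute {f : ℝ → E} {f' : E} {t : ℝ} (hf : HasDerivAt f f' t)
    (hc : ∀ s, Commute (f t) (f s)) :
    HasDerivAt (fun s => NormedSpace.exp (f s)) (NormedSpace.exp (f t) * f') t := by
  have h0 : HasFDerivAt (NormedSpace.exp : E → E) (1 : E →L[ℝ] E) (f t - f t) := by
    rw [sub_self]; exact hasFDerivAt_exp_zero
  have h1 : HasDerivAt (fun s => NormedSpace.exp (f s - f t)) f' t := by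
    have := h0.comp_hasDerivAt t (hf.sub_const (f t))
    simpa using! this
  refine (h1.const_mul (NormedSpace.exp (f t))).congr_of_eventuallyEq (Eventually.of_forall fun s => ?_)
  change NormedSpace.exp (f s) = NormedSpace.exp (f t) * NormedSpace.exp (f s - f t)
  let _ : NormedAlgebra ℚ E := NormedAlgebra.restrictScalars ℚ ℝ E
  rw [← NormedSpace.exp_add_of_commute ((hc s).sub_right (Commute.refl _))]
  simp

omit [CompleteSpace E] in
theorem truncLog_commute (m : ℕ) {a b : E} (h : Commute a b) :
    Commute (truncLog m a) (truncLog m b) := by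
  have h1 : Commute (a - 1) (b - 1) :=
    (h.sub_left (Commute.one_left b)).sub_right ((Commute.one_right a).sub_left (Commute.one_right 1))
  exact Commute.sum_left _ _ _ fun i _ => Commute.sum_right _ _ _ fun j _ =>
    ((h1.pow_pow _ _).smul_left _).smul_right _

/-- Along the segment W(t) = 1 + t(U - 1) the product exp(-log W) W has derivative zero, and it
equals 1 at t = 0. The geometric series supplies the inverse of W(t). -/
theorem exp_truncLog {U : E} {n m : ℕ} (hU : (U - 1) ^ n = 0) (hm : 2 * n ≤ m) (hm0 : 0 < m) :
    NormedSpace.exp (truncLog m U) = U := by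
  set N := U - 1 with hN
  set W : ℝ → E := fun t => 1 + t • N with hW
  set V : ℝ → E := fun t => ∑ k ∈ Finset.range n, (-1 : ℝ) ^ k • (t • N) ^ k with hVdef
  have hV : ∀ t, W t * V t = 1 := fun t =>
    one_add_mul_alternating_geom_sum (by rw [smul_pow, hU, smul_zero])
  have hNW : ∀ t, Commute N (W t) := fun t =>
    (Commute.one_right N).add_right ((Commute.refl N).smul_right t)
  have hNV : ∀ t, Commute N (V t) := fun t => Commute.sum_right _ _ _ fun k _ =>
    (((Commute.refl N).smul_right t).pow_right k).smul_right _
  have hWV : ∀ t, Commute (W t) (V t) := fun t =>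
    (Commute.one_left _).add_left ((hNV t).smul_left t)
  have hV' : ∀ t, V t * W t = 1 := fun t => by rw [← (hWV t).eq, hV]
  have hWd : ∀ t, HasDerivAt W N t := fun t => by
    simpa [hW] using ((hasDerivAt_id t).smul_const N).const_add (1 : E)
  have hWW : ∀ t s, Commute (W t) (W s) := fun t s =>
    (Commute.one_left _).add_left ((hNW s).smul_left t)
  have hlog : ∀ t, HasDerivAt (fun t => truncLog m (W t)) (V t * N) t := fun t =>
    (hWd t).truncLog_of_commute (by rw [← mul_assoc, hV, one_mul]) (hV t) (hV' t)
      (by simp [hW, smul_pow, hU]) hm hm0 ((hWV t).mul_right (hNW t).symm)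
  have hd : ∀ t, HasDerivAt (fun t => NormedSpace.exp (-truncLog m (W t)) * W t) 0 t := fun t => by
    have h1 := (hlog t).neg.exp_of_commute fun s =>
      ((truncLog_commute m (hWW t s)).neg_left).neg_right
    refine (h1.mul (hWd t)).congr_deriv ?_
    simp only [Pi.neg_apply]
    rw [mul_assoc, neg_mul, mul_assoc, (hNW t).eq, ← mul_assoc (V t), hV', one_mul, mul_neg,
      neg_add_cancel]
  have hc := is_const_of_deriv_eq_zero (fun θ => (hd θ).differentiableAt)
    (fun θ => (hd θ).deriv) 1 0
  have hW1 : W 1 = U := by simp [hW, hN]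
  have hW0 : W 0 = 1 := by simp [hW]
  have hl1 : truncLog m (1 : E) = 0 := by simp [truncLog]
  rw [hW1, hW0, hl1, neg_zero, NormedSpace.exp_zero, mul_one] at hc
  calc NormedSpace.exp (truncLog m U)
      = NormedSpace.exp (truncLog m U) * (NormedSpace.exp (-truncLog m U) * U) := by rw [hc, mul_one]
    _ = U := by rw [← mul_assoc, exp_mul_exp_neg, one_mul]

end TruncatedLog

/-! ### The grading of a stratified Lie algebra -/

namespace Stratification

section Grading

variable {𝔤 : Type*} [LieRing 𝔤] [LieAlgebra ℝ 𝔤] (S : Stratification 𝔤)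

theorem proj_mem (j : ℕ) (x : 𝔤) : S.proj j x ∈ S.V j :=
  Submodule.coe_mem _

theorem proj_of_mem {i : ℕ} {x : 𝔤} (hx : x ∈ S.V i) (j : ℕ) :
    S.proj j x = if i = j then x else 0 := by
  have h : (LinearEquiv.ofBijective (DirectSum.coeLinearMap S.V) S.isInternal).symm x =
      DirectSum.lof ℝ ℕ (fun i => S.V i) i ⟨x, hx⟩ := by
    rw [LinearEquiv.symm_apply_eq]
    exact (DirectSum.coeLinearMap_lof S.V i ⟨x, hx⟩).symm
  simp only [proj, LinearMap.comp_apply, LinearEquiv.coe_coe, h]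
  split_ifs with hij
  · subst hij; simp [DirectSum.component.lof_self]
  · simp [DirectSum.component.of, hij]

theorem proj_of_step_lt {j : ℕ} (hj : S.step < j) (x : 𝔤) : S.proj j x = 0 := by
  have := S.proj_mem j x
  rwa [S.layer_eq_bot j hj, Submodule.mem_bot] at this

theorem proj_zero_apply (x : 𝔤) : S.proj 0 x = 0 := by
  have := S.proj_mem 0 x
  rwa [S.layer_zero, Submodule.mem_bot] at this

theorem sum_proj (x : 𝔤) : ∑ j ∈ Finset.range (S.step + 1), S.proj j x = x := by
  have hx : x ∈ iSup S.V := by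
    rw [S.isInternal.submodule_iSup_eq_top]; trivial
  induction hx using Submodule.iSup_induction' with
  | mem i y hy =>
    simp_rw [S.proj_of_mem hy]
    by_cases hi : i ∈ Finset.range (S.step + 1)
    · rw [Finset.sum_ite_eq, if_pos hi]
    · have : y = 0 := by
        rwa [S.layer_eq_bot i (by simpa [Nat.lt_succ_iff] using hi), Submodule.mem_bot] at hy
      simp [this]
  | zero => simp
  | add y z _ _ hy hz => rw [← hy, ← hz]; simp only [map_add, Finset.sum_add_distrib, hy, hz]

theorem ext_proj {x y : 𝔤} (h : ∀ j, S.proj j x = S.proj j y) : x = y := by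
  rw [← S.sum_proj x, ← S.sum_proj y]; simp [h]

theorem homogeneous_induction {p : 𝔤 → Prop} (h : ∀ j, ∀ x ∈ S.V j, p x)
    (hadd : ∀ x y, p x → p y → p (x + y)) (x : 𝔤) : p x := by
  rw [← S.sum_proj x]
  exact Finset.sum_induction _ p hadd (h 0 0 (zero_mem _)) fun j _ => h j _ (S.proj_mem j x)

/-- Induction on j by the Jacobi identity [x,[a,b]] = [[x,a],b] + [a,[x,b]] with a in V_j and b in
V_1. The second term raises the degree of the other factor, so the induction hypothesis must hold
for all i. -/
theorem lie_mem_layer {i j : ℕ} {x y : 𝔤} (hx : x ∈ S.V i) (hy : y ∈ S.V j) :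
    ⁅x, y⁆ ∈ S.V (i + j) := by
  have h1 : ∀ i, ∀ x ∈ S.V i, ∀ y ∈ S.V 1, ⁅x, y⁆ ∈ S.V (i + 1) := fun i x hx y hy => by
    rcases Nat.eq_zero_or_pos i with rfl | hi
    · rw [S.layer_zero, Submodule.mem_bot] at hx
      simp [hx]
    · rw [← S.span_lie i hi]
      exact Submodule.subset_span ⟨x, hx, y, hy, rfl⟩
  have h2 : ∀ j, 1 ≤ j → ∀ i, ∀ x ∈ S.V i, ∀ y ∈ S.V j, ⁅x, y⁆ ∈ S.V (i + j) := by
    intro j hj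
    induction j, hj using Nat.le_induction with
    | base => exact h1
    | succ j hj ih =>
      intro i x hx y hy
      rw [← S.span_lie j hj] at hy
      induction hy using Submodule.span_induction with
      | mem z hz =>
        obtain ⟨a, ha, b, hb, rfl⟩ := hz
        rw [leibniz_lie]
        refine add_mem (h1 (i + j) _ (ih i x hx a ha) b hb) ?_
        rw [← lie_skew]
        have := ih (i + 1) _ (h1 i x hx b hb) a ha
        rw [show i + 1 + j = i + (j + 1) by ring] at this
        exact neg_mem this
      | zero => simp
      | add y z _ _ h h' => rw [lie_add]; exact add_mem h h'
      | smul c y _ h => rw [lie_smul]; exact Submodule.smul_mem _ _ h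
  rcases Nat.eq_zero_or_pos j with rfl | hj
  · rw [S.layer_zero, Submodule.mem_bot] at hy
    simp [hy]
  · exact h2 j hj i x hx y hy

/-- The linear map that multiplies the layer `V_j` by `w j`. -/
noncomputable def weighted (w : ℕ → ℝ) : 𝔤 →ₗ[ℝ] 𝔤 :=
  ∑ j ∈ Finset.range (S.step + 1), w j • S.proj j

theorem weighted_of_mem (w : ℕ → ℝ) {j : ℕ} {x : 𝔤} (hx : x ∈ S.V j) :
    S.weighted w x = w j • x := by
  simp only [weighted, LinearMap.sum_apply, LinearMap.smul_apply, S.proj_of_mem hx, smul_ite,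
    smul_zero, Finset.sum_ite_eq]
  split_ifs with h
  · rfl
  · rw [S.layer_eq_bot j (by simpa [Nat.lt_succ_iff] using h), Submodule.mem_bot] at hx
    simp [hx]

theorem proj_weighted (w : ℕ → ℝ) (j : ℕ) (x : 𝔤) :
    S.proj j (S.weighted w x) = w j • S.proj j x := by
  induction x using S.homogeneous_induction with
  | h i x hx =>
    rw [S.weighted_of_mem w hx, map_smul, S.proj_of_mem hx]
    split_ifs with h
    · rw [h]
    · simp
  | hadd x y hx hy => simp only [map_add, hx, hy, smul_add]

theorem weighted_lie_of_mul {w : ℕ → ℝ} (hw : ∀ i j, w (i + j) = w i * w j) (x y : 𝔤) :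
    S.weighted w ⁅x, y⁆ = ⁅S.weighted w x, S.weighted w y⁆ := by
  induction x using S.homogeneous_induction with
  | h i x hx =>
    induction y using S.homogeneous_induction with
    | h j y hy =>
      rw [S.weighted_of_mem w hx, S.weighted_of_mem w hy, S.weighted_of_mem w (S.lie_mem_layer hx hy),
        hw, smul_lie, lie_smul, smul_smul]
    | hadd y z hy hz => simp only [lie_add, map_add, hy, hz]
  | hadd x z hx hz => simp only [add_lie, map_add, hx, hz]

theorem weighted_lie_of_add {w : ℕ → ℝ} (hw : ∀ i j, w (i + j) = w i + w j) (x y : 𝔤) :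
    S.weighted w ⁅x, y⁆ = ⁅S.weighted w x, y⁆ + ⁅x, S.weighted w y⁆ := by
  induction x using S.homogeneous_induction with
  | h i x hx =>
    induction y using S.homogeneous_induction with
    | h j y hy =>
      rw [S.weighted_of_mem w hx, S.weighted_of_mem w hy, S.weighted_of_mem w (S.lie_mem_layer hx hy),
        hw, smul_lie, lie_smul, add_smul]
    | hadd y z hy hz => simp only [lie_add, map_add, hy, hz]; abel
  | hadd x z hx hz => simp only [add_lie, map_add, hx, hz]; abel

/-- The derivation of the Lie algebra that multiplies the layer `V_j` by `j`. -/
noncomputable def degree : 𝔤 →ₗ[ℝ] 𝔤 := S.weighted fun j => j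

theorem degree_lie (x y : 𝔤) : S.degree ⁅x, y⁆ = ⁅S.degree x, y⁆ + ⁅x, S.degree y⁆ :=
  S.weighted_lie_of_add (by simp) x y

/-- There is no layer of degree 0, so no weight vanishes on a nonzero layer. -/
theorem degree_injective : Function.Injective S.degree := by
  rw [injective_iff_map_eq_zero]
  intro x hx
  refine S.ext_proj fun j => ?_
  have h := S.proj_weighted (fun j => (j : ℝ)) j x
  change S.proj j (S.degree x) = _ at h
  rw [map_zero]
  rw [hx, map_zero] at h
  rcases Nat.eq_zero_or_pos j with rfl | hj
  · exact S.proj_zero_apply x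
  · have : (j : ℝ) ≠ 0 := by positivity
    exact (smul_eq_zero.1 h.symm).resolve_left this

/-! ### Dilations as automorphisms of the Lie algebra -/

theorem dil_eq_weighted (c : ℝ) (x : 𝔤) : S.dil c x = S.weighted (fun j => c ^ j) x := by
  simp [dil, weighted, LinearMap.sum_apply]

theorem dil_add (c : ℝ) (x y : 𝔤) : S.dil c (x + y) = S.dil c x + S.dil c y := by
  simp [dil_eq_weighted]

theorem dil_neg (c : ℝ) (x : 𝔤) : S.dil c (-x) = -S.dil c x := by
  simp [dil_eq_weighted]

theorem dil_sub (c : ℝ) (x y : 𝔤) : S.dil c (x - y) = S.dil c x - S.dil c y := by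
  simp [dil_eq_weighted]

theorem dil_zero (c : ℝ) : S.dil c 0 = 0 := by
  simp [dil_eq_weighted]

theorem dil_smul (c a : ℝ) (x : 𝔤) : S.dil c (a • x) = a • S.dil c x := by
  simp [dil_eq_weighted]

theorem dil_lie (c : ℝ) (x y : 𝔤) : S.dil c ⁅x, y⁆ = ⁅S.dil c x, S.dil c y⁆ := by
  simpa only [dil_eq_weighted] using S.weighted_lie_of_mul (fun i j => pow_add c i j) x y

theorem proj_dil (c : ℝ) (j : ℕ) (x : 𝔤) : S.proj j (S.dil c x) = c ^ j • S.proj j x := by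
  rw [dil_eq_weighted, proj_weighted]

theorem dil_dil (a b : ℝ) (x : 𝔤) : S.dil a (S.dil b x) = S.dil (a * b) x :=
  S.ext_proj fun j => by simp [proj_dil, smul_smul, mul_pow]

theorem dil_one (x : 𝔤) : S.dil 1 x = x :=
  S.ext_proj fun j => by simp [proj_dil]

theorem dil_of_mem_one (c : ℝ) {x : 𝔤} (hx : x ∈ S.V 1) : S.dil c x = c • x := by
  rw [dil_eq_weighted, S.weighted_of_mem _ hx, pow_one]

/-- The descending filtration `F_j = ⊕ V_i` over `i ≥ j`. -/
def filtration (j : ℕ) : Submodule ℝ 𝔤 where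
  carrier := {x | ∀ i < j, S.proj i x = 0}
  add_mem' := fun hx hy i hi => by rw [map_add, hx i hi, hy i hi, add_zero]
  zero_mem' := fun i _ => map_zero _
  smul_mem' := fun c x hx i hi => by rw [map_smul, hx i hi, smul_zero]

theorem mem_filtration {j : ℕ} {x : 𝔤} : x ∈ S.filtration j ↔ ∀ i < j, S.proj i x = 0 := Iff.rfl

theorem filtration_antitone : Antitone S.filtration :=
  fun _ _ hij _ hx k hk => hx k (hk.trans_le hij)

theorem layer_le_filtration {i j : ℕ} (hij : i ≤ j) : S.V j ≤ S.filtration i := fun x hx k hk => by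
  rw [S.proj_of_mem hx, if_neg (by omega)]

theorem filtration_one : S.filtration 1 = ⊤ := by
  refine eq_top_iff.2 fun x _ i hi => ?_
  obtain rfl : i = 0 := by omega
  exact S.proj_zero_apply x

theorem filtration_eq_bot {j : ℕ} (hj : S.step < j) : S.filtration j = ⊥ := by
  refine eq_bot_iff.2 fun x hx => (Submodule.mem_bot ℝ).2 <| S.ext_proj fun i => ?_
  rw [map_zero]
  rcases lt_or_ge i j with h | h
  · exact hx i h
  · exact S.proj_of_step_lt (hj.trans_le h) x

theorem lie_mem_filtration {i j : ℕ} {x y : 𝔤} (hx : x ∈ S.filtration i) (hy : y ∈ S.filtration j) :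
    ⁅x, y⁆ ∈ S.filtration (i + j) := by
  rw [← S.sum_proj x, ← S.sum_proj y, sum_lie]
  refine sum_mem fun a _ => ?_
  rw [lie_sum]
  refine sum_mem fun b _ => ?_
  rcases lt_or_ge a i with ha | ha
  · rw [hx a ha, zero_lie]; exact zero_mem _
  rcases lt_or_ge b j with hb | hb
  · rw [hy b hb, lie_zero]; exact zero_mem _
  exact S.layer_le_filtration (add_le_add ha hb)
    (S.lie_mem_layer (S.proj_mem a x) (S.proj_mem b y))

theorem sub_proj_mem_filtration {j : ℕ} {x : 𝔤} (hx : x ∈ S.filtration j) :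
    x - S.proj j x ∈ S.filtration (j + 1) := fun i hi => by
  rw [map_sub, S.proj_of_mem (S.proj_mem j x)]
  split_ifs with h
  · rw [h, sub_self]
  · rw [hx i (by omega), sub_zero]

end Grading

end Stratification

/-! ### Endomorphisms raising a filtration -/

section Raising

variable {M : Type*} [AddCommGroup M] [Module ℝ M] {Fil : ℕ → Submodule ℝ M}

theorem pow_mem_of_raising {T : Module.End ℝ M} (hT : ∀ j, ∀ x ∈ Fil j, T x ∈ Fil (j + 1)) (k : ℕ)
    {j : ℕ} {x : M} (hx : x ∈ Fil j) : (T ^ k) x ∈ Fil (j + k) := by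
  induction k with
  | zero => simpa using hx
  | succ k ih => rw [pow_succ', Module.End.mul_apply, ← add_assoc]; exact hT _ _ ih

theorem pow_eq_zero_of_raising {T : Module.End ℝ M} (hT : ∀ j, ∀ x ∈ Fil j, T x ∈ Fil (j + 1))
    {n : ℕ} (h0 : Fil 0 = ⊤) (hn : Fil n = ⊥) : T ^ n = 0 := by
  ext x
  have := pow_mem_of_raising hT n (j := 0) (x := x) (by rw [h0]; trivial)
  rwa [zero_add, hn, Submodule.mem_bot] at this

theorem truncExp_sub_one_mem (hF : Antitone Fil) {T : Module.End ℝ M} {l : ℕ}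
    (hT : ∀ i, ∀ x ∈ Fil i, T x ∈ Fil (i + 1)) {n : ℕ} (hn : 0 < n) {x : M}
    (hTx : T x ∈ Fil l) : truncExp n T x - x ∈ Fil l := by
  obtain ⟨n, rfl⟩ : ∃ k, n = k + 1 := ⟨n - 1, by omega⟩
  rw [truncExp, Finset.sum_range_succ', LinearMap.add_apply]
  simp only [Nat.factorial_zero, Nat.cast_one, inv_one, pow_zero, one_smul, Module.End.one_apply,
    add_sub_cancel_right]
  rw [LinearMap.sum_apply]
  refine sum_mem fun k _ => Submodule.smul_mem _ _ ?_
  rw [pow_succ, Module.End.mul_apply]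
  exact hF (Nat.le_add_right l k) (pow_mem_of_raising hT k hTx)

theorem truncExp_sub_one_sub_mem (hF : Antitone Fil) {T : Module.End ℝ M} {l : ℕ}
    (hT : ∀ i, ∀ x ∈ Fil i, T x ∈ Fil (i + 1)) {n : ℕ} (hn : 2 ≤ n) {x : M}
    (hTx : T (T x) ∈ Fil l) : truncExp n T x - x - T x ∈ Fil l := by
  obtain ⟨n, rfl⟩ : ∃ k, n = k + 1 + 1 := ⟨n - 2, by omega⟩
  rw [truncExp, Finset.sum_range_succ', Finset.sum_range_succ', LinearMap.add_apply,
    LinearMap.add_apply]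
  simp only [Nat.factorial_zero, zero_add, Nat.factorial_one, pow_one, Nat.cast_one, inv_one,
    pow_zero, one_smul, Module.End.one_apply, add_sub_cancel_right]
  rw [LinearMap.sum_apply]
  refine sum_mem fun k _ => Submodule.smul_mem _ _ ?_
  rw [pow_succ, pow_succ, Module.End.mul_apply, Module.End.mul_apply]
  exact hF (Nat.le_add_right l k) (pow_mem_of_raising hT k hTx)

end Raising

/-! ### A faithful unipotent representation and the group law -/

namespace Stratification

section Unipotent

variable {𝔤 : Type*} [LieRing 𝔤] [LieAlgebra ℝ 𝔤] (S : Stratification 𝔤)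

theorem ad_raising (x : 𝔤) : ∀ j, ∀ v ∈ S.filtration (j + 1),
    LieAlgebra.ad ℝ 𝔤 x v ∈ S.filtration (j + 1 + 1) := fun j v hv => by
  have hx : x ∈ S.filtration 1 := by rw [S.filtration_one]; trivial
  have := S.lie_mem_filtration hx hv
  rwa [add_comm 1] at this

theorem filtration_succ_antitone : Antitone fun j => S.filtration (j + 1) :=
  fun _ _ h => S.filtration_antitone (Nat.succ_le_succ h)

theorem ad_pow_step (x : 𝔤) : LieAlgebra.ad ℝ 𝔤 x ^ S.step = 0 :=
  pow_eq_zero_of_raising (Fil := fun j => S.filtration (j + 1)) (S.ad_raising x) S.filtration_one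
    (S.filtration_eq_bot (Nat.lt_succ_self _))

/-- `e ^ (ad x) v - v` lies in `F_l` as soon as `[x, v]` does. -/
theorem expAd_sub_mem {l : ℕ} (hl : 1 ≤ l) {x v : 𝔤} (h : ⁅x, v⁆ ∈ S.filtration l) :
    S.expAd x v - v ∈ S.filtration l := by
  obtain ⟨l, rfl⟩ : ∃ k, l = k + 1 := ⟨l - 1, by omega⟩
  exact truncExp_sub_one_mem (Fil := fun j => S.filtration (j + 1)) S.filtration_succ_antitone
    (S.ad_raising x) S.one_le_step h

theorem expAd_sub_raising (x : 𝔤) {l : ℕ} {v : 𝔤} (hv : v ∈ S.filtration (l + 1)) :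
    S.expAd x v - v ∈ S.filtration (l + 1 + 1) :=
  S.expAd_sub_mem (by omega) (S.ad_raising x l v hv)

theorem expAd_mem (x : 𝔤) {l : ℕ} {v : 𝔤} (hv : v ∈ S.filtration (l + 1)) :
    S.expAd x v ∈ S.filtration (l + 1) := by
  have := add_mem (S.filtration_antitone (Nat.le_succ _) (S.expAd_sub_raising x hv)) hv
  rwa [sub_add_cancel] at this

theorem expAd_self_smul (t : ℝ) (y : 𝔤) : S.expAd (t • y) y = y := by
  obtain ⟨n, hn⟩ : ∃ k, S.step = k + 1 := ⟨S.step - 1, by have := S.one_le_step; omega⟩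
  rw [expAd, hn, Finset.sum_range_succ', LinearMap.add_apply, LinearMap.sum_apply,
    Finset.sum_eq_zero]
  · simp
  · intro k _
    simp [pow_succ]

theorem expAd_mul_expAd_sub_one_raising (x y : 𝔤) : ∀ j, ∀ v ∈ S.filtration (j + 1),
    (S.expAd x * S.expAd y - 1) v ∈ S.filtration (j + 1 + 1) := fun j v hv => by
  have h1 := S.expAd_sub_raising y hv
  have h2 := S.expAd_sub_raising x (S.expAd_mem y hv)
  have : (S.expAd x * S.expAd y - 1) v =
    (S.expAd x (S.expAd y v) - S.expAd y v) + (S.expAd y v - v) := by simp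
  rw [this]
  exact add_mem h2 h1

theorem expAd_mul_expAd_sub_one_pow (x y : 𝔤) :
    (S.expAd x * S.expAd y - 1) ^ S.step = 0 :=
  pow_eq_zero_of_raising (Fil := fun j => S.filtration (j + 1))
    (S.expAd_mul_expAd_sub_one_raising x y) S.filtration_one
    (S.filtration_eq_bot (Nat.lt_succ_self _))

/-- The factor z is moved to the right, so that the sum takes the form of the derivative in
`HasDerivAt.truncLog`. -/
theorem bchPsi_apply (z : Module.End ℝ 𝔤) (y : 𝔤) :
    S.bchPsi z y = ∑ k ∈ Finset.range S.step, logCoeff k • ((z - 1) ^ k) (z y) := by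
  have hc : Commute z (∑ k ∈ Finset.range S.step, logCoeff k • (z - 1) ^ k) :=
    Commute.sum_right _ _ _ fun k _ =>
      (((Commute.refl z).sub_right (Commute.one_right z)).pow_right k).smul_right _
  change (z * ∑ k ∈ Finset.range S.step, logCoeff k • (z - 1) ^ k) y = _
  rw [hc.eq, Module.End.mul_apply, LinearMap.sum_apply]
  rfl

/-- The representation `x ↦ ad x` on `𝔤 ⊕ ℝ D`, where `D` is the degree derivation. -/
noncomputable def repEnd : 𝔤 →ₗ[ℝ] Module.End ℝ (𝔤 × ℝ) where
  toFun x := LinearMap.inl ℝ 𝔤 ℝ ∘ₗ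
    (LieAlgebra.ad ℝ 𝔤 x ∘ₗ LinearMap.fst ℝ 𝔤 ℝ - (LinearMap.snd ℝ 𝔤 ℝ).smulRight (S.degree x))
  map_add' x y := by ext <;> (simp; try abel)
  map_smul' c x := by ext <;> simp

theorem repEnd_apply (x z : 𝔤) (c : ℝ) :
    S.repEnd x (z, c) = (⁅x, z⁆ - c • S.degree x, 0) := by
  simp [repEnd]

theorem repEnd_lie (x y : 𝔤) :
    S.repEnd ⁅x, y⁆ = S.repEnd x * S.repEnd y - S.repEnd y * S.repEnd x := by
  refine LinearMap.ext fun ⟨z, c⟩ => ?_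
  simp only [LinearMap.sub_apply, Module.End.mul_apply, repEnd_apply, S.degree_lie, lie_sub,
    lie_smul, lie_lie, smul_add, zero_smul, sub_zero, Prod.mk_sub_mk, Prod.mk.injEq, and_true]
  rw [← lie_skew y (S.degree x)]
  module

/-- The adjoint action of 𝔤 on itself kills the centre. Evaluation at the added generator D gives
minus the degree derivation of x, and this determines x. -/
theorem repEnd_injective : Function.Injective S.repEnd := by
  rw [injective_iff_map_eq_zero]
  intro x hx
  have h : S.repEnd x (0, 1) = 0 := by rw [hx]; rfl
  rw [repEnd_apply] at h
  have h1 := congrArg Prod.fst h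
  simp only [lie_zero, one_smul, zero_sub, Prod.fst_zero, neg_eq_zero] at h1
  exact S.degree_injective (h1.trans (map_zero _).symm)

/-- The filtration of `𝔤 ⊕ ℝ D` that is raised by the representation. -/
def repFiltration (j : ℕ) : Submodule ℝ (𝔤 × ℝ) :=
  (S.filtration j).prod (if j = 0 then ⊤ else ⊥)

theorem repFiltration_antitone : Antitone S.repFiltration := fun i j hij =>
  Submodule.prod_mono (S.filtration_antitone hij) <| by
    split_ifs with h1 h2
    · exact le_rfl
    · omega
    · exact bot_le
    · exact le_rfl

theorem repFiltration_zero : S.repFiltration 0 = ⊤ := by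
  have : S.filtration 0 = ⊤ := eq_top_iff.2 fun x _ i hi => absurd hi (Nat.not_lt_zero i)
  simp [repFiltration, this]

theorem repFiltration_step : S.repFiltration (S.step + 1) = ⊥ := by
  simp [repFiltration, S.filtration_eq_bot (Nat.lt_succ_self S.step)]

theorem repEnd_raising (x : 𝔤) : ∀ j, ∀ w ∈ S.repFiltration j,
    S.repEnd x w ∈ S.repFiltration (j + 1) := by
  rintro j ⟨z, c⟩ ⟨hz, hc⟩
  rw [repEnd_apply]
  refine ⟨?_, by simp⟩
  have hx : x ∈ S.filtration 1 := by rw [S.filtration_one]; trivial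
  rcases Nat.eq_zero_or_pos j with rfl | hj
  · change _ ∈ S.filtration 1
    rw [S.filtration_one]; trivial
  · have : c = 0 := by simpa [hj.ne'] using hc
    subst this
    simp only [zero_smul, sub_zero]
    rw [add_comm]
    exact S.lie_mem_filtration hx hz

end Unipotent

/-! ### The group of unipotent operators -/

noncomputable section

variable {𝔤 : Type*} [NormedLieRing 𝔤] [NormedLieAlgebra 𝔤] [FiniteDimensional ℝ 𝔤]
  (S : Stratification 𝔤)

/-- The representation `repEnd` with values in the Banach algebra of bounded operators. -/
def rep : 𝔤 →ₗ[ℝ] ((𝔤 × ℝ) →L[ℝ] (𝔤 × ℝ)) :=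
  (LinearMap.toContinuousLinearMap (𝕜 := ℝ) (E := 𝔤 × ℝ) (F' := 𝔤 × ℝ)).toLinearMap ∘ₗ S.repEnd

theorem rep_lie (x y : 𝔤) : S.rep ⁅x, y⁆ = S.rep x * S.rep y - S.rep y * S.rep x := by
  refine ContinuousLinearMap.ext fun w => ?_
  change S.repEnd ⁅x, y⁆ w = _
  rw [repEnd_lie]
  rfl

theorem rep_injective : Function.Injective S.rep :=
  LinearMap.toContinuousLinearMap.injective.comp S.repEnd_injective

omit [FiniteDimensional ℝ 𝔤] in
theorem toLinearMap_pow (T : (𝔤 × ℝ) →L[ℝ] (𝔤 × ℝ)) (n : ℕ) :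
    ((T ^ n : (𝔤 × ℝ) →L[ℝ] (𝔤 × ℝ)) : Module.End ℝ (𝔤 × ℝ)) =
      ((T : Module.End ℝ (𝔤 × ℝ))) ^ n :=
  map_pow (ContinuousLinearMap.toLinearMapRingHom (R₁ := ℝ) (M₁ := 𝔤 × ℝ)) T n

theorem rep_pow (x : 𝔤) : S.rep x ^ (S.step + 1) = 0 := by
  have h := pow_eq_zero_of_raising (S.repEnd_raising x) S.repFiltration_zero S.repFiltration_step
  refine ContinuousLinearMap.ext fun w => ?_
  have := toLinearMap_pow (S.rep x) (S.step + 1)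
  exact (LinearMap.congr_fun this w).trans (LinearMap.congr_fun h w)

/-- The element `exp (rep x)` of the unipotent matrix group that represents `x`. -/
def toUnipotent (x : 𝔤) : (𝔤 × ℝ) →L[ℝ] (𝔤 × ℝ) := NormedSpace.exp (S.rep x)

theorem toUnipotent_eq_truncExp (x : 𝔤) : S.toUnipotent x = truncExp (S.step + 1) (S.rep x) :=
  exp_eq_truncExp (S.rep_pow x)

theorem toUnipotent_apply (x : 𝔤) (w : 𝔤 × ℝ) :
    S.toUnipotent x w = truncExp (S.step + 1) (S.repEnd x) w := by
  have h : ∀ k, (S.rep x ^ k) w = (S.repEnd x ^ k) w := fun k =>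
    LinearMap.congr_fun (toLinearMap_pow (S.rep x) k) w
  rw [toUnipotent_eq_truncExp, truncExp, truncExp, sum_apply, LinearMap.sum_apply]
  simp [h]

theorem toUnipotent_sub_raising (x : 𝔤) {j : ℕ} {w : 𝔤 × ℝ} (hw : w ∈ S.repFiltration j) :
    S.toUnipotent x w - w ∈ S.repFiltration (j + 1) := by
  rw [toUnipotent_apply]
  exact truncExp_sub_one_mem S.repFiltration_antitone (S.repEnd_raising x) (Nat.succ_pos _)
    (S.repEnd_raising x j w hw)

theorem toUnipotent_mem (x : 𝔤) {j : ℕ} {w : 𝔤 × ℝ} (hw : w ∈ S.repFiltration j) :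
    S.toUnipotent x w ∈ S.repFiltration j := by
  have := add_mem (S.repFiltration_antitone (Nat.le_succ _) (S.toUnipotent_sub_raising x hw)) hw
  rwa [sub_add_cancel] at this

theorem toUnipotent_mul_sub_one_pow (x y : 𝔤) :
    (S.toUnipotent x * S.toUnipotent y - 1) ^ (S.step + 1) = 0 := by
  set T : (𝔤 × ℝ) →L[ℝ] (𝔤 × ℝ) := S.toUnipotent x * S.toUnipotent y - 1 with hT
  have h : ∀ j, ∀ w ∈ S.repFiltration j,
      (T : Module.End ℝ (𝔤 × ℝ)) w ∈ S.repFiltration (j + 1) := fun j w hw => by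
    have h1 := S.toUnipotent_sub_raising y hw
    have h2 := S.toUnipotent_sub_raising x (S.toUnipotent_mem y hw)
    have : (T : Module.End ℝ (𝔤 × ℝ)) w = (S.toUnipotent x (S.toUnipotent y w) - S.toUnipotent y w) +
        (S.toUnipotent y w - w) := by simp [hT]
    rw [this]
    exact add_mem h2 h1
  refine ContinuousLinearMap.ext fun w => ?_
  exact (LinearMap.congr_fun (toLinearMap_pow T (S.step + 1)) w).trans (LinearMap.congr_fun
    (pow_eq_zero_of_raising h S.repFiltration_zero S.repFiltration_step) w)

theorem toUnipotent_mul_neg (x : 𝔤) : S.toUnipotent x * S.toUnipotent (-x) = 1 := by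
  rw [toUnipotent, toUnipotent, map_neg, exp_mul_exp_neg]

theorem toUnipotent_neg_mul (x : 𝔤) : S.toUnipotent (-x) * S.toUnipotent x = 1 := by
  simpa using S.toUnipotent_mul_neg (-x)

theorem toUnipotent_zero : S.toUnipotent 0 = 1 := by
  rw [toUnipotent, map_zero, NormedSpace.exp_zero]

/-- The logarithm on the unipotent matrix group that contains the range of `toUnipotent`. -/
def unipotentLog (U : (𝔤 × ℝ) →L[ℝ] (𝔤 × ℝ)) : (𝔤 × ℝ) →L[ℝ] (𝔤 × ℝ) :=
  truncLog (2 * (S.step + 1)) U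

theorem unipotentLog_toUnipotent (x : 𝔤) : S.unipotentLog (S.toUnipotent x) = S.rep x :=
  truncLog_exp (S.rep_pow x) le_rfl (by omega)

theorem exp_unipotentLog_mul (x y : 𝔤) :
    NormedSpace.exp (S.unipotentLog (S.toUnipotent x * S.toUnipotent y)) =
      S.toUnipotent x * S.toUnipotent y :=
  exp_truncLog (S.toUnipotent_mul_sub_one_pow x y) le_rfl (by omega)

theorem toUnipotent_injective : Function.Injective S.toUnipotent := fun x y h =>
  S.rep_injective <| by rw [← unipotentLog_toUnipotent, h, unipotentLog_toUnipotent]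

/-! ### Conjugation -/

theorem continuous_lie (x : 𝔤) : Continuous fun v : 𝔤 => ⁅x, v⁆ :=
  (LieAlgebra.ad ℝ 𝔤 x).continuous_of_finiteDimensional

omit [FiniteDimensional ℝ 𝔤] in
theorem hasDerivAt_expAd_smul (x v : 𝔤) (t : ℝ) :
    HasDerivAt (fun t : ℝ => S.expAd (t • x) v) ⁅x, S.expAd (t • x) v⁆ t := by
  have h : ∀ t : ℝ, S.expAd (t • x) v = ∑ k ∈ Finset.range S.step,
      ((k.factorial : ℝ)⁻¹) • t ^ k • (LieAlgebra.ad ℝ 𝔤 x ^ k) v := fun t => by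
    rw [expAd, LinearMap.sum_apply]
    refine Finset.sum_congr rfl fun k _ => ?_
    rw [LinearMap.smul_apply, map_smul, smul_pow, LinearMap.smul_apply]
  obtain ⟨n, hn⟩ : ∃ k, S.step = k + 1 := ⟨S.step - 1, by have := S.one_le_step; omega⟩
  have hd : HasDerivAt (fun t : ℝ => ∑ k ∈ Finset.range S.step,
      ((k.factorial : ℝ)⁻¹) • t ^ k • (LieAlgebra.ad ℝ 𝔤 x ^ k) v)
      (∑ k ∈ Finset.range S.step,
        ((k.factorial : ℝ)⁻¹) • ((k : ℝ) * t ^ (k - 1)) • (LieAlgebra.ad ℝ 𝔤 x ^ k) v) t :=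
    HasDerivAt.fun_sum fun k _ => ((hasDerivAt_pow k t).smul_const _).const_smul _
  simp_rw [h]
  refine hd.congr_deriv ?_
  have hx : (LieAlgebra.ad ℝ 𝔤 x ^ (n + 1)) v = 0 := by rw [← hn, S.ad_pow_step]; rfl
  rw [hn, Finset.sum_range_succ', Finset.sum_range_succ, lie_add, lie_sum]
  have e : ∀ k, ⁅x, (LieAlgebra.ad ℝ 𝔤 x ^ k) v⁆ = (LieAlgebra.ad ℝ 𝔤 x ^ (k + 1)) v := fun k => by
    rw [pow_succ', Module.End.mul_apply, LieAlgebra.ad_apply]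
  simp only [lie_smul, e, hx, smul_zero, add_zero, Nat.cast_zero, zero_mul, zero_smul]
  refine Finset.sum_congr rfl fun k _ => ?_
  rw [smul_smul, smul_smul, Nat.factorial_succ, Nat.add_sub_cancel]
  congr 1
  push_cast
  have : (k : ℝ) + 1 ≠ 0 := by positivity
  field_simp

/-- The curve t ↦ rep(e^(t ad x) v) solves f' = [rep x, f], whose flow is conjugation by exp(t rep
x). -/
theorem toUnipotent_conj (x v : 𝔤) :
    S.toUnipotent x * S.rep v * S.toUnipotent (-x) = S.rep (S.expAd x v) := by
  set X := S.rep x with hX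
  have hE : ∀ t : ℝ, HasDerivAt (fun t : ℝ => S.rep (S.expAd (t • x) v))
      (X * S.rep (S.expAd (t • x) v) - S.rep (S.expAd (t • x) v) * X) t := fun t => by
    rw [hX, ← rep_lie]
    exact (LinearMap.toContinuousLinearMap S.rep).hasFDerivAt.comp_hasDerivAt t
      (S.hasDerivAt_expAd_smul x v t)
  have key := exp_conj_of_hasDerivAt hE
  have h0 : S.expAd (0 : 𝔤) v = v := by simpa using S.expAd_self_smul 0 v
  rw [zero_smul, one_smul, h0] at key
  rw [← key, toUnipotent, toUnipotent, map_neg]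

/-! ### The Baker-Campbell-Hausdorff formula and the group laws -/

omit [NormedLieAlgebra 𝔤] [FiniteDimensional ℝ 𝔤] in
theorem continuous_pow_apply [NormedSpace ℝ 𝔤] {A : ℝ → Module.End ℝ 𝔤}
    (hA : ∀ v : ℝ → 𝔤, Continuous v → Continuous fun t => A t (v t)) (n : ℕ) {v : ℝ → 𝔤}
    (hv : Continuous v) : Continuous fun t => (A t ^ n) (v t) := by
  induction n with
  | zero => simpa using hv
  | succ n ih => simp_rw [pow_succ', Module.End.mul_apply]; exact hA _ ih

theorem continuous_expAd_smul_apply (y : 𝔤) {v : ℝ → 𝔤} (hv : Continuous v) :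
    Continuous fun t : ℝ => S.expAd (t • y) (v t) := by
  simp only [expAd, LinearMap.sum_apply, LinearMap.smul_apply]
  refine continuous_finsetSum _ fun k _ => (continuous_pow_apply (fun w hw => ?_) k hv).const_smul _
  simp only [map_smul, LinearMap.smul_apply, LieAlgebra.ad_apply]
  exact continuous_id.smul ((continuous_lie y).comp hw)

theorem continuous_bchPsi (x y : 𝔤) :
    Continuous fun t : ℝ => S.bchPsi (S.expAd x * S.expAd (t • y)) y := by
  have h1 : ∀ v : ℝ → 𝔤, Continuous v →
      Continuous fun t => (S.expAd x * S.expAd (t • y)) (v t) := fun v hv =>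
    (S.expAd x).continuous_of_finiteDimensional.comp (S.continuous_expAd_smul_apply y hv)
  simp_rw [bchPsi_apply]
  refine continuous_finsetSum _ fun k _ =>
    (continuous_pow_apply (fun w hw => ?_) k (h1 _ continuous_const)).const_smul _
  simp only [LinearMap.sub_apply]
  exact (h1 w hw).sub hw

/-- The curve U(t) = exp(x) exp(ty) satisfies U' = UY, and conjugation by U(t) acts on the image of
`rep` as e^(ad x) e^(t ad y). The derivative of the logarithm is thus the integrand that defines
`mul`. -/
theorem hasDerivAt_unipotentLog (x y : 𝔤) (t : ℝ) :
    HasDerivAt (fun t : ℝ => S.unipotentLog (S.toUnipotent x * S.toUnipotent (t • y)))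
      (S.rep (S.bchPsi (S.expAd x * S.expAd (t • y)) y)) t := by
  set Y := S.rep y with hY
  set U : ℝ → (𝔤 × ℝ) →L[ℝ] (𝔤 × ℝ) := fun t => S.toUnipotent x * S.toUnipotent (t • y) with hU
  set V := S.toUnipotent (-(t • y)) * S.toUnipotent (-x) with hV
  have hUd : HasDerivAt U (U t * Y) t := by
    have h := (hasDerivAt_exp_smul_const Y t).const_mul (S.toUnipotent x)
    simp only [hU, toUnipotent, map_smul, ← hY] at h ⊢
    rwa [mul_assoc]
  have hUV : U t * V = 1 := by
    calc U t * V = S.toUnipotent x * (S.toUnipotent (t • y) * S.toUnipotent (-(t • y))) *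
          S.toUnipotent (-x) := by simp only [hU, hV, mul_assoc]
      _ = 1 := by rw [toUnipotent_mul_neg, mul_one, toUnipotent_mul_neg]
  have hVU : V * U t = 1 := by
    calc V * U t = S.toUnipotent (-(t • y)) * (S.toUnipotent (-x) * S.toUnipotent x) *
          S.toUnipotent (t • y) := by simp only [hU, hV, mul_assoc]
      _ = 1 := by rw [toUnipotent_neg_mul, mul_one, toUnipotent_neg_mul]
  have key := hUd.truncLog rfl hUV hVU (S.toUnipotent_mul_sub_one_pow x (t • y)) le_rfl
  refine key.congr_deriv ?_
  set E := S.expAd x * S.expAd (t • y) with hE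
  have hz : ∀ v, U t * S.rep v * V = S.rep (E v) := fun v => by
    calc U t * S.rep v * V = S.toUnipotent x * (S.toUnipotent (t • y) * S.rep v *
          S.toUnipotent (-(t • y))) * S.toUnipotent (-x) := by simp only [hU, hV, mul_assoc]
      _ = S.rep (E v) := by rw [toUnipotent_conj, toUnipotent_conj, hE, Module.End.mul_apply]
  set Z := ContinuousLinearMap.mul ℝ ((𝔤 × ℝ) →L[ℝ] (𝔤 × ℝ)) (U t) *
    (ContinuousLinearMap.mul ℝ ((𝔤 × ℝ) →L[ℝ] (𝔤 × ℝ))).flip V - 1 with hZ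
  have hZ1 : ∀ v, Z (S.rep v) = S.rep ((E - 1) v) := fun v => by
    have : Z (S.rep v) = U t * S.rep v * V - S.rep v := by
      simp [hZ, mul_assoc]
    rw [this, hz, LinearMap.sub_apply, map_sub]
    rfl
  have hZk : ∀ k v, (Z ^ k) (S.rep v) = S.rep (((E - 1) ^ k) v) := fun k => by
    induction k with
    | zero => intro v; rfl
    | succ k ih => 
      intro v
      rw [pow_succ, mul_apply_eq_comp, hZ1, ih, pow_succ, Module.End.mul_apply]
  rw [hz, bchPsi_apply, map_sum]
  simp_rw [hZk, map_smul]
  symm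
  -- The logarithm is cut at 2(s + 1) and `bchPsi` at s; the additional terms contain powers that
  -- vanish.
  refine Finset.sum_subset (Finset.range_mono (by omega)) fun k _ hk => ?_
  rw [pow_eq_zero_of_le (by simpa using hk) (S.expAd_mul_expAd_sub_one_pow x (t • y)),
    LinearMap.zero_apply, map_zero, smul_zero]

theorem rep_mul (x y : 𝔤) :
    S.rep (S.mul x y) = S.unipotentLog (S.toUnipotent x * S.toUnipotent y) := by
  have hc := S.continuous_bchPsi x y
  have hr : Continuous S.rep := S.rep.continuous_of_finiteDimensional
  have h1 := intervalIntegral.integral_eq_sub_of_hasDerivAt (a := 0) (b := 1)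
    (fun t _ => S.hasDerivAt_unipotentLog x y t) ((hr.comp hc).intervalIntegrable 0 1)
  have h2 := (LinearMap.toContinuousLinearMap S.rep).intervalIntegral_comp_comm
    (hc.intervalIntegrable (μ := volume) 0 1)
  simp only [LinearMap.coe_toContinuousLinearMap'] at h2
  rw [mul, map_add, ← h2, h1]
  simp [toUnipotent_zero, unipotentLog_toUnipotent]

/-- Together with injectivity, this turns each group identity for `mul` into an identity between
operators. -/
theorem toUnipotent_mul (x y : 𝔤) :
    S.toUnipotent (S.mul x y) = S.toUnipotent x * S.toUnipotent y := by
  rw [toUnipotent, rep_mul, exp_unipotentLog_mul]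

theorem mul_assoc' (x y z : 𝔤) : S.mul (S.mul x y) z = S.mul x (S.mul y z) :=
  S.toUnipotent_injective <| by simp only [toUnipotent_mul, mul_assoc]

theorem zero_mul' (x : 𝔤) : S.mul 0 x = x :=
  S.toUnipotent_injective <| by simp only [toUnipotent_mul, toUnipotent_zero, one_mul]

theorem mul_zero' (x : 𝔤) : S.mul x 0 = x :=
  S.toUnipotent_injective <| by simp only [toUnipotent_mul, toUnipotent_zero, mul_one]

theorem mul_neg_self (x : 𝔤) : S.mul x (-x) = 0 :=
  S.toUnipotent_injective <| by simp only [toUnipotent_mul, toUnipotent_mul_neg, toUnipotent_zero]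

theorem neg_mul_self (x : 𝔤) : S.mul (-x) x = 0 := by
  simpa using S.mul_neg_self (-x)

theorem neg_mul_cancel_left' (x y : 𝔤) : S.mul (-x) (S.mul x y) = y := by
  rw [← mul_assoc', neg_mul_self, zero_mul']

theorem mul_neg_cancel_left' (x y : 𝔤) : S.mul x (S.mul (-x) y) = y := by
  rw [← mul_assoc', mul_neg_self, zero_mul']

theorem neg_mul_rev' (x y : 𝔤) : -(S.mul x y) = S.mul (-y) (-x) := by
  rw [← S.neg_mul_cancel_left' (S.mul x y) (S.mul (-y) (-x)), mul_assoc', mul_neg_cancel_left',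
    mul_neg_self, mul_zero']

theorem smul_mul_smul_self (a b : ℝ) (v : 𝔤) : S.mul (a • v) (b • v) = (a + b) • v := by
  let _ : NormedAlgebra ℚ ((𝔤 × ℝ) →L[ℝ] (𝔤 × ℝ)) := NormedAlgebra.restrictScalars ℚ ℝ _
  refine S.toUnipotent_injective ?_
  rw [toUnipotent_mul, toUnipotent, toUnipotent, toUnipotent, ← NormedSpace.exp_add_of_commute,
    add_smul, map_add]
  simp only [map_smul, commute_iff_eq]
  rw [smul_mul_smul_comm, smul_mul_smul_comm, mul_comm]

/-- Conjugation is linear in these coordinates, which allows group commutators to be expanded by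
brackets. -/
theorem mul_conj (x v : 𝔤) : S.mul (S.mul x v) (-x) = S.expAd x v := by
  refine S.rep_injective ?_
  have h : S.toUnipotent (S.mul (S.mul x v) (-x)) = NormedSpace.exp (S.rep (S.expAd x v)) := by
    let _ : NormedAlgebra ℚ ((𝔤 × ℝ) →L[ℝ] (𝔤 × ℝ)) := NormedAlgebra.restrictScalars ℚ ℝ _
    let u : ((𝔤 × ℝ) →L[ℝ] (𝔤 × ℝ))ˣ :=
      ⟨S.toUnipotent x, S.toUnipotent (-x), S.toUnipotent_mul_neg x, S.toUnipotent_neg_mul x⟩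
    have := NormedSpace.exp_units_conj u (S.rep v)
    rw [← toUnipotent_conj, toUnipotent_mul, toUnipotent_mul]
    exact this.symm
  rw [← unipotentLog_toUnipotent, ← unipotentLog_toUnipotent, h]
  rfl

/-- The product is x + y up to iterated brackets that contain [x, y]. This is checked on the
integrand: its constant term is e^(ad x) y, congruent to y, and every further power of z - 1 only
raises the filtration. The projections then pass through the integral. -/
theorem mul_sub_mem_filtration {l : ℕ} (hl : 1 ≤ l) {x y : 𝔤} (h : ⁅x, y⁆ ∈ S.filtration l) :
    S.mul x y - (x + y) ∈ S.filtration l := by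
  have hm : ∀ t : ℝ, S.bchPsi (S.expAd x * S.expAd (t • y)) y - y ∈ S.filtration l := fun t => by
    obtain ⟨l, rfl⟩ : ∃ k, l = k + 1 := ⟨l - 1, by omega⟩
    obtain ⟨n, hn⟩ : ∃ k, S.step = k + 1 := ⟨S.step - 1, by have := S.one_le_step; omega⟩
    have hE : (S.expAd x * S.expAd (t • y)) y = S.expAd x y := by
      rw [Module.End.mul_apply, S.expAd_self_smul]
    have h1 := S.expAd_sub_mem hl h
    have h2 : (S.expAd x * S.expAd (t • y) - 1) (S.expAd x y) ∈ S.filtration (l + 1) := by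
      have e : S.expAd x y = (S.expAd x y - y) + y := by abel
      rw [e, map_add]
      refine add_mem (S.filtration_antitone (Nat.le_succ _)
        (S.expAd_mul_expAd_sub_one_raising x (t • y) l _ h1)) ?_
      rw [LinearMap.sub_apply, hE]
      exact h1
    rw [bchPsi_apply, hE, hn, Finset.sum_range_succ', add_sub_assoc]
    refine add_mem (sum_mem fun k _ => Submodule.smul_mem _ _ ?_) (by simpa [logCoeff] using h1)
    rw [pow_succ, Module.End.mul_apply]
    exact S.filtration_antitone (by omega) (pow_mem_of_raising
      (Fil := fun j => S.filtration (j + 1)) (S.expAd_mul_expAd_sub_one_raising x (t • y)) k h2)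
  have hc := S.continuous_bchPsi x y
  have e : S.mul x y - (x + y) =
      ∫ t in (0 : ℝ)..1, (S.bchPsi (S.expAd x * S.expAd (t • y)) y - y) := by
    rw [intervalIntegral.integral_sub (hc.intervalIntegrable 0 1)
      (continuous_const.intervalIntegrable 0 1), mul]
    simp
  rw [e, S.mem_filtration]
  intro i hi
  have h2 := (LinearMap.toContinuousLinearMap (S.proj i)).intervalIntegral_comp_comm
    ((hc.sub (continuous_const (y := y))).intervalIntegrable (μ := volume) 0 1)
  simp only [LinearMap.coe_toContinuousLinearMap', Pi.sub_apply] at h2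
  refine h2.symm.trans ?_
  simp_rw [fun t : ℝ => hm t i hi]
  simp

omit [FiniteDimensional ℝ 𝔤] in
theorem dil_expAd (c : ℝ) (x v : 𝔤) : S.dil c (S.expAd x v) = S.expAd (S.dil c x) (S.dil c v) := by
  have h : ∀ k, S.weighted (fun j => c ^ j) ((LieAlgebra.ad ℝ 𝔤 x ^ k) v) =
      (LieAlgebra.ad ℝ 𝔤 (S.dil c x) ^ k) (S.dil c v) := fun k => by
    induction k with
    | zero => simp [dil_eq_weighted]
    | succ k ih =>
      rw [pow_succ', Module.End.mul_apply, LieAlgebra.ad_apply, ← dil_eq_weighted, dil_lie,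
        dil_eq_weighted, dil_eq_weighted, ih, pow_succ', Module.End.mul_apply, LieAlgebra.ad_apply,
        dil_eq_weighted]
  simp only [expAd, dil_eq_weighted, LinearMap.sum_apply, LinearMap.smul_apply, map_sum, map_smul, h]

theorem dil_mul (c : ℝ) (x y : 𝔤) : S.dil c (S.mul x y) = S.mul (S.dil c x) (S.dil c y) := by
  have hz : ∀ (t : ℝ) v, S.dil c ((S.expAd x * S.expAd (t • y)) v) =
      (S.expAd (S.dil c x) * S.expAd (t • S.dil c y)) (S.dil c v) := fun t v => by
    rw [Module.End.mul_apply, dil_expAd, dil_expAd, dil_smul, Module.End.mul_apply]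
  have hk : ∀ (t : ℝ) (k : ℕ) (v : 𝔤), S.dil c (((S.expAd x * S.expAd (t • y) - 1) ^ k) v) =
      ((S.expAd (S.dil c x) * S.expAd (t • S.dil c y) - 1) ^ k) (S.dil c v) := fun t k => by
    induction k with
    | zero => intro v; rfl
    | succ k ih =>
      intro v
      rw [pow_succ, Module.End.mul_apply, ih, pow_succ, Module.End.mul_apply, LinearMap.sub_apply,
        dil_sub, hz]
      rfl
  have hp : ∀ t : ℝ, S.dil c (S.bchPsi (S.expAd x * S.expAd (t • y)) y) =
      S.bchPsi (S.expAd (S.dil c x) * S.expAd (t • S.dil c y)) (S.dil c y) := fun t => by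
    rw [bchPsi_apply, bchPsi_apply, dil_eq_weighted, map_sum]
    simp_rw [map_smul, ← dil_eq_weighted, hk, hz]
  have h2 := (LinearMap.toContinuousLinearMap (S.weighted fun j => c ^ j)).intervalIntegral_comp_comm
    ((S.continuous_bchPsi x y).intervalIntegrable (μ := volume) 0 1)
  simp only [LinearMap.coe_toContinuousLinearMap', ← dil_eq_weighted] at h2
  rw [mul, dil_add, ← h2, mul]
  simp_rw [hp]

/-! ### Smoothness -/

theorem contDiff_toUnipotent : ContDiff ℝ 1 S.toUnipotent := by
  have h : S.toUnipotent = fun x => truncExp (S.step + 1) (S.rep x) :=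
    funext S.toUnipotent_eq_truncExp
  rw [h]
  have hr : ContDiff ℝ 1 S.rep := (LinearMap.toContinuousLinearMap S.rep).contDiff
  exact ContDiff.sum fun k _ => (hr.pow k).const_smul _

omit [FiniteDimensional ℝ 𝔤] in
theorem contDiff_unipotentLog : ContDiff ℝ 1 S.unipotentLog := by
  unfold unipotentLog truncLog
  exact ContDiff.sum fun k _ => ((contDiff_id.sub contDiff_const).pow (k + 1)).const_smul _

/-- In the representation the product is built from truncated exponential and logarithmic series,
which are polynomial; a linear left inverse of `rep` brings it back to 𝔤. -/
theorem contDiff_mul : ContDiff ℝ 1 fun p : 𝔤 × 𝔤 => S.mul p.1 p.2 := by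
  obtain ⟨P, hP⟩ := S.rep.exists_leftInverse_of_injective (LinearMap.ker_eq_bot.2 S.rep_injective)
  have h : (fun p : 𝔤 × 𝔤 => S.mul p.1 p.2) = fun p =>
      P (S.unipotentLog (S.toUnipotent p.1 * S.toUnipotent p.2)) := by
    funext p
    rw [← rep_mul]
    exact (LinearMap.congr_fun hP _).symm
  rw [h]
  exact (LinearMap.toContinuousLinearMap P).contDiff.comp (S.contDiff_unipotentLog.comp
    ((S.contDiff_toUnipotent.comp contDiff_fst).mul (S.contDiff_toUnipotent.comp contDiff_snd)))

theorem continuous_mul' : Continuous fun p : 𝔤 × 𝔤 => S.mul p.1 p.2 := S.contDiff_mul.continuous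

theorem continuous_dil (c : ℝ) : Continuous (S.dil c) := by
  have h : S.dil c = S.weighted fun j => c ^ j := funext (S.dil_eq_weighted c)
  rw [h]
  exact LinearMap.continuous_of_finiteDimensional _

end

end Stratification

/-! ### The first layer generates the group -/

namespace Stratification

variable {𝔤 : Type*} [NormedLieRing 𝔤] [NormedLieAlgebra 𝔤] (S : Stratification 𝔤)

/-- The products of `n` elements of the first layer of norm at most `R`. -/
def wordSet (R : ℝ) : ℕ → Set 𝔤
  | 0 => {0}
  | n + 1 => (fun p : 𝔤 × 𝔤 => S.mul p.1 p.2) ''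
      (wordSet R n ×ˢ ((S.V 1 : Set 𝔤) ∩ Metric.closedBall 0 R))

theorem wordSet_mono {R R' : ℝ} (h : R ≤ R') (n : ℕ) : S.wordSet R n ⊆ S.wordSet R' n := by
  induction n with
  | zero => exact subset_rfl
  | succ n ih =>
    exact image_mono (prod_mono ih (inter_subset_inter_right _ (Metric.closedBall_subset_closedBall h)))

variable [FiniteDimensional ℝ 𝔤]

theorem isCompact_wordSet (R : ℝ) (n : ℕ) : IsCompact (S.wordSet R n) := by
  induction n with
  | zero => exact isCompact_singleton
  | succ n ih =>
    exact (ih.prod ((isCompact_closedBall 0 R).inter_left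
      (S.V 1).closed_of_finiteDimensional)).image S.continuous_mul'

theorem mul_mem_wordSet {R : ℝ} {n m : ℕ} {x y : 𝔤} (hx : x ∈ S.wordSet R n)
    (hy : y ∈ S.wordSet R m) : S.mul x y ∈ S.wordSet R (n + m) := by
  induction m generalizing y with
  | zero =>
    obtain rfl : y = 0 := hy
    rwa [mul_zero']
  | succ m ih =>
    obtain ⟨⟨g, v⟩, ⟨hg, hv⟩, rfl⟩ := hy
    exact ⟨(S.mul x g, v), ⟨ih hg, hv⟩, S.mul_assoc' _ _ _⟩

/-- `x` is a product of elements of the first layer. -/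
def IsWord (x : 𝔤) : Prop := ∃ R n, x ∈ S.wordSet R n

variable {S}

theorem IsWord.mul {x y : 𝔤} (hx : S.IsWord x) (hy : S.IsWord y) : S.IsWord (S.mul x y) := by
  obtain ⟨R, n, hx⟩ := hx
  obtain ⟨R', m, hy⟩ := hy
  exact ⟨max R R', n + m, S.mul_mem_wordSet (S.wordSet_mono (le_max_left _ _) n hx)
    (S.wordSet_mono (le_max_right _ _) m hy)⟩

theorem IsWord.of_mem {v : 𝔤} (hv : v ∈ S.V 1) : S.IsWord v :=
  ⟨‖v‖, 1, (0, v), ⟨rfl, hv, by simp⟩, S.zero_mul' v⟩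

theorem IsWord.neg {x : 𝔤} (hx : S.IsWord x) : S.IsWord (-x) := by
  obtain ⟨R, n, hx⟩ := hx
  induction n generalizing x with
  | zero =>
    obtain rfl : x = 0 := hx
    exact ⟨R, 0, by simp [wordSet]⟩
  | succ n ih =>
    obtain ⟨⟨g, v⟩, ⟨hg, hv⟩, rfl⟩ := hx
    rw [neg_mul_rev']
    exact (IsWord.of_mem (neg_mem hv.1)).mul (ih hg)

variable (S)

omit [FiniteDimensional ℝ 𝔤] in
theorem lie_mem_filtration_succ {j : ℕ} (hj : 1 ≤ j) {x y : 𝔤} (hx : x ∈ S.filtration j)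
    (hy : y ∈ S.filtration j) : ⁅x, y⁆ ∈ S.filtration (j + 1) :=
  S.filtration_antitone (by omega) (S.lie_mem_filtration hx hy)

/-- A bracket [x, y] with x in V_j and y in V_1 is, modulo F_{j+2}, the group commutator h y h⁻¹
y⁻¹, where h is a word congruent to x modulo F_{j+1}: conjugation by h is e^(ad h), and [h,[h,y]]
lies in F_{2j+1}. Products of such elements are sums up to higher order. -/
theorem exists_isWord_sub_mem {j : ℕ} (hj : 1 ≤ j) : ∀ z ∈ S.V j,
    ∃ h, S.IsWord h ∧ h ∈ S.filtration j ∧ h - z ∈ S.filtration (j + 1) := by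
  induction j, hj using Nat.le_induction with
  | base => exact fun z hz =>
      ⟨z, IsWord.of_mem hz, S.layer_le_filtration le_rfl hz, by simp⟩
  | succ j hj ih =>
    intro z hz
    -- The expansion e^(ad h) y = y + [h, y] + ⋯ below needs two terms of the truncated series,
    -- hence step at least 2; this holds as j + 1 ≤ s.
    rcases lt_or_ge S.step (j + 1) with hs | hs
    · rw [S.layer_eq_bot _ hs, Submodule.mem_bot] at hz
      exact ⟨0, ⟨0, 0, rfl⟩, zero_mem _, by simp [hz]⟩
    rw [← S.span_lie j hj, Submodule.mem_span_set'] at hz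
    obtain ⟨n, f, g, rfl⟩ := hz
    refine Finset.sum_induction _ (fun z => ∃ h, S.IsWord h ∧ h ∈ S.filtration (j + 1) ∧
      h - z ∈ S.filtration (j + 1 + 1)) ?_ ⟨0, ⟨0, 0, rfl⟩, zero_mem _, by simp⟩ ?_
    · rintro z w ⟨h, hh, hF, hz⟩ ⟨h', hh', hF', hw⟩
      have h1 := S.mul_sub_mem_filtration (by omega)
        (S.lie_mem_filtration_succ (by omega) hF hF')
      refine ⟨S.mul h h', hh.mul hh', ?_, ?_⟩
      · have := add_mem (S.filtration_antitone (Nat.le_succ _) h1) (add_mem hF hF')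
        rwa [sub_add_cancel] at this
      · have := add_mem h1 (add_mem hz hw)
        convert this using 1
        abel
    · rintro i -
      obtain ⟨x, hx, y, hy, hxy⟩ := (g i).2
      rw [← hxy, ← smul_lie]
      obtain ⟨h, hh, hF, hz⟩ := ih _ (Submodule.smul_mem _ (f i) hx)
      have hy1 : y ∈ S.filtration 1 := by rw [S.filtration_one]; trivial
      have hc : ⁅h, y⁆ ∈ S.filtration (j + 1) := S.lie_mem_filtration hF hy1
      have h2 : S.expAd h y - y - ⁅h, y⁆ ∈ S.filtration (j + 1 + 1) :=
        truncExp_sub_one_sub_mem (Fil := fun j => S.filtration (j + 1)) S.filtration_succ_antitone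
          (S.ad_raising h) (by omega)
          (S.filtration_antitone (by omega) (S.lie_mem_filtration hF hc))
      have h3 : S.expAd h y - y ∈ S.filtration (j + 1) := by
        have := add_mem (S.filtration_antitone (Nat.le_succ _) h2) hc
        rwa [sub_add_cancel] at this
      have h4 : S.mul (S.expAd h y) (-y) - (S.expAd h y + -y) ∈ S.filtration (j + 1 + 1) := by
        refine S.mul_sub_mem_filtration (by omega) ?_
        have e : ⁅S.expAd h y, -y⁆ = -⁅S.expAd h y - y, y⁆ := by simp
        rw [e]
        exact neg_mem (S.lie_mem_filtration h3 hy1)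
      have h5 : ⁅h - f i • x, y⁆ ∈ S.filtration (j + 1 + 1) := S.lie_mem_filtration hz hy1
      have h6 : S.mul (S.expAd h y) (-y) - ⁅f i • x, y⁆ ∈ S.filtration (j + 1 + 1) := by
        have := add_mem (add_mem h4 h2) h5
        convert this using 1
        rw [sub_lie]
        abel
      refine ⟨S.mul (S.expAd h y) (-y), ?_, ?_, h6⟩
      · rw [← mul_conj]
        exact ((hh.mul (IsWord.of_mem hy)).mul hh.neg).mul (IsWord.of_mem hy).neg
      · have := add_mem (S.filtration_antitone (Nat.le_succ _) h6)
          (S.lie_mem_filtration (S.layer_le_filtration le_rfl (Submodule.smul_mem _ (f i) hx)) hy1)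
        rwa [sub_add_cancel] at this

/-- Layers are removed one by one: left multiplication by the inverse of a word that matches the
leading component moves z to the next step of the filtration, until nothing is left. -/
theorem isWord_of_mem_filtration (d : ℕ) : ∀ j, 1 ≤ j → S.step + 1 ≤ j + d →
    ∀ z ∈ S.filtration j, S.IsWord z := by
  induction d with
  | zero =>
    intro j _ hj z hz
    rw [S.filtration_eq_bot (by omega), Submodule.mem_bot] at hz
    exact hz ▸ ⟨0, 0, rfl⟩
  | succ d ih =>
    intro k hk1 hk z hz
    obtain ⟨h, hh, hF, hhz⟩ := S.exists_isWord_sub_mem hk1 _ (S.proj_mem k z)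
    have h1 := S.sub_proj_mem_filtration hz
    have h2 := S.mul_sub_mem_filtration (by omega)
      (S.lie_mem_filtration_succ hk1 (neg_mem hF) hz)
    have h3 : S.mul (-h) z ∈ S.filtration (k + 1) := by
      have := add_mem h2 (sub_mem h1 hhz)
      convert this using 1
      abel
    rw [← S.mul_neg_cancel_left' h z]
    exact hh.mul (ih (k + 1) (by omega) (by omega) _ h3)

theorem isWord (x : 𝔤) : S.IsWord x :=
  S.isWord_of_mem_filtration S.step 1 le_rfl (by omega) x (by rw [S.filtration_one]; trivial)

/-- The group is a countable union of compact word sets, so by Baire one of them has an interior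
point g. Left translation by g⁻¹, itself a word, brings a neighbourhood of g to the identity. -/
theorem exists_wordSet_mem_nhds : ∃ R n, S.wordSet R n ∈ 𝓝 (0 : 𝔤) := by
  have hU : ⋃ p : ℕ × ℕ, S.wordSet p.1 p.2 = univ := by
    refine eq_univ_of_forall fun x => ?_
    obtain ⟨R, k, hx⟩ := S.isWord x
    exact mem_iUnion.2 ⟨(⌈R⌉₊, k), S.wordSet_mono (Nat.le_ceil R) k hx⟩
  obtain ⟨⟨N, n⟩, g, hg⟩ := nonempty_interior_of_iUnion_of_closed
    (fun p : ℕ × ℕ => (S.isCompact_wordSet p.1 p.2).isClosed) hU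
  obtain ⟨R, k, hk⟩ := S.isWord (-g)
  refine ⟨max R N, k + n, ?_⟩
  have hc : Continuous fun y => S.mul g y := S.continuous_mul'.comp (by fun_prop : Continuous fun y => (g, y))
  have h0 : (fun y => S.mul g y) ⁻¹' (S.wordSet N n) ∈ 𝓝 (0 : 𝔤) := by
    refine hc.continuousAt.preimage_mem_nhds ?_
    rw [mul_zero']
    exact mem_interior_iff_mem_nhds.1 hg
  refine mem_of_superset h0 fun y hy => ?_
  rw [← S.neg_mul_cancel_left' g y]
  exact S.mul_mem_wordSet (S.wordSet_mono (le_max_left _ _) k hk)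
    (S.wordSet_mono (le_max_right _ _) n hy)

end Stratification

/-! ### Horizontal curves and the Carnot-Carathéodory distance -/

namespace Stratification

noncomputable section

variable {𝔤 : Type*} [NormedLieRing 𝔤] [NormedLieAlgebra 𝔤] [FiniteDimensional ℝ 𝔤]
  (S : Stratification 𝔤)

theorem continuous_mul_left' (g : 𝔤) : Continuous (S.mul g) :=
  S.continuous_mul'.comp (by fun_prop : Continuous fun y => (g, y))

theorem contDiff_mul_left (g : 𝔤) : ContDiff ℝ 1 (S.mul g) :=
  S.contDiff_mul.comp (contDiff_const.prodMk contDiff_id : ContDiff ℝ 1 fun y => (g, y))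

theorem hasDerivAt_mul_smul (g v : 𝔤) (t : ℝ) :
    HasDerivAt (fun t : ℝ => S.mul g (t • v)) (S.leftInvariantField v (S.mul g (t • v))) t := by
  have h : ∀ g, HasDerivAt (fun t : ℝ => S.mul g (t • v)) (S.leftInvariantField v g) 0 := fun g => by
    have h2 : HasFDerivAt (S.mul g) (fderiv ℝ (S.mul g) ((0 : ℝ) • v)) ((0 : ℝ) • v) :=
      ((S.contDiff_mul_left g).differentiable one_ne_zero _).hasFDerivAt
    exact (h2.comp_hasDerivAt (0 : ℝ)
      ((hasDerivAt_id (0 : ℝ)).smul_const v)).differentiableAt.hasDerivAt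
  have h1 := (h (S.mul g (t • v)))
  rw [← sub_self t] at h1
  refine (h1.comp_sub_const t t).congr_of_eventuallyEq (Eventually.of_forall fun s => ?_)
  simp only [S.mul_assoc', S.smul_mul_smul_self, add_sub_cancel]

theorem leftInvariantField_eq_fderiv (v g : 𝔤) :
    S.leftInvariantField v g = fderiv ℝ (fun p : 𝔤 × 𝔤 => S.mul p.1 p.2) (g, 0) (0, v) := by
  have h1 : HasDerivAt (fun t : ℝ => (g, t • v)) ((0 : 𝔤), v) 0 := by
    simpa using (hasDerivAt_const (0 : ℝ) g).prodMk ((hasDerivAt_id (0 : ℝ)).smul_const v)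
  have h2 : HasFDerivAt (fun p : 𝔤 × 𝔤 => S.mul p.1 p.2)
      (fderiv ℝ (fun p : 𝔤 × 𝔤 => S.mul p.1 p.2) (g, 0)) (g, (0 : ℝ) • v) := by
    rw [zero_smul]
    exact (S.contDiff_mul.differentiable one_ne_zero _).hasFDerivAt
  exact (h2.comp_hasDerivAt (0 : ℝ) h1).deriv

theorem leftInvariantField_sum {ι : Type*} (s : Finset ι) (a : ι → ℝ) (v : ι → 𝔤) (g : 𝔤) :
    S.leftInvariantField (∑ i ∈ s, a i • v i) g = ∑ i ∈ s, a i • S.leftInvariantField (v i) g := by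
  simp only [leftInvariantField_eq_fderiv]
  have : ((0 : 𝔤), ∑ i ∈ s, a i • v i) = ∑ i ∈ s, a i • ((0 : 𝔤), v i) := by
    rw [Prod.ext_iff]; simp [Prod.fst_sum, Prod.snd_sum]
  rw [this, map_sum]
  simp only [map_smul]

theorem exists_norm_leftInvariantField_le :
    ∃ C : ℝ, 0 ≤ C ∧ ∀ g : 𝔤, ‖g‖ ≤ 1 → ∀ v, ‖S.leftInvariantField v g‖ ≤ C * ‖v‖ := by
  have hc : Continuous fun g : 𝔤 => fderiv ℝ (fun p : 𝔤 × 𝔤 => S.mul p.1 p.2) (g, 0) :=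
    (S.contDiff_mul.continuous_fderiv one_ne_zero).comp (by fun_prop)
  obtain ⟨C, hC⟩ := (isCompact_closedBall (0 : 𝔤) 1).exists_bound_of_continuousOn hc.continuousOn
  refine ⟨C, (norm_nonneg _).trans (hC 0 (by simp)), fun g hg v => ?_⟩
  rw [leftInvariantField_eq_fderiv]
  refine (ContinuousLinearMap.le_opNorm _ _).trans ?_
  have : ‖((0 : 𝔤), v)‖ = ‖v‖ := by simp [Prod.norm_def]
  rw [this]
  exact mul_le_mul_of_nonneg_right (hC g (by simpa using hg)) (norm_nonneg _)

variable {k : ℕ} (X : Module.Basis (Fin k) ℝ (S.V 1))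

omit [FiniteDimensional ℝ 𝔤] in
theorem ccDist_lt_iff (x y : 𝔤) {r : ℝ} (hr : 0 < r) :
    S.ccDist X x y < ENNReal.ofReal r ↔ ∃ (γ : ℝ → 𝔤) (a : ℝ → Fin k → ℝ),
      S.IsHorizontal X x y γ a ∧
        ∫⁻ t in Icc (0 : ℝ) 1, ENNReal.ofReal (∑ i, |a t i| ^ 2) < ENNReal.ofReal (r ^ 2) := by
  have h : ENNReal.ofReal r = ENNReal.ofReal (r ^ 2) ^ (1 / 2 : ℝ) := by
    rw [ENNReal.ofReal_rpow_of_pos (by positivity), ← Real.sqrt_eq_rpow, Real.sqrt_sq hr.le]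
  rw [ccDist, h, ENNReal.rpow_lt_rpow_iff (by norm_num)]
  simp only [iInf_lt_iff, exists_prop]

/-- The curve `γ` is transported by a left translation composed with a dilation. -/
theorem IsHorizontal.transport {S : Stratification 𝔤} {X : Module.Basis (Fin k) ℝ (S.V 1)}
    {x y : 𝔤} {γ : ℝ → 𝔤} {a : ℝ → Fin k → ℝ} (h : S.IsHorizontal X x y γ a) (g : 𝔤) (c : ℝ) :
    S.IsHorizontal X (S.mul g (S.dil c x)) (S.mul g (S.dil c y))
      (fun t => S.mul g (S.dil c (γ t))) (fun t i => c * a t i) := by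
  obtain ⟨h0, h1, ⟨K, hK⟩, hd⟩ := h
  have hT : ContDiff ℝ 1 fun p => S.mul g (S.dil c p) := by
    refine (S.contDiff_mul_left g).comp ?_
    have h : S.dil c = S.weighted fun j => c ^ j := funext (S.dil_eq_weighted c)
    rw [h]
    exact (LinearMap.toContinuousLinearMap (S.weighted fun j => c ^ j)).contDiff
  -- On the first layer the dilation is multiplication by c, so it sends the curve p exp(tv) to one
  -- with velocity cv; left translation preserves left invariant fields.
  have hX : ∀ p, ∀ v ∈ S.V 1, fderiv ℝ (fun p => S.mul g (S.dil c p)) p (S.leftInvariantField v p) =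
      c • S.leftInvariantField v (S.mul g (S.dil c p)) := fun p v hv => by
    have e1 : HasFDerivAt (fun p => S.mul g (S.dil c p))
        (fderiv ℝ (fun p => S.mul g (S.dil c p)) p) (S.mul p ((0 : ℝ) • v)) := by
      rw [zero_smul, mul_zero']
      exact (hT.differentiable one_ne_zero _).hasFDerivAt
    have e2 := e1.comp_hasDerivAt (0 : ℝ) (S.hasDerivAt_mul_smul p v 0)
    rw [zero_smul, mul_zero'] at e2
    have e3 := S.hasDerivAt_mul_smul (S.mul g (S.dil c p)) (c • v) 0
    rw [zero_smul, mul_zero'] at e3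
    have e4 : ((fun p => S.mul g (S.dil c p)) ∘ fun t : ℝ => S.mul p (t • v)) =
        fun t : ℝ => S.mul (S.mul g (S.dil c p)) (t • (c • v)) := by
      funext t
      simp only [Function.comp, dil_mul, S.mul_assoc', S.dil_smul, S.dil_of_mem_one c hv]
    rw [e4] at e2
    rw [e2.unique e3]
    simp only [leftInvariantField_eq_fderiv]
    rw [← map_smul]
    simp
  refine ⟨by simp only [h0], by simp only [h1], ?_, ?_⟩
  · have hcpt : IsCompact (γ '' Icc 0 1) := isCompact_Icc.image_of_continuousOn hK.continuousOn
    obtain ⟨R, hR⟩ := hcpt.isBounded.subset_closedBall 0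
    obtain ⟨K', hK'⟩ := (hT.contDiffOn (s := Metric.closedBall 0 R)).exists_lipschitzOnWith
      one_ne_zero (convex_closedBall 0 R) (isCompact_closedBall 0 R)
    exact ⟨K' * K, hK'.comp hK fun t ht => hR (mem_image_of_mem γ ht)⟩
  · filter_upwards [hd] with t ht
    have e := ((hT.differentiable one_ne_zero (γ t)).hasFDerivAt).comp_hasDerivAt t ht
    refine e.congr_deriv ?_
    rw [map_sum]
    refine Finset.sum_congr rfl fun i _ => ?_
    rw [map_smul, hX _ _ (X i).2, smul_smul, mul_comm]

theorem mem_ccBall_transport {x y : 𝔤} {r : ℝ} (hr : 0 < r) (h : y ∈ S.ccBall X x r) (g : 𝔤) {c : ℝ}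
    (hc : 0 < c) : S.mul g (S.dil c y) ∈ S.ccBall X (S.mul g (S.dil c x)) (c * r) := by
  obtain ⟨γ, a, hγ, ha⟩ := (S.ccDist_lt_iff X x y hr).1 h
  refine (S.ccDist_lt_iff X _ _ (by positivity)).2 ⟨_, _, hγ.transport g c, ?_⟩
  have e : ∀ t, ENNReal.ofReal (∑ i, |c * a t i| ^ 2) =
      ENNReal.ofReal (c ^ 2) * ENNReal.ofReal (∑ i, |a t i| ^ 2) := fun t => by
    rw [← ENNReal.ofReal_mul (by positivity), Finset.mul_sum]
    simp [mul_pow]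
  simp_rw [e]
  rw [lintegral_const_mul' _ _ ENNReal.ofReal_ne_top, mul_pow, ENNReal.ofReal_mul (by positivity)]
  exact ENNReal.mul_lt_mul_right (by simpa using hc.ne') ENNReal.ofReal_ne_top ha

/-- A horizontal curve from 0 that leaves the unit ball must spend a definite energy, since up to
the first exit the fields X_i are bounded. -/
theorem exists_ccBall_subset_ball : ∃ ε : ℝ, 0 < ε ∧ S.ccBall X 0 ε ⊆ Metric.ball 0 1 := by
  obtain ⟨C, hC0, hC⟩ := S.exists_norm_leftInvariantField_le
  set B : ℝ := ∑ i, ‖(X i : 𝔤)‖ ^ 2 with hB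
  have hB0 : 0 ≤ B := by positivity
  -- D times the squared norm of the controls bounds the squared speed inside the unit ball, and the
  -- summand 1 keeps D positive. The radius 1/√D makes the energy smaller than 1/D.
  set D : ℝ := C ^ 2 * B + 1 with hD
  have hDpos : 0 < D := by positivity
  refine ⟨1 / Real.sqrt D, by positivity, fun y hy => ?_⟩
  obtain ⟨γ, a, ⟨h0, h1, ⟨K, hK⟩, hd⟩, ha⟩ := (S.ccDist_lt_iff X 0 y (by positivity)).1 hy
  rw [div_pow, Real.sq_sqrt hDpos.le, one_pow] at ha
  rw [mem_ball_zero_iff]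
  by_contra! hy1
  have hcl : IsCompact (Icc (0 : ℝ) 1 ∩ (fun t => ‖γ t‖) ⁻¹' Ici 1) :=
    isCompact_Icc.of_isClosed_subset
      (hK.continuousOn.norm.preimage_isClosed_of_isClosed isClosed_Icc isClosed_Ici) inter_subset_left
  obtain ⟨T, ⟨hT, hT1⟩, hTmin⟩ := hcl.exists_isLeast ⟨1, by simp, by simpa [h1] using hy1⟩
  have hlt : ∀ t ∈ Ico 0 T, ‖γ t‖ ≤ 1 := fun t ht => by
    by_contra! h
    exact absurd (hTmin ⟨⟨ht.1, ht.2.le.trans hT.2⟩, h.le⟩) (not_le.2 ht.2)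
  -- A functional that norms the exit point reduces the estimate to a scalar Lipschitz function, for
  -- which the fundamental theorem of calculus holds.
  obtain ⟨ℓ, hℓ, hℓT⟩ := exists_dual_vector'' ℝ (γ T)
  set f : ℝ → ℝ := fun t => ℓ (γ t) with hf
  have hfL : LipschitzOnWith (‖ℓ‖₊ * K) f (uIcc 0 T) := by
    rw [uIcc_of_le hT.1]
    exact (ℓ.lipschitz.lipschitzOnWith (s := univ)).comp (hK.mono (Icc_subset_Icc_right hT.2))
      (mapsTo_univ _ _)
  have hint := hfL.absolutelyContinuousOnInterval.integral_deriv_eq_sub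
  have hf1 : 1 ≤ f T - f 0 := by
    have : f T = ‖γ T‖ := by simpa [hf] using hℓT
    rw [this, hf]
    simpa [h0] using hT1
  have hderiv : ∀ᵐ t ∂(volume.restrict (Ioc 0 T)), ‖deriv f t‖ₑ ≤ ENNReal.ofReal (1 / 2) +
      ENNReal.ofReal (D / 2) * ENNReal.ofReal (∑ i, |a t i| ^ 2) := by
    have hd' := ae_restrict_of_ae_restrict_of_subset
      ((Ioc_subset_Icc_self).trans (Icc_subset_Icc_right hT.2)) hd
    have hne : ∀ᵐ t ∂(volume.restrict (Ioc 0 T)), t ≠ T :=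
      ae_restrict_of_ae (by simp [ae_iff])
    filter_upwards [hd', hne, ae_restrict_mem measurableSet_Ioc] with t ht htT htm
    have e : HasDerivAt f (ℓ (∑ i, a t i • S.leftInvariantField (X i : 𝔤) (γ t))) t :=
      ℓ.hasFDerivAt.comp_hasDerivAt t ht
    set s := ∑ i, |a t i| ^ 2 with hs
    have hs0 : 0 ≤ s := by positivity
    have n1 : ‖∑ i, a t i • (X i : 𝔤)‖ ^ 2 ≤ s * B := by
      have n2 : ‖∑ i, a t i • (X i : 𝔤)‖ ≤ ∑ i, |a t i| * ‖(X i : 𝔤)‖ :=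
        (norm_sum_le _ _).trans (by simp [norm_smul])
      exact (pow_le_pow_left₀ (norm_nonneg _) n2 2).trans (Finset.sum_mul_sq_le_sq_mul_sq _ _ _)
    have n3 : ‖deriv f t‖ ≤ C * ‖∑ i, a t i • (X i : 𝔤)‖ := by
      rw [e.deriv, ← leftInvariantField_sum]
      refine (ℓ.le_opNorm _).trans ?_
      refine (mul_le_of_le_one_left (norm_nonneg _) hℓ).trans ?_
      exact hC _ (hlt t ⟨htm.1.le, lt_of_le_of_ne htm.2 htT⟩) _
    -- Young's inequality is applied pointwise rather than Cauchy-Schwarz under the integral: the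
    -- controls are not assumed measurable.
    have n4 : ‖deriv f t‖ ≤ 1 / 2 + D / 2 * s := by
      have n5 : (C * ‖∑ i, a t i • (X i : 𝔤)‖) ^ 2 ≤ D * s := by
        rw [mul_pow, hD]
        nlinarith [mul_le_mul_of_nonneg_left n1 (sq_nonneg C)]
      nlinarith [sq_nonneg (C * ‖∑ i, a t i • (X i : 𝔤)‖ - 1)]
    rw [← ofReal_norm, ← ENNReal.ofReal_mul (by positivity),
      ← ENNReal.ofReal_add (by norm_num) (by positivity)]
    exact ENNReal.ofReal_le_ofReal n4
  have hfin : (1 : ℝ≥0∞) < 1 := by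
    calc (1 : ℝ≥0∞) ≤ ‖f T - f 0‖ₑ := by
          rw [← ofReal_norm, ← ENNReal.ofReal_one]
          exact ENNReal.ofReal_le_ofReal (hf1.trans (le_abs_self _))
      _ ≤ ∫⁻ t in Ioc 0 T, ‖deriv f t‖ₑ := by
          rw [← hint, intervalIntegral.integral_of_le hT.1]
          exact enorm_integral_le_lintegral_enorm _
      _ ≤ ∫⁻ t in Ioc 0 T, (ENNReal.ofReal (1 / 2) +
            ENNReal.ofReal (D / 2) * ENNReal.ofReal (∑ i, |a t i| ^ 2)) := lintegral_mono_ae hderiv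
      _ ≤ ∫⁻ t in Icc (0 : ℝ) 1, (ENNReal.ofReal (1 / 2) +
            ENNReal.ofReal (D / 2) * ENNReal.ofReal (∑ i, |a t i| ^ 2)) :=
          lintegral_mono_set (Ioc_subset_Icc_self.trans (Icc_subset_Icc_right hT.2))
      _ = ENNReal.ofReal (1 / 2) + ENNReal.ofReal (D / 2) *
            ∫⁻ t in Icc (0 : ℝ) 1, ENNReal.ofReal (∑ i, |a t i| ^ 2) := by
          rw [lintegral_add_left measurable_const, lintegral_const_mul' _ _ ENNReal.ofReal_ne_top]
          simp
      _ < ENNReal.ofReal (1 / 2) + ENNReal.ofReal (D / 2) * ENNReal.ofReal (1 / D) := by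
          refine ENNReal.add_lt_add_left ENNReal.ofReal_ne_top ?_
          exact ENNReal.mul_lt_mul_right (by simpa using hDpos) ENNReal.ofReal_ne_top ha
      _ = 1 := by
          rw [← ENNReal.ofReal_mul (by positivity), ← ENNReal.ofReal_add (by norm_num) (by positivity)]
          have : 1 / 2 + D / 2 * (1 / D) = 1 := by field_simp; norm_num
          rw [this, ENNReal.ofReal_one]
  exact lt_irrefl _ hfin

end

end Stratification

/-! ### Joining points by horizontal curves -/

namespace Stratification

noncomputable section

variable {𝔤 : Type*} [NormedLieRing 𝔤] [NormedLieAlgebra 𝔤]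
  (S : Stratification 𝔤) {k : ℕ} (X : Module.Basis (Fin k) ℝ (S.V 1))

/-- `x` and `y` are joined by a Lipschitz curve which, off a finite set, is differentiable and
horizontal with controls bounded by `M`. -/
def Joined (M : ℝ) (x y : 𝔤) : Prop :=
  ∃ (γ : ℝ → 𝔤) (a : ℝ → Fin k → ℝ), γ 0 = x ∧ γ 1 = y ∧ (∃ K : ℝ≥0, LipschitzOnWith K γ (Icc 0 1)) ∧
    (∀ t i, |a t i| ≤ M) ∧ ∃ N : Set ℝ, N.Finite ∧ ∀ t ∈ Ioo (0 : ℝ) 1, t ∉ N →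
      HasDerivAt γ (∑ i, a t i • S.leftInvariantField (X i : 𝔤) (γ t)) t

variable {S X}

theorem Joined.mono {M M' : ℝ} (h : M ≤ M') {x y : 𝔤} (hxy : S.Joined X M x y) :
    S.Joined X M' x y := by
  obtain ⟨γ, a, h0, h1, hK, ha, hN⟩ := hxy
  exact ⟨γ, a, h0, h1, hK, fun t i => (ha t i).trans h, hN⟩

theorem Joined.refl {M : ℝ} (hM : 0 ≤ M) (x : 𝔤) : S.Joined X M x x :=
  ⟨fun _ => x, fun _ _ => 0, rfl, rfl, ⟨0, LipschitzOnWith.of_dist_le_mul (by simp)⟩, by simpa using fun _ => hM, ∅,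
    finite_empty, fun t _ _ => by simpa using hasDerivAt_const t x⟩

theorem lipschitzOnWith_Icc_of_glue {E : Type*} [PseudoMetricSpace E] {f : ℝ → E} {a b c : ℝ} {K : ℝ≥0}
    (h1 : LipschitzOnWith K f (Icc a b)) (h2 : LipschitzOnWith K f (Icc b c)) :
    LipschitzOnWith K f (Icc a c) := by
  have key : ∀ s t, s ∈ Icc a c → t ∈ Icc a c → s ≤ t → dist (f s) (f t) ≤ K * dist s t := by
    intro s t hs ht hst
    rcases le_total t b with htb | htb
    · exact h1.dist_le_mul s ⟨hs.1, hst.trans htb⟩ t ⟨ht.1, htb⟩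
    rcases le_total s b with hsb | hsb
    · have e1 := h1.dist_le_mul s ⟨hs.1, hsb⟩ b ⟨hs.1.trans hsb, le_rfl⟩
      have e2 := h2.dist_le_mul b ⟨le_rfl, htb.trans ht.2⟩ t ⟨htb, ht.2⟩
      have e3 : dist s t = dist s b + dist b t := by
        rw [dist_comm s t, dist_comm s b, dist_comm b t, Real.dist_eq, Real.dist_eq, Real.dist_eq,
          abs_of_nonneg (by linarith), abs_of_nonneg (by linarith), abs_of_nonneg (by linarith)]
        ring
      calc dist (f s) (f t) ≤ dist (f s) (f b) + dist (f b) (f t) := dist_triangle _ _ _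
        _ ≤ K * dist s t := by rw [e3, mul_add]; exact add_le_add e1 e2
    · exact h2.dist_le_mul s ⟨hsb, hs.2⟩ t ⟨htb, ht.2⟩
  refine LipschitzOnWith.of_dist_le_mul fun s hs t ht => ?_
  rcases le_total s t with h | h
  · exact key s t hs ht h
  · rw [dist_comm, dist_comm s]; exact key t s ht hs h

/-- Each curve is run at double speed, hence the factor 2 on the controls. -/
theorem Joined.trans {M : ℝ} {x y z : 𝔤} (hxy : S.Joined X M x y) (hyz : S.Joined X M y z) :
    S.Joined X (2 * M) x z := by
  obtain ⟨γ, a, h0, h1, ⟨K, hK⟩, ha, N, hN, hd⟩ := hxy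
  obtain ⟨γ', a', h0', h1', ⟨K', hK'⟩, ha', N', hN', hd'⟩ := hyz
  set γ'' : ℝ → 𝔤 := fun t => if t ≤ 1 / 2 then γ (2 * t) else γ' (2 * t - 1) with hγ
  have hleft : ∀ t ≤ 1 / 2, γ'' t = γ (2 * t) := fun t ht => if_pos ht
  have hright : ∀ t, 1 / 2 ≤ t → γ'' t = γ' (2 * t - 1) := fun t ht => by
    rcases ht.eq_or_lt with rfl | h
    · rw [hleft _ le_rfl]
      norm_num [h1, h0']
    · exact if_neg (not_le.2 h)
  refine ⟨γ'', fun t i => if t ≤ 1 / 2 then 2 * a (2 * t) i else 2 * a' (2 * t - 1) i, ?_, ?_,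
    ⟨max K K' * 2, lipschitzOnWith_Icc_of_glue (b := 1 / 2) ?_ ?_⟩, ?_,
    {1 / 2} ∪ ((fun t => 2 * t) ⁻¹' N ∪ (fun t => 2 * t - 1) ⁻¹' N'), ?_, ?_⟩
  · rw [hleft _ (by norm_num), mul_zero, h0]
  · rw [hright _ (by norm_num)]; norm_num [h1']
  · refine LipschitzOnWith.of_dist_le_mul fun s hs t ht => ?_
    rw [hleft s hs.2, hleft t ht.2]
    refine (hK.dist_le_mul _ ⟨by linarith [hs.1], by linarith [hs.2]⟩ _
      ⟨by linarith [ht.1], by linarith [ht.2]⟩).trans ?_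
    have e : dist (2 * s) (2 * t) = 2 * dist s t := by
      rw [Real.dist_eq, Real.dist_eq, ← mul_sub, abs_mul, abs_two]
    rw [e, ← mul_assoc]
    push_cast
    gcongr
    exact le_max_left _ _
  · refine LipschitzOnWith.of_dist_le_mul fun s hs t ht => ?_
    rw [hright s hs.1, hright t ht.1]
    refine (hK'.dist_le_mul _ ⟨by linarith [hs.1], by linarith [hs.2]⟩ _
      ⟨by linarith [ht.1], by linarith [ht.2]⟩).trans ?_
    have e : dist (2 * s - 1) (2 * t - 1) = 2 * dist s t := by
      rw [Real.dist_eq, Real.dist_eq, sub_sub_sub_cancel_right, ← mul_sub, abs_mul, abs_two]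
    rw [e, ← mul_assoc]
    push_cast
    gcongr
    exact le_max_right _ _
  · intro t i
    simp only
    split_ifs
    · rw [abs_mul, abs_two]; linarith [ha (2 * t) i]
    · rw [abs_mul, abs_two]; linarith [ha' (2 * t - 1) i]
  · refine (finite_singleton _).union ((hN.preimage ?_).union (hN'.preimage ?_))
    · exact (mul_right_injective₀ (two_ne_zero' ℝ)).injOn
    · exact fun s _ t _ h => by simpa using h
  · intro t ht htN
    simp only [mem_union, mem_singleton_iff, mem_preimage, not_or] at htN
    obtain ⟨hne, hn, hn'⟩ := htN
    rcases lt_or_gt_of_ne hne with hlt | hlt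
    · have e := (hd (2 * t) ⟨by linarith [ht.1], by linarith⟩ hn).scomp t
        ((hasDerivAt_id t).const_mul 2)
      refine (e.congr_deriv ?_).congr_of_eventuallyEq ?_
      · rw [hleft t hlt.le]
        simp only [if_pos hlt.le, mul_one, Finset.smul_sum, smul_smul]
      · filter_upwards [gt_mem_nhds hlt] with s hs using hleft s hs.le
    · have e := (hd' (2 * t - 1) ⟨by linarith, by linarith [ht.2]⟩ hn').scomp t
        (((hasDerivAt_id t).const_mul 2).sub_const 1)
      refine (e.congr_deriv ?_).congr_of_eventuallyEq ?_
      · rw [hright t hlt.le]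
        simp only [if_neg (not_le.2 hlt), mul_one, Finset.smul_sum, smul_smul]
      · filter_upwards [lt_mem_nhds hlt] with s hs using hright s hs.le

theorem Joined.ccDist_lt {M : ℝ} (hM : 0 < M) {x y : 𝔤} (h : S.Joined X M x y) :
    S.ccDist X x y < ENNReal.ofReal ((k + 1) * M) := by
  obtain ⟨γ, a, h0, h1, hK, ha, N, hN, hd⟩ := h
  refine (S.ccDist_lt_iff X x y (by positivity)).2 ⟨γ, a, ⟨h0, h1, hK, ?_⟩, ?_⟩
  · rw [← restrict_Ioo_eq_restrict_Icc]
    have : ∀ᵐ t ∂(volume.restrict (Ioo (0 : ℝ) 1)), t ∉ N :=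
      ae_restrict_of_ae (measure_eq_zero_iff_ae_notMem.1 (hN.measure_zero volume))
    filter_upwards [this, ae_restrict_mem measurableSet_Ioo] with t ht htm using hd t htm ht
  · calc ∫⁻ t in Icc (0 : ℝ) 1, ENNReal.ofReal (∑ i, |a t i| ^ 2)
        ≤ ∫⁻ _ in Icc (0 : ℝ) 1, ENNReal.ofReal (k * M ^ 2) := by
          refine lintegral_mono fun t => ENNReal.ofReal_le_ofReal ?_
          calc ∑ i, |a t i| ^ 2 ≤ ∑ _i : Fin k, M ^ 2 :=
                Finset.sum_le_sum fun i _ => pow_le_pow_left₀ (abs_nonneg _) (ha t i) 2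
            _ = k * M ^ 2 := by simp
      _ = ENNReal.ofReal (k * M ^ 2) := by simp
      _ < ENNReal.ofReal (((k + 1) * M) ^ 2) := by
          rw [ENNReal.ofReal_lt_ofReal_iff (by positivity), mul_pow]
          refine mul_lt_mul_of_pos_right ?_ (by positivity)
          have : (0 : ℝ) ≤ k := by positivity
          nlinarith

variable [FiniteDimensional ℝ 𝔤] (S X)

theorem joined_mul {v : 𝔤} (hv : v ∈ S.V 1) {M : ℝ} (hM : ∀ i, |X.repr ⟨v, hv⟩ i| ≤ M) (x : 𝔤) :
    S.Joined X M x (S.mul x v) := by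
  have hs : ∑ i, X.repr ⟨v, hv⟩ i • (X i : 𝔤) = v := by
    have := congrArg (S.V 1).subtype (X.sum_repr ⟨v, hv⟩)
    rw [map_sum] at this
    simpa only [map_smul, Submodule.subtype_apply] using this
  refine ⟨fun t => S.mul x (t • v), fun _ i => X.repr ⟨v, hv⟩ i, by simp [mul_zero'], by simp, ?_,
    fun _ i => hM i, ∅, finite_empty, fun t _ _ => ?_⟩
  · exact (((S.contDiff_mul_left x).comp (contDiff_id.smul contDiff_const)).contDiffOn
      (s := Icc (0 : ℝ) 1)).exists_lipschitzOnWith one_ne_zero (convex_Icc 0 1) isCompact_Icc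
  · refine (S.hasDerivAt_mul_smul x v t).congr_deriv ?_
    rw [← leftInvariantField_sum, hs]

theorem exists_joined_of_mem_wordSet (R : ℝ) (n : ℕ) :
    ∃ M, 0 < M ∧ ∀ y ∈ S.wordSet R n, S.Joined X M 0 y := by
  induction n with
  | zero => exact ⟨1, one_pos, fun y hy => by obtain rfl : y = 0 := hy; exact Joined.refl zero_le_one _⟩
  | succ n ih =>
    obtain ⟨M, hM, h⟩ := ih
    have hc : ∀ i, Continuous fun v : S.V 1 => X.repr v i := fun i =>
      (X.coord i).continuous_of_finiteDimensional
    have hb : ∃ M', ∀ v : S.V 1, ‖v‖ ≤ R → ∀ i, |X.repr v i| ≤ M' := by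
      choose M' hM' using fun i => (isCompact_closedBall (0 : S.V 1) R).exists_bound_of_continuousOn
        (hc i).continuousOn
      refine ⟨∑ i, |M' i|, fun v hv i => ?_⟩
      refine ((hM' i v (by simpa using hv)).trans (le_abs_self _)).trans ?_
      exact Finset.single_le_sum (f := fun i => |M' i|) (fun _ _ => abs_nonneg _) (Finset.mem_univ i)
    obtain ⟨M', hM'⟩ := hb
    refine ⟨2 * max M M', by positivity, ?_⟩
    rintro _ ⟨⟨g, v⟩, ⟨hg, hv⟩, rfl⟩
    refine ((h g hg).mono (le_max_left _ _)).trans (S.joined_mul X hv.1 (fun i => ?_) g)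
    exact (hM' ⟨v, hv.1⟩ (by simpa using hv.2) i).trans (le_max_right _ _)

theorem exists_ccBall_mem_nhds : ∃ D : ℝ, 0 < D ∧ S.ccBall X 0 D ∈ 𝓝 (0 : 𝔤) := by
  obtain ⟨R, n, h⟩ := S.exists_wordSet_mem_nhds
  obtain ⟨M, hM, hJ⟩ := S.exists_joined_of_mem_wordSet X R n
  exact ⟨(k + 1) * M, by positivity, mem_of_superset h fun y hy => (hJ y hy).ccDist_lt hM⟩

end

end Stratification

/-! ### Homogeneous balls -/

namespace Stratification

noncomputable section

variable {𝔤 : Type*} [NormedLieRing 𝔤] [NormedLieAlgebra 𝔤] (S : Stratification 𝔤)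

/-- The sum of the norms of the components in the layers. -/
def layerNorm (x : 𝔤) : ℝ := ∑ j ∈ Finset.range (S.step + 1), ‖S.proj j x‖

/-- The left translate to `x` of the dilation by `r` of the unit ball of `layerNorm`. -/
def gball (x : 𝔤) (r : ℝ) : Set 𝔤 := {y | S.layerNorm (S.blowUp x r y) < 1}

variable {S} in
theorem mem_gball {x y : 𝔤} {r : ℝ} : y ∈ S.gball x r ↔ S.layerNorm (S.blowUp x r y) < 1 := Iff.rfl

theorem layerNorm_nonneg (x : 𝔤) : 0 ≤ S.layerNorm x := Finset.sum_nonneg fun _ _ => norm_nonneg _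

theorem layerNorm_zero : S.layerNorm 0 = 0 := by simp [layerNorm]

theorem layerNorm_neg (x : 𝔤) : S.layerNorm (-x) = S.layerNorm x := by simp [layerNorm]

theorem norm_le_layerNorm (x : 𝔤) : ‖x‖ ≤ S.layerNorm x := by
  conv_lhs => rw [← S.sum_proj x]
  exact norm_sum_le _ _

/-- All layers have degree at least 1, and c^j ≤ c for c ≤ 1. -/
theorem layerNorm_dil_le {c : ℝ} (hc : 0 ≤ c) (hc1 : c ≤ 1) (x : 𝔤) :
    S.layerNorm (S.dil c x) ≤ c * S.layerNorm x := by
  unfold layerNorm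
  rw [Finset.mul_sum]
  refine Finset.sum_le_sum fun j _ => ?_
  rw [proj_dil]
  rcases j with _ | j
  · simp [proj_zero_apply]
  · rw [norm_smul, norm_pow, Real.norm_of_nonneg hc]
    gcongr
    rw [pow_succ]
    exact mul_le_of_le_one_left hc (pow_le_one₀ hc hc1)

variable [FiniteDimensional ℝ 𝔤]

theorem continuous_layerNorm : Continuous S.layerNorm :=
  continuous_finsetSum _ fun j _ => (S.proj j).continuous_of_finiteDimensional.norm

theorem mul_dil_blowUp (x : 𝔤) {r : ℝ} (hr : r ≠ 0) (y : 𝔤) :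
    S.mul x (S.dil r (S.blowUp x r y)) = y := by
  rw [blowUp, dil_dil, mul_one_div_cancel hr, dil_one, mul_neg_cancel_left']

theorem blowUp_mul_dil (x : 𝔤) {r : ℝ} (hr : r ≠ 0) (z : 𝔤) :
    S.blowUp x r (S.mul x (S.dil r z)) = z := by
  rw [blowUp, neg_mul_cancel_left', dil_dil, one_div_mul_cancel hr, dil_one]

theorem blowUp_blowUp (x y z : 𝔤) {r s : ℝ} (hr : r ≠ 0) :
    S.blowUp y s (S.blowUp x r z) = S.blowUp (S.mul x (S.dil r y)) (r * s) z := by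
  have h : -y = S.dil (1 / r) (-S.dil r y) := by
    rw [dil_neg, dil_dil, one_div_mul_cancel hr, dil_one]
  rw [blowUp, blowUp, blowUp, neg_mul_rev', mul_assoc', h, ← dil_mul, dil_dil]
  congr 1
  rw [one_div_mul_one_div, mul_comm]

theorem continuous_blowUp_uncurry (r : ℝ) : Continuous fun p : 𝔤 × 𝔤 => S.blowUp p.1 r p.2 :=
  (S.continuous_dil _).comp
    (S.continuous_mul'.comp ((continuous_fst.neg).prodMk continuous_snd))

theorem continuous_blowUp (x : 𝔤) (r : ℝ) : Continuous (S.blowUp x r) :=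
  (S.continuous_dil _).comp (S.continuous_mul_left' _)

/-- The blow-up map as a homeomorphism. -/
def blowUpHomeomorph (x : 𝔤) {r : ℝ} (hr : r ≠ 0) : 𝔤 ≃ₜ 𝔤 where
  toFun := S.blowUp x r
  invFun z := S.mul x (S.dil r z)
  left_inv := S.mul_dil_blowUp x hr
  right_inv := S.blowUp_mul_dil x hr
  continuous_toFun := S.continuous_blowUp x r
  continuous_invFun := (S.continuous_mul_left' x).comp (S.continuous_dil r)

theorem isOpen_gball (x : 𝔤) (r : ℝ) : IsOpen (S.gball x r) :=
  isOpen_lt (S.continuous_layerNorm.comp (S.continuous_blowUp x r)) continuous_const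

theorem blowUp_self (x : 𝔤) (r : ℝ) : S.blowUp x r x = 0 := by
  rw [blowUp, neg_mul_self, dil_zero]

theorem mem_gball_self (x : 𝔤) (r : ℝ) : x ∈ S.gball x r := by
  simp [gball, blowUp_self, layerNorm_zero]

theorem mem_gball_comm {x y : 𝔤} {r : ℝ} : y ∈ S.gball x r ↔ x ∈ S.gball y r := by
  have : S.blowUp x r y = -S.blowUp y r x := by
    rw [blowUp, blowUp, ← dil_neg, neg_mul_rev', neg_neg]
  rw [mem_gball, mem_gball, this, layerNorm_neg]

omit [FiniteDimensional ℝ 𝔤] in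
theorem blowUp_mul_right {x : 𝔤} {r s : ℝ} (hr : 0 < r) (y : 𝔤) :
    S.blowUp x s y = S.dil (r / s) (S.blowUp x r y) := by
  rw [blowUp, blowUp, dil_dil]
  congr 1
  field_simp

omit [FiniteDimensional ℝ 𝔤] in
theorem gball_mono (x : 𝔤) {r s : ℝ} (hr : 0 < r) (hrs : r ≤ s) : S.gball x r ⊆ S.gball x s := by
  intro y hy
  have hs : 0 < s := hr.trans_le hrs
  rw [mem_gball, S.blowUp_mul_right hr]
  have h1 : r / s ≤ 1 := (div_le_one hs).2 hrs
  refine (S.layerNorm_dil_le (by positivity) h1 _).trans_lt ?_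
  exact (mul_le_of_le_one_left (S.layerNorm_nonneg _) h1).trans_lt hy

theorem mem_gball_iff_blowUp (x y : 𝔤) {r : ℝ} (hr : 0 < r) (t : ℝ) :
    y ∈ S.gball x (r * t) ↔ S.blowUp x r y ∈ S.gball 0 t := by
  rw [mem_gball, mem_gball, S.blowUp_blowUp x 0 y hr.ne', dil_zero, mul_zero']

theorem isCompact_setOf_layerNorm_le (R : ℝ) : IsCompact {z | S.layerNorm z ≤ R} := by
  refine (isCompact_closedBall (0 : 𝔤) R).of_isClosed_subset
    (isClosed_le S.continuous_layerNorm continuous_const) fun z hz => ?_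
  rw [mem_closedBall_zero_iff]
  exact (S.norm_le_layerNorm z).trans hz

/-- The quasi-triangle inequality. -/
theorem exists_gball_trans : ∃ K : ℝ, 1 ≤ K ∧ ∀ (r : ℝ) (x y z : 𝔤), 0 < r → y ∈ S.gball x r →
    z ∈ S.gball y r → z ∈ S.gball x (K * r) := by
  obtain ⟨C, hC⟩ := ((S.isCompact_setOf_layerNorm_le 1).prod
    (S.isCompact_setOf_layerNorm_le 1)).exists_bound_of_continuousOn
    (S.continuous_layerNorm.comp S.continuous_mul').continuousOn
  have hC0 : 0 ≤ C := (norm_nonneg _).trans (hC (0, 0) ⟨by simp [layerNorm_zero], by simp [layerNorm_zero]⟩)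
  refine ⟨C + 1, by linarith, fun r x y z hr hy hz => ?_⟩
  have hK : (0 : ℝ) < C + 1 := by linarith
  have h1 : S.blowUp x r z = S.mul (S.blowUp x r y) (S.blowUp y r z) := by
    rw [blowUp, blowUp, blowUp, ← dil_mul, mul_assoc', mul_neg_cancel_left']
  have h2 := hC (S.blowUp x r y, S.blowUp y r z) ⟨(mem_gball.1 hy).le, (mem_gball.1 hz).le⟩
  rw [mem_gball, S.blowUp_mul_right hr, h1]
  have e : r / ((C + 1) * r) = 1 / (C + 1) := by field_simp
  rw [e]
  refine (S.layerNorm_dil_le (by positivity) ((div_le_one hK).2 (by linarith)) _).trans_lt ?_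
  rw [Function.comp_apply, Real.norm_of_nonneg (S.layerNorm_nonneg _)] at h2
  rw [one_div_mul_eq_div, div_lt_one hK]
  exact h2.trans_lt (lt_add_one C)

theorem exists_gball_subset {x : 𝔤} {O : Set 𝔤} (hO : O ∈ 𝓝 x) : ∃ ε : ℝ, 0 < ε ∧ S.gball x ε ⊆ O := by
  have h0 : {z | S.mul x z ∈ O} ∈ 𝓝 (0 : 𝔤) :=
    (S.continuous_mul_left' x).continuousAt.preimage_mem_nhds (by rwa [mul_zero'])
  obtain ⟨ε, hε, h⟩ := Metric.mem_nhds_iff.1 h0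
  refine ⟨min ε 1, by positivity, fun y hy => ?_⟩
  have hm : 0 < min ε 1 := by positivity
  have h1 : S.dil (min ε 1) (S.blowUp x (min ε 1) y) ∈ Metric.ball (0 : 𝔤) ε := by
    rw [mem_ball_zero_iff]
    refine (S.norm_le_layerNorm _).trans_lt ?_
    refine (S.layerNorm_dil_le hm.le (min_le_right _ _) _).trans_lt ?_
    exact (mul_lt_of_lt_one_right hm hy).trans_le (min_le_left _ _)
  have := h h1
  rwa [mem_ofPred_eq, S.mul_dil_blowUp x hm.ne'] at this

theorem isCompact_closure_gball (x : 𝔤) {r : ℝ} (hr : 0 < r) : IsCompact (closure (S.gball x r)) := by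
  have h : IsCompact (S.blowUpHomeomorph x hr.ne' ⁻¹' {z | S.layerNorm z ≤ 1}) :=
    (S.blowUpHomeomorph x hr.ne').isCompact_preimage.2 (S.isCompact_setOf_layerNorm_le 1)
  exact h.of_isClosed_subset isClosed_closure (closure_minimal (fun y hy => (mem_gball.1 hy).le) h.isClosed)

theorem exists_subset_gball {C : Set 𝔤} (hC : IsCompact C) : ∃ R : ℝ, 1 ≤ R ∧ C ⊆ S.gball 0 R := by
  obtain ⟨R, hR⟩ := hC.exists_bound_of_continuousOn S.continuous_layerNorm.continuousOn
  refine ⟨|R| + 1, by simp, fun y hy => ?_⟩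
  have hR' : 0 < |R| + 1 := by positivity
  rw [mem_gball, blowUp, neg_zero, zero_mul']
  refine (S.layerNorm_dil_le (by positivity) ((div_le_one hR').2 (by simp)) _).trans_lt ?_
  have := hR y hy
  rw [Real.norm_of_nonneg (S.layerNorm_nonneg _)] at this
  rw [one_div_mul_eq_div, div_lt_one hR']
  exact this.trans_lt ((le_abs_self R).trans_lt (lt_add_one _))

/-- Homogeneous balls and Carnot-Carathéodory balls are comparable. -/
theorem exists_ccBall_comparison {k : ℕ} (X : Module.Basis (Fin k) ℝ (S.V 1)) :
    ∃ M : ℝ, 0 < M ∧ ∀ (x : 𝔤) (r : ℝ), 0 < r →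
      S.gball x r ⊆ S.ccBall X x (M * r) ∧ S.ccBall X x r ⊆ S.gball x (M * r) := by
  obtain ⟨D, hD, hDn⟩ := S.exists_ccBall_mem_nhds X
  obtain ⟨ε, hε, hεs⟩ := S.exists_gball_subset hDn
  obtain ⟨δ, hδ, hδs⟩ := S.exists_ccBall_subset_ball X
  obtain ⟨R, hR, hRs⟩ := S.exists_subset_gball (isCompact_closedBall (0 : 𝔤) 1)
  have key : ∀ (x y : 𝔤) (c : ℝ), 0 < c → ∀ t, 0 < t → (y ∈ S.ccBall X x t →
      S.blowUp x c y ∈ S.ccBall X 0 (1 / c * t)) := by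
    intro x y c hc t ht hy
    have := S.mem_ccBall_transport X ht hy (S.dil (1 / c) (-x)) (inv_pos.2 hc)
    rwa [inv_eq_one_div, ← dil_mul, ← dil_mul, neg_mul_self, dil_zero] at this
  have hM : 0 < max (D / ε) (R / δ) := lt_max_of_lt_left (by positivity)
  refine ⟨max (D / ε) (R / δ), hM, fun x r hr => ⟨fun y hy => ?_, fun y hy => ?_⟩⟩
  -- Translation and dilation by c reduce the inclusion to radius ε at the identity, where it is
  -- known.
  · set c := r / ε with hcdef
    have hc : 0 < c := by positivity
    have e : r = c * ε := by rw [hcdef]; field_simp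
    rw [e, S.mem_gball_iff_blowUp x y hc] at hy
    have := S.mem_ccBall_transport X hD (hεs hy) x hc
    rw [dil_zero, mul_zero', S.mul_dil_blowUp x hc.ne'] at this
    refine lt_of_lt_of_le this (ENNReal.ofReal_le_ofReal ?_)
    calc c * D = D / ε * r := by rw [hcdef]; ring
      _ ≤ _ := by gcongr; exact le_max_left _ _
  · set c := r / δ with hcdef
    have hc : 0 < c := by positivity
    have h1 := key x y c hc r hr hy
    have e : 1 / c * r = δ := by rw [hcdef]; field_simp
    rw [e] at h1
    have h2 := hRs (Metric.ball_subset_closedBall (hδs h1))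
    rw [← S.mem_gball_iff_blowUp x y hc] at h2
    refine S.gball_mono x (by positivity) ?_ h2
    calc c * R = R / δ * r := by rw [hcdef]; ring
      _ ≤ _ := by gcongr; exact le_max_right _ _

end

end Stratification

/-! ### Vector-valued Radon measures: total variation and integrals -/

/-- In a basis the variation is bounded by the weighted sum of the total variations of the
coordinates, which are finite signed measures. -/
theorem MeasureTheory.VectorMeasure.isFiniteMeasure_variation {Ω F : Type*} [MeasurableSpace Ω]
    [NormedAddCommGroup F] [NormedSpace ℝ F] [FiniteDimensional ℝ F] (v : VectorMeasure Ω F) :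
    IsFiniteMeasure v.variation := by
  classical
  set b := Module.finBasis ℝ F
  set c : Fin (Module.finrank ℝ F) → SignedMeasure Ω := fun i =>
    v.mapRange (b.coord i).toAddMonoidHom (b.coord i).continuous_of_finiteDimensional
  have hle : v.variation ≤ ∑ i, ‖b i‖₊ • (c i).totalVariation := by
    refine VectorMeasure.variation_le_of_forall_enorm_le fun E hE => ?_
    calc ‖v E‖ₑ = ‖∑ i, b.coord i (v E) • b i‖ₑ := by
          congr 1
          exact (b.sum_repr (v E)).symm
      _ ≤ ∑ i, ‖b.coord i (v E) • b i‖ₑ := enorm_sum_le _ _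
      _ ≤ ∑ i, ‖b i‖ₑ * (c i).totalVariation E := by
          refine Finset.sum_le_sum fun i _ => ?_
          rw [enorm_smul, mul_comm]
          gcongr
          exact SignedMeasure.enorm_le_totalVariation (c i) E
      _ = (∑ i, ‖b i‖₊ • (c i).totalVariation) E := by
          simp only [Measure.finsetSum_apply, Measure.smul_apply, ENNReal.smul_def, smul_eq_mul]
          rfl
  have : IsFiniteMeasure (∑ i, ‖b i‖₊ • (c i).totalVariation) := inferInstance
  exact isFiniteMeasure_of_le _ hle

theorem IsBddBorel.mono {G : Type*} [TopologicalSpace G] [MeasurableSpace G] {A B : Set G}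
    (hB : IsBddBorel B) (hA : MeasurableSet A) (h : A ⊆ B) : IsBddBorel A :=
  ⟨hA, hB.2.of_isClosed_subset isClosed_closure (closure_mono h)⟩

theorem IsCompact.isBddBorel {G : Type*} [TopologicalSpace G] [T2Space G] [MeasurableSpace G]
    [OpensMeasurableSpace G] {K : Set G} (hK : IsCompact K) : IsBddBorel K :=
  ⟨hK.isClosed.measurableSet, by rwa [hK.isClosed.closure_eq]⟩

namespace VectorRadonMeasure

section Variation

variable {G : Type*} [TopologicalSpace G] [MeasurableSpace G]
  {F : Type*} [NormedAddCommGroup F] (μ : VectorRadonMeasure G F)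

theorem restrict_apply {K : Set G} (hK : IsBddBorel K) {A : Set G} (hA : MeasurableSet A) :
    μ.restrict K hK A = μ.toFun (A ∩ K) := if_pos hA

theorem restrict_restrict {K L : Set G} (hK : IsBddBorel K) (hL : IsBddBorel L) (h : L ⊆ K) :
    (μ.restrict K hK).restrict L = μ.restrict L hL := by
  ext A hA
  rw [VectorMeasure.restrict_apply _ hL.1 hA, restrict_apply _ _ (hA.inter hL.1), restrict_apply _ _ hA,
    inter_assoc, inter_eq_self_of_subset_left h]

theorem variation_restrict_le {K : Set G} (hK : IsBddBorel K) :
    (μ.restrict K hK).variation ≤ μ.variation := by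
  refine le_sInf fun σ hσ => VectorMeasure.variation_le_of_forall_enorm_le fun E hE => ?_
  rw [restrict_apply _ _ hE]
  exact (hσ _ (hK.mono (hE.inter hK.1) inter_subset_right)).trans (measure_mono inter_subset_left)

theorem variation_le_of_forall_enorm_le {σ : Measure G} (h : ∀ B, IsBddBorel B → ‖μ.toFun B‖ₑ ≤ σ B) :
    μ.variation ≤ σ := sInf_le h

/-- The infimum is tested with the variation of the restriction to K plus an infinite mass at every
point outside K: sets not contained in K then impose no condition. -/
theorem variation_apply_le {K : Set G} (hK : IsBddBorel K) [MeasurableSingletonClass G] :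
    μ.variation K ≤ (μ.restrict K hK).variation K := by
  have : μ.variation ≤ (μ.restrict K hK).variation + (∞ : ℝ≥0∞) • Measure.count.restrict Kᶜ := by
    refine μ.variation_le_of_forall_enorm_le fun B hB => ?_
    by_cases hBK : B ⊆ K
    · have h := VectorMeasure.enorm_measure_le_variation (μ.restrict K hK) B
      rw [restrict_apply _ _ hB.1, inter_eq_self_of_subset_left hBK] at h
      exact h.trans (by simp)
    · obtain ⟨x, hxB, hxK⟩ := not_subset.1 hBK
      have h1 : Measure.count.restrict Kᶜ B ≠ 0 := by
        rw [Measure.restrict_apply hB.1]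
        exact Measure.count_ne_zero ⟨x, hxB, hxK⟩
      simp [ENNReal.top_mul h1]
  refine (this K).trans ?_
  simp [Measure.restrict_apply hK.1]

theorem variation_lt_top [MeasurableSingletonClass G] [NormedSpace ℝ F] [FiniteDimensional ℝ F]
    {K : Set G} (hK : IsBddBorel K) : μ.variation K < ∞ := by
  have := (μ.restrict K hK).isFiniteMeasure_variation
  exact (μ.variation_apply_le hK).trans_lt (measure_lt_top _ _)

end Variation

section Integral

variable {G : Type*} [TopologicalSpace G] [T2Space G] [MeasurableSpace G] [BorelSpace G]
  {F : Type*} [NormedAddCommGroup F] [NormedSpace ℝ F] (μ : VectorRadonMeasure G F)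

/-- `integral` restricts to the support of u itself. To compare several test functions, a common
bounded set is needed. -/
theorem integral_eq_restrict (u : CompactlySupportedContinuousMap G ℝ) {K : Set G} (hK : IsBddBorel K)
    (h : tsupport u ⊆ K) :
    μ.integral u = (μ.restrict K hK).integral u (ContinuousLinearMap.lsmul ℝ ℝ) := by
  have hu : IsBddBorel (tsupport u) := u.hasCompactSupport.isBddBorel
  rw [integral, ← μ.restrict_restrict hK hu h]
  exact VectorMeasure.setIntegral_eq_integral_of_forall_compl_eq_zero hu.1
    fun x hx => image_eq_zero_of_notMem_tsupport hx

omit [TopologicalSpace G] [T2Space G] [BorelSpace G] in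
theorem enorm_vectorMeasure_integral_le (v : VectorMeasure G F) (f : G → ℝ) :
    ‖v.integral f (ContinuousLinearMap.lsmul ℝ ℝ)‖ₑ ≤ ∫⁻ x, ‖f x‖ₑ ∂v.variation := by
  refine (VectorMeasure.enorm_integral_le_lintegral_enorm (B := ContinuousLinearMap.lsmul ℝ ℝ)).trans ?_
  refine mul_le_of_le_one_left zero_le ?_
  rw [← ofReal_norm, ENNReal.ofReal_le_one]
  exact ContinuousLinearMap.opNorm_lsmul_le

omit [T2Space G] in
theorem enorm_integral_le (u : CompactlySupportedContinuousMap G ℝ) :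
    ‖μ.integral u‖ₑ ≤ ∫⁻ x, ‖u x‖ₑ ∂μ.variation :=
  (enorm_vectorMeasure_integral_le _ _).trans
    (lintegral_mono' (μ.variation_restrict_le _) le_rfl)

variable [FiniteDimensional ℝ F]

omit [T2Space G] in
theorem integrable_restrict (u : CompactlySupportedContinuousMap G ℝ) {K : Set G} (hK : IsBddBorel K) :
    (μ.restrict K hK).Integrable u := by
  have := (μ.restrict K hK).isFiniteMeasure_variation
  obtain ⟨C, hC⟩ := u.hasCompactSupport.exists_bound_of_continuous u.continuous
  exact Integrable.of_bound u.continuous.measurable.aestronglyMeasurable C (Eventually.of_forall hC)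

theorem integral_sub (u w : CompactlySupportedContinuousMap G ℝ) :
    μ.integral (u - w) = μ.integral u - μ.integral w := by
  have hK : IsBddBorel (tsupport u ∪ tsupport w) :=
    (u.hasCompactSupport.union w.hasCompactSupport).isBddBorel
  rw [μ.integral_eq_restrict u hK subset_union_left, μ.integral_eq_restrict w hK subset_union_right,
    μ.integral_eq_restrict (u - w) hK (tsupport_sub _ _),
    ← VectorMeasure.integral_fun_sub (μ.integrable_restrict u hK) (μ.integrable_restrict w hK)]
  rfl

theorem enorm_integral_sub_le (u w : CompactlySupportedContinuousMap G ℝ) {A : Set G} {ε : ℝ≥0∞}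
    (hA : MeasurableSet A) (h : ∀ x ∈ A, ‖u x - w x‖ₑ ≤ ε) (h0 : ∀ x, x ∉ A → u x = 0 ∧ w x = 0) :
    ‖μ.integral u - μ.integral w‖ₑ ≤ ε * μ.variation A := by
  rw [← integral_sub]
  refine (μ.enorm_integral_le _).trans ?_
  calc ∫⁻ x, ‖(u - w) x‖ₑ ∂μ.variation ≤ ∫⁻ x, A.indicator (fun _ => ε) x ∂μ.variation := by
        refine lintegral_mono fun x => ?_
        by_cases hx : x ∈ A
        · simpa [hx] using h x hx
        · simp [hx, h0 x hx]
    _ = ε * μ.variation A := by rw [lintegral_indicator_const hA]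

theorem isLocallyFiniteMeasure_variation [LocallyCompactSpace G] : IsLocallyFiniteMeasure μ.variation :=
  ⟨fun x => by
    obtain ⟨K, hK, hKx⟩ := exists_compact_mem_nhds x
    exact ⟨K, hKx, μ.variation_lt_top hK.isBddBorel⟩⟩

omit [FiniteDimensional ℝ F] in
theorem integral_smul_measure (c : ℝ) (u : CompactlySupportedContinuousMap G ℝ) :
    (c • μ).integral u = c • μ.integral u := by
  have hu : IsBddBorel (tsupport u) := u.hasCompactSupport.isBddBorel
  have : (c • μ).restrict _ hu = c • μ.restrict _ hu := by
    ext A hA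
    rw [_root_.smul_apply, restrict_apply _ _ hA, restrict_apply _ _ hA]
    rfl
  rw [integral, this, VectorMeasure.integral_smul_vectorMeasure]
  rfl

omit [FiniteDimensional ℝ F] in
theorem integral_map (f : G ≃ₜ G) (u : CompactlySupportedContinuousMap G ℝ) :
    (map f μ).integral u = μ.integral (u.comp f.toCocompactMap) := by
  have hf : Measurable f ∧ ∀ B, IsBddBorel B → IsBddBorel (f ⁻¹' B) :=
    ⟨f.measurable, fun B hB => ⟨f.measurable hB.1, by
      rw [← f.preimage_closure]
      exact f.isCompact_preimage.2 hB.2⟩⟩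
  have hu : IsBddBorel (tsupport u) := u.hasCompactSupport.isBddBorel
  have hfu := hf.2 _ hu
  rw [μ.integral_eq_restrict (u.comp f.toCocompactMap) hfu
    (closure_minimal (fun x hx => subset_tsupport u hx) ((isClosed_tsupport u).preimage f.continuous))]
  have h1 : (map f μ).restrict _ hu = (μ.restrict _ hfu).map f := by
    ext A hA
    rw [restrict_apply _ _ hA, VectorMeasure.map_apply _ hf.1 hA, restrict_apply _ _ (hf.1 hA), map, dif_pos hf]
    exact if_pos (hu.mono (hA.inter hu.1) inter_subset_right)
  rw [integral, h1]
  exact f.measurableEmbedding.integral_map_vectorMeasure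

/-- Positive variation on O yields a Borel set B inside a compact part of O with μ(B) ≠ 0. A Urysohn
function between a compact C ⊆ B and an open V ⊇ B has integral within |μ|(V \ C) of μ(B). -/
theorem exists_integral_ne_zero [LocallyCompactSpace G] [SecondCountableTopology G]
    [TopologicalSpace.PseudoMetrizableSpace G] {O : Set G} (hO : IsOpen O) (h : μ.variation O ≠ 0) :
    ∃ u : CompactlySupportedContinuousMap G ℝ, tsupport u ⊆ O ∧ μ.integral u ≠ 0 := by
  have hlf : IsLocallyFiniteMeasure μ.variation := μ.isLocallyFiniteMeasure_variation
  by_contra! hcon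
  obtain ⟨K, hKO, hK, hK0⟩ : ∃ K ⊆ O, IsCompact K ∧ μ.variation K ≠ 0 := by
    by_contra! hc
    rw [hO.measure_eq_iSup_isCompact] at h
    exact h (by simpa using hc)
  obtain ⟨B, hBK, hB, hB0⟩ : ∃ B ⊆ K, MeasurableSet B ∧ μ.toFun B ≠ 0 := by
    by_contra! hc
    refine hK0 (le_antisymm ((μ.variation_apply_le hK.isBddBorel).trans_eq ?_) zero_le)
    refine (VectorMeasure.variation_apply_eq_zero hK.isBddBorel.1).2 fun t ht htm => ?_
    rw [restrict_apply _ _ htm, inter_eq_self_of_subset_left ht]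
    exact hc t ht htm
  have hBb : IsBddBorel B := hK.isBddBorel.mono hB hBK
  have hBfin : μ.variation B ≠ ∞ := (μ.variation_lt_top hBb).ne
  -- Inner and outer approximation each cost ε, so |μ|(V \ C) < ‖μ(B)‖.
  set ε : ℝ≥0∞ := ‖μ.toFun B‖ₑ / 2 with hε
  have hε0 : ε ≠ 0 := by simpa [hε] using hB0
  have hεtop : ε ≠ ∞ := ENNReal.div_ne_top enorm_ne_top two_ne_zero
  obtain ⟨C, hCB, hC, hCm⟩ := hB.exists_isCompact_lt_add hBfin hε0
  obtain ⟨V, hBV, hV, hVm⟩ := B.exists_isOpen_lt_add hBfin hε0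
  obtain ⟨f, hf1, hfc, hfV, hf01⟩ := exists_continuousMap_one_of_isCompact_subset_isOpen hC
    (hV.inter hO) fun x hx => ⟨hBV (hCB hx), hKO (hBK (hCB hx))⟩
  set u : CompactlySupportedContinuousMap G ℝ := ⟨f, hfc⟩
  have hL : IsBddBorel (K ∪ tsupport f) := (hK.union hfc).isBddBorel
  set v := μ.restrict _ hL with hv
  have hfin : IsFiniteMeasure v.variation := v.isFiniteMeasure_variation
  have hu0 : v.integral u (ContinuousLinearMap.lsmul ℝ ℝ) = 0 := by
    rw [hv, ← μ.integral_eq_restrict u hL subset_union_right]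
    exact hcon u (hfV.trans inter_subset_right)
  have hvB : v.integral (B.indicator fun _ => (1 : ℝ)) (ContinuousLinearMap.lsmul ℝ ℝ) = μ.toFun B := by
    rw [VectorMeasure.integral_indicator_const _ hB, ContinuousLinearMap.lsmul_apply, one_smul, hv,
      restrict_apply _ _ hB, inter_eq_self_of_subset_left (hBK.trans subset_union_left)]
  have hsub : v.integral (fun x => B.indicator (fun _ => (1 : ℝ)) x - u x)
      (ContinuousLinearMap.lsmul ℝ ℝ) = μ.toFun B := by
    rw [VectorMeasure.integral_fun_sub ((integrable_const 1).indicator hB) (μ.integrable_restrict u hL), hvB,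
      hu0, sub_zero]
  have hle : ‖μ.toFun B‖ₑ ≤ μ.variation (V \ C) := by
    rw [← hsub]
    refine (enorm_vectorMeasure_integral_le _ _).trans
      ((lintegral_mono' (μ.variation_restrict_le hL) le_rfl).trans ?_)
    calc ∫⁻ x, ‖B.indicator (fun _ => (1 : ℝ)) x - u x‖ₑ ∂μ.variation
        ≤ ∫⁻ x, (V \ C).indicator (fun _ => 1) x ∂μ.variation := by
          refine lintegral_mono fun x => ?_
          have hux : u x = f x := rfl
          by_cases hxC : x ∈ C
          · simp [hCB hxC, hux, hf1 hxC]
          by_cases hxV : x ∈ V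
          · rw [indicator_of_mem (show x ∈ V \ C from ⟨hxV, hxC⟩), hux, ← ofReal_norm, ENNReal.ofReal_le_one,
              Real.norm_eq_abs, abs_le]
            have := hf01 x
            by_cases hxB : x ∈ B
            · rw [indicator_of_mem hxB]; constructor <;> linarith [this.1, this.2]
            · rw [indicator_of_notMem hxB]; constructor <;> linarith [this.1, this.2]
          · have : f x = 0 := image_eq_zero_of_notMem_tsupport fun hx => hxV (hfV hx).1
            rw [indicator_of_notMem fun hx => hxV (hBV hx), hux, this, sub_zero, enorm_zero]
            exact zero_le
      _ = μ.variation (V \ C) := by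
          rw [lintegral_indicator_const (hV.measurableSet.diff hC.measurableSet), one_mul]
  rw [measure_sdiff (hCB.trans hBV) hC.measurableSet.nullMeasurableSet hC.measure_lt_top.ne] at hle
  have h2 : μ.variation V < μ.variation C + ε + ε :=
    hVm.trans_le (add_le_add_left hCm.le _)
  have h3 : ‖μ.toFun B‖ₑ < ε + ε := by
    refine hle.trans_lt (ENNReal.sub_lt_of_lt_add ?_ ?_)
    · exact measure_mono (hCB.trans hBV)
    · rwa [add_comm, ← add_assoc]
  rw [hε, ENNReal.add_halves] at h3
  exact lt_irrefl _ h3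

end Integral

end VectorRadonMeasure

/-! ### A density theorem for measures of controlled growth -/

namespace Stratification

noncomputable section

variable {𝔤 : Type*} [NormedLieRing 𝔤] [NormedLieAlgebra 𝔤] [FiniteDimensional ℝ 𝔤]
  [MeasurableSpace 𝔤] [BorelSpace 𝔤] (S : Stratification 𝔤)

/-- The upper `q`-density of `σ` at `x` is finite. -/
def HasFiniteUpperDensity (q : ℝ) (σ : Measure 𝔤) (x : 𝔤) : Prop :=
  ∃ C : ℕ, ∀ᶠ r : ℝ in 𝓝[>] 0, σ (S.gball x r) ≤ C * ENNReal.ofReal (r ^ q)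

omit [MeasurableSpace 𝔤] [BorelSpace 𝔤] in
/-- The enlargement lemma of Vitali, for homogeneous balls. -/
theorem exists_countable_disjoint_gball_covering :
    ∃ L : ℝ, 0 < L ∧ ∀ (t : Set (𝔤 × ℝ)) (R : ℝ), (∀ a ∈ t, 0 < a.2 ∧ a.2 ≤ R) →
      ∃ u ⊆ t, u.Countable ∧ (u.PairwiseDisjoint fun a => S.gball a.1 a.2) ∧
        ∀ a ∈ t, ∃ b ∈ u, a.1 ∈ S.gball b.1 (L * b.2) := by
  obtain ⟨K, hK1, hK⟩ := S.exists_gball_trans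
  refine ⟨K * 2, by linarith, fun t R ht => ?_⟩
  obtain ⟨u, hut, hdisj, hu⟩ := Vitali.exists_disjoint_subfamily_covering_enlargement
    (fun a : 𝔤 × ℝ => S.gball a.1 a.2) t (fun a => a.2) 2 one_lt_two (fun a ha => (ht a ha).1.le) R
    (fun a ha => (ht a ha).2) (fun a _ => ⟨a.1, S.mem_gball_self _ _⟩)
  refine ⟨u, hut, hdisj.countable_of_isOpen (fun a _ => S.isOpen_gball _ _)
    (fun a _ => ⟨a.1, S.mem_gball_self _ _⟩), hdisj, fun a ha => ?_⟩
  obtain ⟨b, hb, ⟨z, hza, hzb⟩, hab⟩ := hu a ha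
  have hb0 := (ht b (hut hb)).1
  refine ⟨b, hb, ?_⟩
  rw [mul_assoc]
  refine hK (2 * b.2) b.1 z a.1 (by positivity) (S.gball_mono _ hb0 (by linarith) hzb) ?_
  exact S.gball_mono _ (ht a ha).1 hab (S.mem_gball_comm.1 hza)

/-- The restriction of σ to the complement of T does not charge the exceptional set. Cover that set,
inside an open U of small restricted measure, by enlarged disjoint balls. The upper bound controls
the enlarged ball by r^q, and the frequent lower bound controls r^q by the mass of the original ball
outside T; no doubling is needed. -/
theorem measure_setOf_frequently_eq_zero (q : ℝ) (σ : Measure 𝔤) [IsLocallyFiniteMeasure σ]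
    {T : Set 𝔤} (hT : MeasurableSet T) (C N : ℕ) {ρ : ℝ} (hρ : 0 < ρ) :
    σ {x | x ∈ T ∧ (∀ r : ℝ, 0 < r → r < ρ → σ (S.gball x r) ≤ C * ENNReal.ofReal (r ^ q)) ∧
      ∃ᶠ r : ℝ in 𝓝[>] 0, ENNReal.ofReal (r ^ q) < N * σ (S.gball x r \ T)} = 0 := by
  obtain ⟨L, hL, hcov⟩ := S.exists_countable_disjoint_gball_covering
  set E := {x | x ∈ T ∧ (∀ r : ℝ, 0 < r → r < ρ → σ (S.gball x r) ≤ C * ENNReal.ofReal (r ^ q)) ∧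
      ∃ᶠ r : ℝ in 𝓝[>] 0, ENNReal.ofReal (r ^ q) < N * σ (S.gball x r \ T)} with hE
  set τ := σ.restrict Tᶜ with hτ
  have hτE : τ E = 0 := by
    refine measure_mono_null (fun x hx => hx.1) (?_ : τ T = 0)
    rw [hτ, Measure.restrict_apply hT, inter_compl_self, measure_empty]
  set c : ℝ≥0∞ := C * ENNReal.ofReal (L ^ q) * N with hc
  have hctop : c ≠ ∞ := by finiteness
  have key : ∀ η : ℝ≥0∞, η ≠ 0 → σ E ≤ c * η := by
    intro η hη
    obtain ⟨U, hEU, hU, hUm⟩ := E.exists_isOpen_lt_add (μ := τ) (by simp [hτE]) hη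
    rw [hτE, zero_add] at hUm
    set t : Set (𝔤 × ℝ) := {a | a.1 ∈ E ∧ 0 < a.2 ∧ a.2 < ρ / L ∧ S.gball a.1 a.2 ⊆ U ∧
      ENNReal.ofReal (a.2 ^ q) < N * σ (S.gball a.1 a.2 \ T)} with ht
    obtain ⟨u, hut, hucount, hudisj, hu⟩ := hcov t (ρ / L) fun a ha => ⟨ha.2.1, ha.2.2.1.le⟩
    have hEsub : E ⊆ ⋃ a ∈ u, S.gball a.1 (L * a.2) := by
      intro x hx
      obtain ⟨ε, hε, hεU⟩ := S.exists_gball_subset (hU.mem_nhds (hEU hx))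
      have hev : ∀ᶠ r : ℝ in 𝓝[>] 0, r ∈ Ioo 0 (min ε (ρ / L)) :=
        Ioo_mem_nhdsGT (by positivity)
      obtain ⟨r, hr, hr0, hrlt⟩ := (hx.2.2.and_eventually hev).exists
      have hxt : (x, r) ∈ t := ⟨hx, hr0, hrlt.trans_le (min_le_right _ _),
        (S.gball_mono x hr0 (hrlt.le.trans (min_le_left _ _))).trans hεU, hr⟩
      obtain ⟨b, hb, hxb⟩ := hu _ hxt
      exact mem_iUnion₂.2 ⟨b, hb, hxb⟩
    have hball : ∀ a ∈ u, σ (S.gball a.1 (L * a.2)) ≤ c * τ (S.gball a.1 a.2) := by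
      intro a ha
      obtain ⟨hax, ha0, haL, haU, haN⟩ := hut ha
      refine (hax.2.1 (L * a.2) (by positivity) ?_).trans ?_
      · rwa [lt_div_iff₀ hL, mul_comm] at haL
      · rw [Real.mul_rpow hL.le ha0.le, ENNReal.ofReal_mul (by positivity), hc, mul_assoc, mul_assoc,
          hτ, Measure.restrict_apply (S.isOpen_gball _ _).measurableSet, ← sdiff_eq]
        gcongr
    calc σ E ≤ σ (⋃ a ∈ u, S.gball a.1 (L * a.2)) := measure_mono hEsub
      _ ≤ ∑' a : u, σ (S.gball a.1.1 (L * a.1.2)) := measure_biUnion_le σ hucount _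
      _ ≤ ∑' a : u, c * τ (S.gball a.1.1 a.1.2) := ENNReal.tsum_le_tsum fun a => hball a.1 a.2
      _ = c * τ (⋃ a ∈ u, S.gball a.1 a.2) := by
        rw [ENNReal.tsum_mul_left, measure_biUnion hucount hudisj
          fun a _ => (S.isOpen_gball _ _).measurableSet]
      _ ≤ c * τ U := by
        gcongr
        exact iUnion₂_subset fun a ha => (hut ha).2.2.2.1
      _ ≤ c * η := by gcongr
  -- The bound with η = 1 makes the measure finite; a small multiple of that measure taken as η then
  -- gives a contradiction.
  by_contra hpos
  have hd : σ E / (2 * (c + 1)) ≠ 0 := by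
    refine ENNReal.div_ne_zero.2 ⟨hpos, by finiteness⟩
  have hfin : σ E ≠ ∞ := ((key 1 one_ne_zero).trans_lt (by finiteness)).ne
  have h1 := key _ hd
  have h2 : c * (σ E / (2 * (c + 1))) ≤ σ E / 2 := by
    rw [ENNReal.div_eq_inv_mul, ENNReal.mul_inv (by simp) (by simp), ENNReal.div_eq_inv_mul]
    calc c * (2⁻¹ * (c + 1)⁻¹ * σ E) ≤ (c + 1) * (2⁻¹ * (c + 1)⁻¹ * σ E) := by
          gcongr; exact le_self_add
      _ = ((c + 1) * (c + 1)⁻¹) * (2⁻¹ * σ E) := by ring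
      _ = 2⁻¹ * σ E := by rw [ENNReal.mul_inv_cancel (by simp) (by finiteness), one_mul]
  exact absurd (h1.trans h2) (not_le.2 (ENNReal.half_lt_self hpos hfin))

/-- Almost every point of `A` at which the upper density is finite is a density point of the measurable
hull of `A`. -/
theorem ae_density (q : ℝ) (σ : Measure 𝔤) [IsLocallyFiniteMeasure σ] {T : Set 𝔤} (hT : MeasurableSet T) :
    ∀ᵐ x ∂σ, x ∈ T → S.HasFiniteUpperDensity q σ x →
      ∀ N : ℕ, ∀ᶠ r : ℝ in 𝓝[>] 0, N * σ (S.gball x r \ T) ≤ ENNReal.ofReal (r ^ q) := by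
  -- The density bound C, the factor N and the radius 1/(j + 1) run over countable sets, so one null
  -- set serves for all of them.
  have h := fun C N j : ℕ => S.measure_setOf_frequently_eq_zero q σ hT C N
    (Nat.one_div_pos_of_nat (α := ℝ) (n := j))
  simp only [measure_eq_zero_iff_ae_notMem, ← ae_all_iff] at h
  filter_upwards [h] with x hx hxT ⟨C, hC⟩ N
  by_contra hcon
  obtain ⟨ρ, hρ, hρC⟩ := mem_nhdsGT_iff_exists_Ioo_subset.1 hC
  obtain ⟨j, hj⟩ := exists_nat_one_div_lt (show (0 : ℝ) < ρ from hρ)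
  refine hx C N j ⟨hxT, fun r hr hrj => hρC ⟨hr, hrj.trans hj⟩, ?_⟩
  rw [not_eventually] at hcon
  exact hcon.mono fun r hr => not_le.1 hr

omit [BorelSpace 𝔤] in
theorem HasFiniteUpperDensity.of_limsup {k : ℕ} (X : Module.Basis (Fin k) ℝ (S.V 1)) {q : ℝ} {σ : Measure 𝔤}
    {x : 𝔤} (h : limsup (fun r : ℝ => σ (S.ccBall X x r) / ENNReal.ofReal (r ^ q)) (𝓝[>] 0) < ∞) :
    S.HasFiniteUpperDensity q σ x := by
  obtain ⟨M, hM, hMs⟩ := S.exists_ccBall_comparison X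
  obtain ⟨C, hC, hCtop⟩ := exists_between h
  have hev := eventually_lt_of_limsup_lt hC
  obtain ⟨n, hn⟩ := ENNReal.exists_nat_gt (show C * ENNReal.ofReal (M ^ q) ≠ ∞ by finiteness)
  have htend : Tendsto (fun r : ℝ => M * r) (𝓝[>] 0) (𝓝[>] 0) := by
    refine tendsto_nhdsWithin_iff.2 ⟨?_, ?_⟩
    · exact ((continuous_const_mul M).tendsto' 0 0 (mul_zero M)).mono_left nhdsWithin_le_nhds
    · filter_upwards [self_mem_nhdsWithin] with r hr using mul_pos hM hr
  refine ⟨n, ?_⟩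
  filter_upwards [htend.eventually hev, self_mem_nhdsWithin] with r hr hr0
  have hr0' : (0 : ℝ) < r := hr0
  have hq : 0 < (M * r) ^ q := by positivity
  rw [ENNReal.div_lt_iff (Or.inl (by simpa using hq)) (Or.inl ENNReal.ofReal_ne_top)] at hr
  calc σ (S.gball x r) ≤ σ (S.ccBall X x (M * r)) := measure_mono (hMs x r hr0).1
    _ ≤ C * ENNReal.ofReal ((M * r) ^ q) := hr.le
    _ = C * ENNReal.ofReal (M ^ q) * ENNReal.ofReal (r ^ q) := by
      rw [Real.mul_rpow hM.le hr0'.le, ENNReal.ofReal_mul (by positivity), mul_assoc]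
    _ ≤ n * ENNReal.ofReal (r ^ q) := by gcongr

end

end Stratification

/-! ### Rescalings of a vector measure -/

namespace Stratification

noncomputable section

variable {𝔤 : Type*} [NormedLieRing 𝔤] [NormedLieAlgebra 𝔤] [FiniteDimensional ℝ 𝔤]
  (S : Stratification 𝔤)

/-- The composition of a test function with a blow-up map. -/
def blowUpComp (x : 𝔤) {r : ℝ} (hr : r ≠ 0) (u : CompactlySupportedContinuousMap 𝔤 ℝ) :
    CompactlySupportedContinuousMap 𝔤 ℝ :=
  u.comp (S.blowUpHomeomorph x hr).toCocompactMap

variable {S} in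
theorem blowUpComp_apply {x : 𝔤} {r : ℝ} (hr : r ≠ 0) (u : CompactlySupportedContinuousMap 𝔤 ℝ) (z : 𝔤) :
    S.blowUpComp x hr u z = u (S.blowUp x r z) := rfl

/-- Near `y`, the test functions `u ∘ I_{y', s}` have a common bounded support, and they converge
uniformly to `u ∘ I_{y, s}`. -/
theorem exists_eventually_blowUp_close (u : CompactlySupportedContinuousMap 𝔤 ℝ) (y : 𝔤) {s : ℝ}
    (hs : s ≠ 0) :
    ∃ R : ℝ, 0 < R ∧ ∀ ε : ℝ, 0 < ε → ∀ᶠ y' in 𝓝 y, (∀ z, z ∉ S.gball 0 R → u (S.blowUp y' s z) = 0) ∧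
      ∀ z, |u (S.blowUp y' s z) - u (S.blowUp y s z)| ≤ ε := by
  obtain ⟨Y, hY, hYy⟩ := exists_compact_mem_nhds y
  have hcomp : IsCompact ((fun p : 𝔤 × 𝔤 => S.mul p.1 (S.dil s p.2)) '' (Y ×ˢ tsupport u)) :=
    (hY.prod u.hasCompactSupport).image
      (S.continuous_mul'.comp (continuous_fst.prodMk ((S.continuous_dil s).comp continuous_snd)))
  obtain ⟨R, hR1, hR⟩ := S.exists_subset_gball hcomp
  have hR0 : 0 < R := one_pos.trans_le hR1
  have hsupp : ∀ y' ∈ Y, ∀ z, z ∉ S.gball 0 R → u (S.blowUp y' s z) = 0 := by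
    intro y' hy' z hz
    by_contra h
    exact hz (hR ⟨(y', S.blowUp y' s z), ⟨hy', subset_tsupport _ h⟩, S.mul_dil_blowUp y' hs z⟩)
  refine ⟨R, hR0, fun ε hε => ?_⟩
  have hu : Continuous fun p : 𝔤 × 𝔤 => |u (S.blowUp p.1 s p.2) - u (S.blowUp y s p.2)| :=
    ((u.continuous.comp (S.continuous_blowUp_uncurry s)).sub
      (u.continuous.comp ((S.continuous_blowUp y s).comp continuous_snd))).abs
  -- Joint continuity gives closeness near each z; compactness makes the neighbourhood of y uniform
  -- in z.
  have hev := (S.isCompact_closure_gball 0 hR0).eventually_forall_of_forall_eventually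
    (P := fun y' z => |u (S.blowUp y' s z) - u (S.blowUp y s z)| < ε) (x₀ := y)
    fun z _ => hu.continuousAt.eventually_lt continuousAt_const (by simpa using hε)
  filter_upwards [hYy, hev] with y' hy' hy'2
  refine ⟨hsupp y' hy', fun z => ?_⟩
  by_cases hz : z ∈ S.gball 0 R
  · exact (hy'2 z (subset_closure hz)).le
  · rw [hsupp y' hy' z hz, hsupp y (mem_of_mem_nhds hYy) z hz, sub_self, abs_zero]
    exact hε.le

/-- A countable family of test functions which is dense for uniform convergence with supports in a
common ball. -/
theorem exists_dense_testFunctions :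
    ∃ u : ℕ → CompactlySupportedContinuousMap 𝔤 ℝ, ∀ w : CompactlySupportedContinuousMap 𝔤 ℝ,
      ∃ R : ℝ, 0 < R ∧ ∀ ε : ℝ, 0 < ε → ∃ n, ∀ z, (z ∉ S.gball 0 R → u n z = 0 ∧ w z = 0) ∧
        |u n z - w z| ≤ ε := by
  set K : ℕ → Set 𝔤 := fun n => closure (S.gball 0 (n + 1)) with hK
  have hKc : ∀ n, CompactSpace (K n) := fun n =>
    isCompact_iff_compactSpace.1 (S.isCompact_closure_gball 0 (by positivity))
  set ι : ∀ n : ℕ, {u : CompactlySupportedContinuousMap 𝔤 ℝ // ∀ z, z ∉ S.gball 0 (n + 1) → u z = 0} →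
    C(K n, ℝ) := fun n u => (u.1 : C(𝔤, ℝ)).restrict (K n)
  -- Continuous functions on a compact set form a separable space. The dense set is chosen within
  -- the range of restriction, so that its members extend by zero to test functions.
  have hsep : ∀ n, ∃ t : Set C(K n, ℝ), t ⊆ range (ι n) ∧ t.Countable ∧ range (ι n) ⊆ closure t := fun n =>
    (TopologicalSpace.IsSeparable.of_separableSpace (range (ι n))).exists_countable_dense_subset
  choose t ht htc htd using hsep
  have hne : ∀ n : ℕ, Nonempty {u : CompactlySupportedContinuousMap 𝔤 ℝ //
      ∀ z, z ∉ S.gball 0 (n + 1) → u z = 0} := fun n => ⟨⟨0, fun _ _ => rfl⟩⟩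
  choose! g hg using fun n c (hc : c ∈ t n) => ht n hc
  set D : Set (CompactlySupportedContinuousMap 𝔤 ℝ) :=
    ⋃ n, (fun c => (g n c).1) '' (t n) with hD
  have hDc : D.Countable := countable_iUnion fun n => (htc n).image _
  have key : ∀ w : CompactlySupportedContinuousMap 𝔤 ℝ, ∃ R : ℝ, 0 < R ∧ ∀ ε : ℝ, 0 < ε → ∃ v ∈ D, ∀ z,
      (z ∉ S.gball 0 R → v z = 0 ∧ w z = 0) ∧ |v z - w z| ≤ ε := by
    intro w
    obtain ⟨R, hR1, hR⟩ := S.exists_subset_gball w.hasCompactSupport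
    obtain ⟨n, hn⟩ := exists_nat_gt R
    have hw : ∀ z, z ∉ S.gball 0 (n + 1) → w z = 0 := fun z hz =>
      image_eq_zero_of_notMem_tsupport fun h =>
        hz (S.gball_mono 0 (one_pos.trans_le hR1) (by linarith) (hR h))
    refine ⟨n + 1, by positivity, fun ε hε => ?_⟩
    obtain ⟨c, hc, hcd⟩ := Metric.mem_closure_iff.1 (htd n (mem_range_self ⟨w, hw⟩)) ε hε
    refine ⟨(g n c).1, mem_iUnion.2 ⟨n, mem_image_of_mem _ hc⟩, fun z => ⟨fun hz => ⟨(g n c).2 z hz, hw z hz⟩, ?_⟩⟩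
    by_cases hz : z ∈ S.gball 0 (n + 1)
    · have h1 := (ContinuousMap.dist_lt_iff hε).1 hcd ⟨z, subset_closure hz⟩
      rw [← hg n c hc, dist_comm, Real.dist_eq] at h1
      exact h1.le
    · rw [(g n c).2 z hz, hw z hz, sub_self, abs_zero]
      exact hε.le
  have hDne : D.Nonempty := by
    obtain ⟨R, _, h⟩ := key 0
    obtain ⟨v, hv, _⟩ := h 1 one_pos
    exact ⟨v, hv⟩
  obtain ⟨u, hu⟩ := hDc.exists_eq_range hDne
  refine ⟨u, fun w => ?_⟩
  obtain ⟨R, hR, h⟩ := key w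
  refine ⟨R, hR, fun ε hε => ?_⟩
  obtain ⟨v, hv, hvw⟩ := h ε hε
  rw [hu] at hv
  obtain ⟨n, rfl⟩ := hv
  exact ⟨n, hvw⟩

/-! ### Rescaled measures as functionals on test functions -/

variable [MeasurableSpace 𝔤] [BorelSpace 𝔤] {F : Type*} [NormedAddCommGroup F] [NormedSpace ℝ F]
  [FiniteDimensional ℝ F] (q : ℝ) (μ : VectorRadonMeasure 𝔤 F)

/-- The rescaled measure `r ^ (-q) (I_{x, r})_# μ`. -/
def rescale (x : 𝔤) (r : ℝ) : VectorRadonMeasure 𝔤 F := r ^ (-q) • VectorRadonMeasure.map (S.blowUp x r) μ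

omit [FiniteDimensional ℝ F] in
theorem rescale_integral (x : 𝔤) {r : ℝ} (hr : r ≠ 0) (u : CompactlySupportedContinuousMap 𝔤 ℝ) :
    (S.rescale q μ x r).integral u = r ^ (-q) • μ.integral (S.blowUpComp x hr u) := by
  rw [rescale, VectorRadonMeasure.integral_smul_measure]
  congr 1
  exact μ.integral_map (S.blowUpHomeomorph x hr) u

omit [FiniteDimensional ℝ F] in
theorem rescale_mul_dil_integral (x y : 𝔤) {r s : ℝ} (hr : 0 < r) (hs : 0 < s)
    (u : CompactlySupportedContinuousMap 𝔤 ℝ) :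
    (S.rescale q μ (S.mul x (S.dil r y)) (r * s)).integral u =
      s ^ (-q) • (S.rescale q μ x r).integral (S.blowUpComp y hs.ne' u) := by
  rw [rescale_integral _ _ _ _ (mul_pos hr hs).ne', rescale_integral _ _ _ _ hr.ne', smul_smul, Real.mul_rpow hr.le hs.le,
    mul_comm (s ^ (-q))]
  congr 2
  ext z
  simp only [blowUpComp_apply, S.blowUp_blowUp x y z hr.ne']

omit [FiniteDimensional ℝ F] in
-- The support condition is required only almost everywhere, so that A may be a ball with a
-- measurable hull removed.
theorem enorm_rescale_integral_le (x : 𝔤) {r : ℝ} (hr : 0 < r) (u : CompactlySupportedContinuousMap 𝔤 ℝ)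
    {c : ℝ≥0∞} {A : Set 𝔤} (hA : MeasurableSet A) (hc : ∀ z, ‖u z‖ₑ ≤ c)
    (h : ∀ᵐ z ∂μ.variation, z ∉ A → u (S.blowUp x r z) = 0) :
    ‖(S.rescale q μ x r).integral u‖ₑ ≤ c * (ENNReal.ofReal (r ^ (-q)) * μ.variation A) := by
  rw [S.rescale_integral q μ x hr.ne', enorm_smul, Real.enorm_of_nonneg (by positivity), mul_left_comm]
  gcongr
  refine (μ.enorm_integral_le _).trans ?_
  rw [← lintegral_indicator_const hA]
  refine lintegral_mono_ae ?_
  filter_upwards [h] with z hz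
  rw [blowUpComp_apply]
  by_cases hzA : z ∈ A
  · simpa [hzA] using hc _
  · simp [hz hzA]

theorem ofReal_rpow_neg_mul {r : ℝ} (hr : 0 < r) (q : ℝ) :
    ENNReal.ofReal (r ^ (-q)) * ENNReal.ofReal (r ^ q) = 1 := by
  rw [← ENNReal.ofReal_mul (by positivity), ← Real.rpow_add hr, neg_add_cancel, Real.rpow_zero, ENNReal.ofReal_one]

theorem tendsto_mul_nhdsGT_zero {R : ℝ} (hR : 0 < R) :
    Tendsto (fun r : ℝ => r * R) (𝓝[>] 0) (𝓝[>] 0) := by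
  refine tendsto_nhdsWithin_iff.2 ⟨?_, ?_⟩
  · exact ((continuous_mul_const R).tendsto' 0 0 (zero_mul R)).mono_left nhdsWithin_le_nhds
  · filter_upwards [self_mem_nhdsWithin] with r hr using mul_pos hr hR

variable {S q μ}

/-- At a point of finite upper density, the rescaled measures are equicontinuous on test functions
supported in a given ball. -/
theorem HasFiniteUpperDensity.exists_norm_rescale_integral_sub_le {x : 𝔤}
    (hx : S.HasFiniteUpperDensity q μ.variation x) {R : ℝ} (hR : 0 < R) :
    ∃ C : ℝ, 0 ≤ C ∧ ∀ᶠ r : ℝ in 𝓝[>] 0, ∀ (u w : CompactlySupportedContinuousMap 𝔤 ℝ) (ε : ℝ), 0 ≤ ε →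
      (∀ z, (z ∉ S.gball 0 R → u z = 0 ∧ w z = 0) ∧ |u z - w z| ≤ ε) →
      ‖(S.rescale q μ x r).integral u - (S.rescale q μ x r).integral w‖ ≤ C * ε := by
  obtain ⟨C, hC⟩ := hx
  refine ⟨C * R ^ q, by positivity, ?_⟩
  filter_upwards [(tendsto_mul_nhdsGT_zero hR).eventually hC, self_mem_nhdsWithin] with r hr hr0 u w ε hε huw
  have hr0' : (0 : ℝ) < r := hr0
  rw [← VectorRadonMeasure.integral_sub]
  have h1 := S.enorm_rescale_integral_le q μ x hr0 (u - w) (c := ENNReal.ofReal ε)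
    (S.isOpen_gball x (r * R)).measurableSet
    (fun z => by
      rw [← ofReal_norm]
      exact ENNReal.ofReal_le_ofReal (huw z).2)
    (Eventually.of_forall fun z hz => by
      rw [S.mem_gball_iff_blowUp x z hr0] at hz
      have := (huw _).1 hz
      simp [this.1, this.2])
  have h2 : ENNReal.ofReal ε * (ENNReal.ofReal (r ^ (-q)) * μ.variation (S.gball x (r * R))) ≤
      ENNReal.ofReal (C * R ^ q * ε) := by
    calc _ ≤ ENNReal.ofReal ε * (ENNReal.ofReal (r ^ (-q)) * (C * ENNReal.ofReal ((r * R) ^ q))) := by gcongr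
      _ = ENNReal.ofReal ε * ((ENNReal.ofReal (r ^ (-q)) * ENNReal.ofReal (r ^ q)) *
          (C * ENNReal.ofReal (R ^ q))) := by
        rw [Real.mul_rpow hr0'.le hR.le, ENNReal.ofReal_mul (by positivity)]
        ring
      _ = ENNReal.ofReal (C * R ^ q * ε) := by
        rw [ofReal_rpow_neg_mul hr0, one_mul, ENNReal.ofReal_mul (by positivity), ENNReal.ofReal_mul (by positivity),
          ENNReal.ofReal_natCast]
        ring
  have h3 := h1.trans h2
  rw [← ofReal_norm] at h3
  exact (ENNReal.ofReal_le_ofReal_iff (by positivity)).1 h3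

end

end Stratification

/-! ### Tangent measures of tangent measures -/

namespace Stratification

noncomputable section

variable {𝔤 : Type*} [NormedLieRing 𝔤] [NormedLieAlgebra 𝔤] [FiniteDimensional ℝ 𝔤]
  [MeasurableSpace 𝔤] [BorelSpace 𝔤] {S : Stratification 𝔤}
  {F : Type*} [NormedAddCommGroup F] [NormedSpace ℝ F] [FiniteDimensional ℝ F]
  {q : ℝ} {μ ν : VectorRadonMeasure 𝔤 F}

omit [BorelSpace 𝔤] in
theorem measure_ne_zero_of_mem_supp {k : ℕ} {X : Module.Basis (Fin k) ℝ (S.V 1)} {σ : Measure 𝔤} {y : 𝔤}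
    (hy : y ∈ S.supp X σ) {O : Set 𝔤} (hO : O ∈ 𝓝 y) : σ O ≠ 0 := by
  obtain ⟨M, hM, h⟩ := S.exists_ccBall_comparison X
  obtain ⟨ε, hε, hεO⟩ := S.exists_gball_subset hO
  have h1 := (h y (ε / M) (by positivity)).2
  rw [mul_div_cancel₀ _ hM.ne'] at h1
  exact ((hy (ε / M) (by positivity)).trans_le (measure_mono (h1.trans hεO))).ne'

/-- Moving the centre from x · δ_r y to x · δ_r y' replaces the test function u ∘ I_{y,s} by the
uniformly close u ∘ I_{y',s}. Equicontinuity of the rescalings makes the neighbourhood of y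
independent of r. -/
theorem HasFiniteUpperDensity.exists_rescale_close {x : 𝔤} (hx : S.HasFiniteUpperDensity q μ.variation x)
    (u : CompactlySupportedContinuousMap 𝔤 ℝ) (y : 𝔤) {s δ : ℝ} (hs : 0 < s) (hδ : 0 < δ) :
    ∃ O ∈ 𝓝 y, ∀ᶠ r : ℝ in 𝓝[>] 0, ∀ y' ∈ O,
      ‖(S.rescale q μ (S.mul x (S.dil r y')) (r * s)).integral u -
        s ^ (-q) • (S.rescale q μ x r).integral (S.blowUpComp y hs.ne' u)‖ < δ := by
  obtain ⟨R, hR, hclose⟩ := S.exists_eventually_blowUp_close u y hs.ne'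
  obtain ⟨C, hC, hev⟩ := hx.exists_norm_rescale_integral_sub_le hR
  have hsq : 0 < s ^ (-q) := by positivity
  set ε : ℝ := δ / (s ^ (-q) * (C + 1)) with hε
  have hε0 : 0 < ε := by positivity
  refine ⟨_, hclose ε hε0, ?_⟩
  filter_upwards [hev, self_mem_nhdsWithin] with r hr hr0 y' hy'
  have hself := (hclose ε hε0).self_of_nhds
  rw [S.rescale_mul_dil_integral q μ x y' hr0 hs, ← smul_sub, norm_smul, Real.norm_of_nonneg hsq.le]
  have h1 := hr (S.blowUpComp y' hs.ne' u) (S.blowUpComp y hs.ne' u) ε hε0.le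
    fun z => ⟨fun hz => ⟨hy'.1 z hz, hself.1 z hz⟩, hy'.2 z⟩
  calc _ ≤ s ^ (-q) * (C * ε) := by gcongr
    _ < s ^ (-q) * ((C + 1) * ε) := by gcongr; linarith
    _ = δ := by rw [hε]; field_simp

/-- At a density point `x` of `A`, the rescalings of `A` at `x` meet every open set charged by a tangent
measure. -/
theorem eventually_exists_mul_dil_mem {x : 𝔤} {A : Set 𝔤}
    (hx : ∀ N : ℕ, ∀ᶠ r : ℝ in 𝓝[>] 0,
      N * μ.variation (S.gball x r \ toMeasurable μ.variation A) ≤ ENNReal.ofReal (r ^ q))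
    {r : ℕ → ℝ} (hr : Tendsto r atTop (𝓝[>] 0))
    (hν : VectorRadonMeasure.WeakStarTendsto (fun i => S.rescale q μ x (r i)) ν)
    {O : Set 𝔤} (hO : IsOpen O) (hνO : ν.variation O ≠ 0) :
    ∀ᶠ i in atTop, ∃ y ∈ O, S.mul x (S.dil (r i) y) ∈ A := by
  have hlf : IsLocallyFiniteMeasure μ.variation := μ.isLocallyFiniteMeasure_variation
  obtain ⟨w, hwO, hw⟩ := ν.exists_integral_ne_zero hO hνO
  obtain ⟨R, hR1, hR⟩ := S.exists_subset_gball w.hasCompactSupport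
  have hR0 : 0 < R := one_pos.trans_le hR1
  obtain ⟨c, hc⟩ := w.hasCompactSupport.exists_bound_of_continuous w.continuous
  have hc0 : 0 ≤ c := (norm_nonneg _).trans (hc 0)
  -- For this N the mass outside the hull, at most (rR)^q / N, is too small to produce half of the
  -- integral of w against ν.
  obtain ⟨N, hN⟩ := exists_nat_gt (c * R ^ q / (‖ν.integral w‖ / 2))
  have hw0 : 0 < ‖ν.integral w‖ := norm_pos_iff.2 hw
  have hev : ∀ᶠ i in atTop, ‖ν.integral w‖ / 2 < ‖(S.rescale q μ x (r i)).integral w‖ :=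
    (hν w).norm.eventually_const_lt (half_lt_self hw0)
  filter_upwards [hev, hr.eventually ((tendsto_mul_nhdsGT_zero hR0).eventually (hx N)),
    hr.eventually self_mem_nhdsWithin] with i hi hiN hi0
  by_contra! hcon
  have hi0' : (0 : ℝ) < r i := hi0
  set T := toMeasurable μ.variation A
  -- A need not be measurable, but its hull has the same measure as A inside every measurable set,
  -- and A misses this one.
  have hnull : μ.variation (T ∩ S.blowUp x (r i) ⁻¹' O) = 0 := by
    rw [Measure.measure_toMeasurable_inter_of_sFinite
      (hO.preimage (S.continuous_blowUp x (r i))).measurableSet]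
    convert measure_empty (μ := μ.variation)
    refine eq_empty_of_forall_notMem fun z hz => hcon _ hz.2 ?_
    rw [S.mul_dil_blowUp x hi0'.ne']
    exact hz.1
  have h1 := S.enorm_rescale_integral_le q μ x hi0' w (c := ENNReal.ofReal c)
    ((S.isOpen_gball x (r i * R)).measurableSet.diff (measurableSet_toMeasurable μ.variation A))
    (fun z => by rw [← ofReal_norm]; exact ENNReal.ofReal_le_ofReal (hc z))
    (by
      filter_upwards [measure_eq_zero_iff_ae_notMem.1 hnull] with z hz hzA
      refine image_eq_zero_of_notMem_tsupport fun hzw => hzA ⟨?_, fun hzT => hz ⟨hzT, hwO hzw⟩⟩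
      rw [S.mem_gball_iff_blowUp x z hi0']
      exact hR hzw)
  have h2 : ENNReal.ofReal (‖(S.rescale q μ x (r i)).integral w‖ * N) ≤ ENNReal.ofReal (c * R ^ q) := by
    rw [ENNReal.ofReal_mul (norm_nonneg _), ofReal_norm, ENNReal.ofReal_natCast]
    calc _ ≤ ENNReal.ofReal c * (ENNReal.ofReal (r i ^ (-q)) * μ.variation (S.gball x (r i * R) \ T)) * N := by
          gcongr
      _ = ENNReal.ofReal c * (ENNReal.ofReal (r i ^ (-q)) * (N * μ.variation (S.gball x (r i * R) \ T))) := by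
          ring
      _ ≤ ENNReal.ofReal c * (ENNReal.ofReal (r i ^ (-q)) * ENNReal.ofReal ((r i * R) ^ q)) := by gcongr
      _ = ENNReal.ofReal (c * R ^ q) := by
          rw [Real.mul_rpow hi0'.le hR0.le, ENNReal.ofReal_mul (p := r i ^ q) (by positivity), ← mul_assoc (ENNReal.ofReal (r i ^ (-q))),
            ofReal_rpow_neg_mul hi0', one_mul, ENNReal.ofReal_mul hc0]
  have h3 := (ENNReal.ofReal_le_ofReal_iff (by positivity)).1 h2
  rw [div_lt_iff₀ (by positivity)] at hN
  have h4 : (N : ℝ) * (‖ν.integral w‖ / 2) ≤ ‖(S.rescale q μ x (r i)).integral w‖ * N := by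
    rw [mul_comm]
    gcongr
  linarith

/-- The neighbourhood of y on which centres may be moved is charged by ν, so along the blow-up
sequence it contains some y' with x · δ_{r_i} y' in A. That point is x', and its scale is r_i s. -/
theorem exists_mem_rescale_close {k : ℕ} {X : Module.Basis (Fin k) ℝ (S.V 1)} {x : 𝔤} {A : Set 𝔤}
    (hx : S.HasFiniteUpperDensity q μ.variation x)
    (hxA : ∀ N : ℕ, ∀ᶠ r : ℝ in 𝓝[>] 0,
      N * μ.variation (S.gball x r \ toMeasurable μ.variation A) ≤ ENNReal.ofReal (r ^ q))
    (hν : ν ∈ S.Tan q μ x) {y : 𝔤} (hy : y ∈ S.supp X ν.variation) {s δ ρ : ℝ} (hs : 0 < s) (hδ : 0 < δ)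
    (hρ : 0 < ρ) {p : ℕ} (u : Fin p → CompactlySupportedContinuousMap 𝔤 ℝ) :
    ∃ x' ∈ A, ∃ r : ℝ, 0 < r ∧ r < ρ ∧ ∀ j,
      ‖(S.rescale q μ x' r).integral (u j) - (S.rescale q ν y s).integral (u j)‖ < δ := by
  obtain ⟨r, hr0, hr, hrν⟩ := hν
  have hr' : Tendsto r atTop (𝓝[>] 0) := tendsto_nhdsWithin_iff.2 ⟨hr, Eventually.of_forall hr0⟩
  choose O hO hOev using fun j => hx.exists_rescale_close (u j) y hs (half_pos hδ)
  have hON : (⋂ j, O j) ∈ 𝓝 y := iInter_mem.2 hO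
  have hmeet := eventually_exists_mul_dil_mem hxA hr' hrν isOpen_interior
    (measure_ne_zero_of_mem_supp hy (interior_mem_nhds.2 hON))
  have hlim : ∀ j, ∀ᶠ i in atTop, ‖s ^ (-q) • (S.rescale q μ x (r i)).integral (S.blowUpComp y hs.ne' (u j)) -
      (S.rescale q ν y s).integral (u j)‖ < δ / 2 := by
    intro j
    rw [S.rescale_integral q ν y hs.ne']
    have h := ((hrν (S.blowUpComp y hs.ne' (u j))).const_smul (s ^ (-q))).eventually
      (Metric.ball_mem_nhds _ (half_pos hδ))
    filter_upwards [h] with i hi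
    rw [dist_eq_norm] at hi
    exact hi
  have hsmall := hr'.eventually ((tendsto_mul_nhdsGT_zero hs).eventually (Ioo_mem_nhdsGT hρ))
  obtain ⟨i, ⟨y', hy', hy'A⟩, hi1, hi2, hi3⟩ := (hmeet.and ((eventually_all.2 hlim).and
    ((hr'.eventually (eventually_all.2 hOev)).and hsmall))).exists
  refine ⟨_, hy'A, r i * s, hi3.1, hi3.2, fun j => ?_⟩
  calc _ ≤ _ := norm_sub_le_norm_sub_add_norm_sub _
        (s ^ (-q) • (S.rescale q μ x (r i)).integral (S.blowUpComp y hs.ne' (u j))) _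
    _ < δ / 2 + δ / 2 := add_lt_add (hi2 j y' (mem_iInter.1 (interior_subset hy') j)) (hi1 j)
    _ = δ := add_halves δ

theorem ae_forall_tangent_rescale_close {k : ℕ} (X : Module.Basis (Fin k) ℝ (S.V 1))
    (q : ℝ) (μ : VectorRadonMeasure 𝔤 F) (u : ℕ → CompactlySupportedContinuousMap 𝔤 ℝ) :
    ∀ᵐ x ∂μ.variation, S.HasFiniteUpperDensity q μ.variation x → ∀ ν ∈ S.Tan q μ x,
      ∀ y ∈ S.supp X ν.variation, ∀ s : ℝ, 0 < s → ∀ p : ℕ, ∃ r : ℝ, 0 < r ∧ r < 1 / ((p : ℝ) + 1) ∧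
        ∀ j : Fin p, ‖(S.rescale q μ x r).integral (u j) - (S.rescale q ν y s).integral (u j)‖ <
          4 * (1 / ((p : ℝ) + 1)) := by
  have hlf : IsLocallyFiniteMeasure μ.variation := μ.isLocallyFiniteMeasure_variation
  -- Bad points are sorted by precision and by an approximate value c from a countable dense set.
  -- Since c is common to all points of A, the contradiction may be drawn at a point x' other than
  -- x.
  set A : ∀ p : ℕ, (Fin p → F) → Set 𝔤 := fun p c => {x | (∃ ν ∈ S.Tan q μ x, ∃ y ∈ S.supp X ν.variation,
    ∃ s : ℝ, 0 < s ∧ ∀ j : Fin p, ‖(S.rescale q ν y s).integral (u j) - c j‖ < 1 / ((p : ℝ) + 1)) ∧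
    ∀ r : ℝ, 0 < r → r < 1 / ((p : ℝ) + 1) → ∃ j : Fin p,
      2 * (1 / ((p : ℝ) + 1)) ≤ ‖(S.rescale q μ x r).integral (u j) - c j‖} with hA
  have hδ : ∀ p : ℕ, 0 < 1 / ((p : ℝ) + 1) := fun p => Nat.one_div_pos_of_nat
  have hnot : ∀ p n : ℕ, ∀ᵐ x ∂μ.variation, S.HasFiniteUpperDensity q μ.variation x →
      x ∉ A p (TopologicalSpace.denseSeq (Fin p → F) n) := by
    intro p n
    set c := TopologicalSpace.denseSeq (Fin p → F) n
    filter_upwards [S.ae_density q μ.variation (measurableSet_toMeasurable μ.variation (A p c))]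
      with x hxd hx hxA
    obtain ⟨ν, hν, y, hy, s, hs, hc⟩ := hxA.1
    obtain ⟨x', hx'A, r, hr0, hr, hclose⟩ := exists_mem_rescale_close hx
      (hxd (subset_toMeasurable _ _ hxA) hx) hν hy hs (hδ p) (hδ p) fun j : Fin p => u j
    obtain ⟨j, hj⟩ := hx'A.2 r hr0 hr
    refine absurd hj (not_le.2 ?_)
    rw [two_mul]
    exact (norm_sub_le_norm_sub_add_norm_sub _ _ _).trans_lt (add_lt_add (hclose j) (hc j))
  simp only [← ae_all_iff] at hnot
  filter_upwards [hnot] with x hxn hx ν hν y hy s hs p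
  obtain ⟨n, hn⟩ := (TopologicalSpace.denseRange_denseSeq (Fin p → F)).exists_dist_lt
    (fun j : Fin p => (S.rescale q ν y s).integral (u j)) (hδ p)
  set c := TopologicalSpace.denseSeq (Fin p → F) n
  have hc : ∀ j : Fin p, ‖(S.rescale q ν y s).integral (u j) - c j‖ < 1 / ((p : ℝ) + 1) := fun j => by
    rw [← dist_eq_norm]
    exact (dist_le_pi_dist _ _ j).trans_lt hn
  -- Being 4/(p + 1) away from ν_{y,s}, which is within 1/(p + 1) of c, leaves a distance of at
  -- least 2/(p + 1) from c, as A demands. The factor 3 would also do.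
  by_contra! hcon
  refine hxn p n hx ⟨⟨ν, hν, y, hy, s, hs, hc⟩, fun r hr0 hr => ?_⟩
  obtain ⟨j, hj⟩ := hcon r hr0 hr
  refine ⟨j, ?_⟩
  have h1 := norm_sub_le_norm_sub_add_norm_sub ((S.rescale q μ x r).integral (u j)) (c j)
    ((S.rescale q ν y s).integral (u j))
  rw [norm_sub_rev (c j)] at h1
  linarith [hc j, hδ p]

/-- A weak-* limit may be tested on a dense family of test functions. -/
theorem weakStarTendsto_rescale_of_dense {u : ℕ → CompactlySupportedContinuousMap 𝔤 ℝ}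
    (hu : ∀ w : CompactlySupportedContinuousMap 𝔤 ℝ, ∃ R : ℝ, 0 < R ∧ ∀ ε : ℝ, 0 < ε → ∃ n, ∀ z,
      (z ∉ S.gball 0 R → u n z = 0 ∧ w z = 0) ∧ |u n z - w z| ≤ ε)
    {x : 𝔤} (hx : S.HasFiniteUpperDensity q μ.variation x) {r : ℕ → ℝ} (hr : Tendsto r atTop (𝓝[>] 0))
    (h : ∀ n, Tendsto (fun i => (S.rescale q μ x (r i)).integral (u n)) atTop (𝓝 (ν.integral (u n)))) :
    VectorRadonMeasure.WeakStarTendsto (fun i => S.rescale q μ x (r i)) ν := by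
  intro w
  obtain ⟨R, hR, hw⟩ := hu w
  obtain ⟨C, hC, hev⟩ := hx.exists_norm_rescale_integral_sub_le hR
  set V : ℝ := (ν.variation (S.gball 0 R)).toReal with hV
  have hVtop : ν.variation (S.gball 0 R) ≠ ∞ :=
    (ν.variation_lt_top ⟨(S.isOpen_gball 0 R).measurableSet, S.isCompact_closure_gball 0 hR⟩).ne
  have hV0 : 0 ≤ V := ENNReal.toReal_nonneg
  rw [Metric.tendsto_atTop']
  intro δ hδ
  -- C bounds the rescalings and V the limit on the common ball; replacing w by u n costs at most
  -- δ/3 on each side.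
  set ε : ℝ := δ / 3 / (C + V + 1) with hε
  have hε0 : 0 < ε := by positivity
  have hCε : C * ε ≤ δ / 3 := by
    rw [hε, mul_div_assoc', div_le_iff₀ (by positivity)]
    nlinarith
  have hVε : ε * V ≤ δ / 3 := by
    rw [hε, div_mul_eq_mul_div, div_le_iff₀ (by positivity)]
    nlinarith
  obtain ⟨n, hn⟩ := hw ε hε0
  have h1 : ‖ν.integral (u n) - ν.integral w‖ ≤ ε * V := by
    have := ν.enorm_integral_sub_le (u n) w (ε := ENNReal.ofReal ε) (S.isOpen_gball 0 R).measurableSet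
      (fun z _ => by rw [← ofReal_norm]; exact ENNReal.ofReal_le_ofReal (hn z).2) (fun z => (hn z).1)
    rw [← ENNReal.ofReal_toReal hVtop, ← ENNReal.ofReal_mul hε0.le, ← ofReal_norm] at this
    exact (ENNReal.ofReal_le_ofReal_iff (by positivity)).1 this
  have h2 := (h n).eventually (Metric.ball_mem_nhds _ (show 0 < δ / 3 by positivity))
  obtain ⟨i₀, hi₀⟩ := eventually_atTop.1 (h2.and (hr.eventually hev))
  refine ⟨i₀, fun i hi => ?_⟩
  obtain ⟨h3, h4⟩ := hi₀ i hi.le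
  have h5 := h4 (u n) w ε hε0.le hn
  rw [dist_eq_norm] at h3
  rw [dist_eq_norm]
  have e : (S.rescale q μ x (r i)).integral w - ν.integral w =
      ((S.rescale q μ x (r i)).integral (u n) - ν.integral (u n)) -
      ((S.rescale q μ x (r i)).integral (u n) - (S.rescale q μ x (r i)).integral w) +
      (ν.integral (u n) - ν.integral w) := by abel
  rw [e]
  refine (norm_add_le _ _).trans_lt ?_
  have := norm_sub_le ((S.rescale q μ x (r i)).integral (u n) - ν.integral (u n))
    ((S.rescale q μ x (r i)).integral (u n) - (S.rescale q μ x (r i)).integral w)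
  linarith

/-- If ν_{y,s_p} → κ, choose r_p < 1/(p + 1) such that μ_{x,r_p} agrees with ν_{y,s_p} up to 4/(p +
1) on the first p functions of a dense family. Each function of the family is tested from some p on,
and density does the rest. -/
theorem ae_Tan_subset_Tan {k : ℕ} (X : Module.Basis (Fin k) ℝ (S.V 1)) (q : ℝ) (μ : VectorRadonMeasure 𝔤 F)
    (hμ : ∀ᵐ x ∂μ.variation, S.HasFiniteUpperDensity q μ.variation x) :
    ∀ᵐ x ∂μ.variation, ∀ ν ∈ S.Tan q μ x, ∀ y ∈ S.supp X ν.variation, S.Tan q ν y ⊆ S.Tan q μ x := by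
  obtain ⟨u, hu⟩ := S.exists_dense_testFunctions
  filter_upwards [hμ, ae_forall_tangent_rescale_close X q μ u] with x hx hxu ν hν y hy κ hκ
  obtain ⟨s, hs0, hs, hsκ⟩ := hκ
  choose r hr0 hr hru using fun p => hxu hx ν hν y hy (s p) (hs0 p) p
  have hrlim : Tendsto r atTop (𝓝 0) :=
    squeeze_zero (fun p => (hr0 p).le) (fun p => (hr p).le) tendsto_one_div_add_atTop_nhds_zero_nat
  refine ⟨r, hr0, hrlim, weakStarTendsto_rescale_of_dense hu hx
    (tendsto_nhdsWithin_iff.2 ⟨hrlim, Eventually.of_forall hr0⟩) fun n => ?_⟩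
  have h1 : Tendsto (fun p => (S.rescale q μ x (r p)).integral (u n) - (S.rescale q ν y (s p)).integral (u n))
      atTop (𝓝 0) := by
    refine squeeze_zero_norm' (a := fun p : ℕ => 4 * (1 / ((p : ℝ) + 1))) ?_ ?_
    · filter_upwards [eventually_gt_atTop n] with p hp using (hru p ⟨n, hp⟩).le
    · simpa using (tendsto_one_div_add_atTop_nhds_zero_nat (𝕜 := ℝ)).const_mul 4
  have h2 : Tendsto (fun p => (S.rescale q ν y (s p)).integral (u n)) atTop (𝓝 (κ.integral (u n))) := hsκ (u n)
  simpa using h1.add h2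

end

end Stratification

theorem mainTheorem4 {𝔤 : Type*} [NormedLieRing 𝔤] [NormedLieAlgebra 𝔤] [FiniteDimensional ℝ 𝔤]
    [MeasurableSpace 𝔤] [BorelSpace 𝔤] (S : Stratification 𝔤)
    {k : ℕ} (X : Module.Basis (Fin k) ℝ (S.V 1)) (q : ℝ) (m : ℕ)
    (μ : VectorRadonMeasure 𝔤 (EuclideanSpace ℝ (Fin m))) (hμ : S.AsymptoticallyRegular X q μ) :
    ∀ᵐ x ∂μ.variation, ∀ ν ∈ S.Tan q μ x, ∀ y ∈ S.supp X ν.variation,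
      S.Tan q ν y ⊆ S.Tan q μ x :=
  Stratification.ae_Tan_subset_Tan X q μ
    (hμ.mono fun _ hx => Stratification.HasFiniteUpperDensity.of_limsup S X hx.2)
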